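/- Let $\mathbb{F}_q$ be a finite field with $q$ elements, let $S$ be a locally noetherian scheme over $\mathbb{F}_q$, and let $\mathcal{L}$ be an invertible sheaf on $S$. For an invertible sheaf $\mathcal{M}$ on $S$, the contravariant functor $(f:T\to S)\mapsto H^0(T,f^*\mathcal{M})$ from $S$-schemes to $\mathbb{F}_q$-vector spaces is representable; denote by $\mathbb{G}_{a,\mathcal{M}}$ the $S$-scheme that represents it, with its structure of $\mathbb{F}_q$-vector space object (the line bundle of $\mathcal{M}$). An $\mathbb{F}_q$-morphism $\mathbb{G}_{a,\mathcal{L}}\to\mathbb{G}_{a,\mathcal{M}}$ is a homomorphism of group schemes over $S$ that commutes with the actions of $\mathbb{F}_q$. A sequence $0\to X\to Y\to Z\to 0$ of group schemes over $S$ is exact if for every group scheme $T$ over $S$ the sequences $0\to\operatorname{Hom}(T,X)\to\operatorname{Hom}(T,Y)\to\operatorname{Hom}(T,Z)$ and $0\to\operatorname{Hom}(Z,T)\to\operatorname{Hom}(Y,T)\to\operatorname{Hom}(X,T)$ of homomorphisms over $S$ are exact (exactness means that the first map is injective and that its image is the set of those homomorphisms which become trivial under the second map). Let $G\subset\mathbb{G}_{a,\mathcal{L}}$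 be a finite flat $\mathbb{F}_q$-subgroup scheme, that is, a subgroup scheme, finite and flat over $S$, which is stable under the action of $\mathbb{F}_q$, and whose rank at every point of $S$ is a power $q^n$ of $q$ (with $n\ge 0$ depending on the point). Then: (1) There are an invertible sheaf $\mathcal{M}$ on $S$ and an $\mathbb{F}_q$-morphism $\xi:\mathbb{G}_{a,\mathcal{L}}\to\mathbb{G}_{a,\mathcal{M}}$ such that $0\to G\to\mathbb{G}_{a,\mathcal{L}}\xrightarrow{\ \xi\ }\mathbb{G}_{a,\mathcal{M}}\to 0$ is an exact sequence of group schemes over $S$. (2) The pair $(\mathcal{M},\xi)$ is unique up to a unique isomorphism: if $(\mathcal{M}',\xi')$ is another such pair, there is exactly one isomorphism $\theta:\mathbb{G}_{a,\mathcal{M}}\to\mathbb{G}_{a,\mathcal{M}'}$ of $S$-schemes that is an $\mathbb{F}_q$-morphism and satisfies $\theta\circ\xi=\xi'$. (3) If $S$ is connected, then $G$ has a constant rank $r$ over $S$, and for every pair $(\mathcal{M},\xi)$ as in (1) one has $\mathcal{M}\cong\mathcal{L}^{\otimes r}$, and $\xi$ is finite and flat of constant rank $r$. -/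

import Mathlib

universe u

open CategoryTheory Limits AlgebraicGeometry MonoidalCategory

noncomputable section

namespace FqBundle

variable {S : Scheme.{u}}

/-- The structure sheaf of a scheme, as a sheaf of modules over itself. -/
abbrev structureModule (X : Scheme.{u}) : X.Modules :=
  SheafOfModules.unit.{u} X.ringCatSheaf

/-- Invertible sheaves: sheaves of modules that are locally isomorphic to the structure sheaf. -/
def IsInvertible (L : S.Modules) : Prop :=
  ∀ x : S, ∃ U : S.Opens, x ∈ U ∧ Nonempty (L.restrict U.ι ≅ structureModule U)

/-- The `n`-fold tensor power in the category of presheaves of modules. -/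
def presheafTensorPow (P : PresheafOfModules.{u} (S.presheaf ⋙ forget₂ CommRingCat RingCat)) :
    ℕ → PresheafOfModules.{u} (S.presheaf ⋙ forget₂ CommRingCat RingCat)
  | 0 => 𝟙_ _
  | n + 1 => presheafTensorPow P n ⊗ P

/-- The tensor power `L^{⊗ n}` of a sheaf of modules: the sheaf of modules associated with the
presheaf `U ↦ Γ(L, U)^{⊗ n}` (tensor products over `Γ(S, U)`). -/
def tensorPow (L : S.Modules) (n : ℕ) : S.Modules :=
  (PresheafOfModules.sheafification (𝟙 S.ringCatSheaf.obj)).obj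
    (presheafTensorPow (S := S) ((Scheme.Modules.toPresheafOfModules S).obj L) n)

/-- For a morphism `g : T' ⟶ T` of `S`-schemes, with structure morphisms `f : T ⟶ S` and
`f' : T' ⟶ S`, the canonical morphism `f^* L ⟶ g_* (f'^* L)`. It is the adjoint of
the unit `L ⟶ f'_* f'^* L = f_* g_* f'^* L`. -/
def baseChangeHom (L : S.Modules) {T T' : Scheme.{u}} (f : T ⟶ S) (f' : T' ⟶ S) (g : T' ⟶ T)
    (w : g ≫ f = f') :
    (Scheme.Modules.pullback f).obj L ⟶
      (Scheme.Modules.pushforward g).obj ((Scheme.Modules.pullback f').obj L) :=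
  ((Scheme.Modules.pullbackPushforwardAdjunction f).homEquiv _ _).symm
    ((Scheme.Modules.pullbackPushforwardAdjunction f').unit.app L ≫
      (Scheme.Modules.pushforwardCongr w.symm).hom.app _ ≫
      (Scheme.Modules.pushforwardComp g f).inv.app _)

lemma baseChangeHom_id (L : S.Modules) {T : Scheme.{u}} (f : T ⟶ S) (w : 𝟙 T ≫ f = f) :
    baseChangeHom L f f (𝟙 T) w = (Scheme.Modules.pushforwardId _).inv.app _ := by
  unfold baseChangeHom
  rw [Equiv.symm_apply_eq, Adjunction.homEquiv_unit]
  congr 1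
  ext U x
  exact congr($(((Scheme.Modules.pullback f).obj L).presheaf.map_id (.op (f ⁻¹ᵁ U))) x)

lemma baseChangeHom_unit (L : S.Modules) {T T' : Scheme.{u}} (f : T ⟶ S) (f' : T' ⟶ S)
    (g : T' ⟶ T) (w : g ≫ f = f') :
    (Scheme.Modules.pullbackPushforwardAdjunction f).unit.app L ≫
      (Scheme.Modules.pushforward f).map (baseChangeHom L f f' g w) =
    (Scheme.Modules.pullbackPushforwardAdjunction f').unit.app L ≫
      (Scheme.Modules.pushforwardCongr w.symm).hom.app _ ≫
      (Scheme.Modules.pushforwardComp g f).inv.app _ := by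
  have := (Scheme.Modules.pullbackPushforwardAdjunction f).homEquiv_unit
    (f := baseChangeHom L f f' g w)
  rw [baseChangeHom, Equiv.apply_symm_apply] at this
  exact this.symm

lemma baseChangeHom_comp (L : S.Modules) {T T' T'' : Scheme.{u}} (f : T ⟶ S) (f' : T' ⟶ S)
    (f'' : T'' ⟶ S) (g : T' ⟶ T) (h : T'' ⟶ T') (w : g ≫ f = f') (w' : h ≫ f' = f'')
    (w'' : (h ≫ g) ≫ f = f'') :
    baseChangeHom L f f'' (h ≫ g) w'' = baseChangeHom L f f' g w ≫
      (Scheme.Modules.pushforward g).map (baseChangeHom L f' f'' h w') ≫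
      (Scheme.Modules.pushforwardComp h g).hom.app _ := by
  subst w w'
  conv_lhs => unfold baseChangeHom
  rw [Equiv.symm_apply_eq, Adjunction.homEquiv_unit]
  have k1 := baseChangeHom_unit L (g ≫ f) _ h rfl
  have k2 := baseChangeHom_unit L f _ g rfl
  ext U : 1
  have h1 := congr(Scheme.Modules.Hom.app $k1 U)
  have h2 := congr(Scheme.Modules.Hom.app $k2 U)
  simp only [Scheme.Modules.Hom.comp_app, Scheme.Modules.pushforward_map_app,
    Scheme.Modules.pushforwardCongr_hom_app_app, Scheme.Modules.pushforwardComp_inv_app_app,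
    Scheme.Modules.pushforwardComp_hom_app_app, Functor.map_comp] at h1 h2 ⊢
  have i1 := ((Scheme.Modules.pullback (g ≫ f)).obj L).presheaf.map_id
    (.op ((g ≫ f) ⁻¹ᵁ U))
  have i2 := ((Scheme.Modules.pullback (h ≫ g ≫ f)).obj L).presheaf.map_id
    (.op ((h ≫ g ≫ f) ⁻¹ᵁ U))
  refine (congrArg (fun a => Scheme.Modules.Hom.app
    ((Scheme.Modules.pullbackPushforwardAdjunction (h ≫ g ≫ f)).unit.app L) U ≫ a) i2).trans ?_
  replace h1 := h1.trans (congrArg (fun a => Scheme.Modules.Hom.app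
    ((Scheme.Modules.pullbackPushforwardAdjunction (h ≫ g ≫ f)).unit.app L) U ≫ a) i2)
  replace h2 := h2.trans (congrArg (fun a => Scheme.Modules.Hom.app
    ((Scheme.Modules.pullbackPushforwardAdjunction (g ≫ f)).unit.app L) U ≫ a) i1)
  ext x
  have h1' := congr($h1 x)
  have h2' := congr($h2 x)
  exact h1'.symm.trans (congrArg (fun y => Scheme.Modules.Hom.app
    (baseChangeHom L (g ≫ f) (h ≫ g ≫ f) h rfl) (g ⁻¹ᵁ f ⁻¹ᵁ U) y) h2').symm

/-- The ring homomorphism `k → Γ(T, 𝒪_T)` for an `S`-scheme `T`, where `S` is a scheme over `k`. -/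
def scalars {k : Type u} [Field k] (s : S ⟶ Spec (.of k)) (T : Over S) : k →+* Γ(T.left, ⊤) :=
  ((Scheme.ΓSpecIso (.of k)).inv ≫ (T.hom ≫ s).appTop).hom

/-- The global sections `H⁰(T, f^* L)` for an `S`-scheme `f : T ⟶ S`. -/
def Sections {k : Type u} [Field k] (_s : S ⟶ Spec (.of k)) (L : S.Modules) (T : Over S) :
    Type u :=
  Γ((Scheme.Modules.pullback T.hom).obj L, ⊤)

section

variable {k : Type u} [Field k] (s : S ⟶ Spec (.of k)) (L : S.Modules)

instance (T : Over S) : AddCommGroup (Sections s L T) :=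
  inferInstanceAs (AddCommGroup Γ((Scheme.Modules.pullback T.hom).obj L, ⊤))

/-- `k` acts on `H⁰(T, f^* L)` through `k → Γ(T, 𝒪_T)`. -/
instance (T : Over S) : Module k (Sections s L T) :=
  Module.compHom Γ((Scheme.Modules.pullback T.hom).obj L, ⊤) (scalars s T)

lemma scalars_comp {T T' : Over S} (g : T' ⟶ T) (c : k) :
    g.left.appTop (scalars s T c) = scalars s T' c := by
  have : (T'.hom ≫ s).appTop = (T.hom ≫ s).appTop ≫ g.left.appTop := by
    rw [← Scheme.Hom.comp_appTop, ← Category.assoc, Over.w]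
  simp [scalars, this]

/-- The pullback of sections along a morphism `g : T' ⟶ T` of `S`-schemes. -/
def Sections.map {T T' : Over S} (g : T' ⟶ T) : Sections s L T →ₗ[k] Sections s L T' where
  toFun := (baseChangeHom L T.hom T'.hom g.left (Over.w g)).app ⊤
  map_add' x y := map_add ((baseChangeHom L T.hom T'.hom g.left (Over.w g)).app ⊤).hom x y
  map_smul' c x := by
    refine (Scheme.Modules.Hom.app_smul (baseChangeHom L T.hom T'.hom g.left (Over.w g)) (scalars s T c) x).trans ?_
    rw [RingHom.id_apply]
    let y : Γ((Scheme.Modules.pullback T'.hom).obj L, ⊤) :=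
      (baseChangeHom L T.hom T'.hom g.left (Over.w g)).app ⊤ x
    exact congrArg (fun a : Γ(T'.left, ⊤) => a • y) (scalars_comp s g c)

/-- The contravariant functor `(f : T ⟶ S) ↦ H⁰(T, f^* L)` from `S`-schemes to
`k`-vector spaces. -/
def sectionsFunctor : (Over S)ᵒᵖ ⥤ ModuleCat.{u} k where
  obj T := ModuleCat.of k (Sections s L T.unop)
  map g := ModuleCat.ofHom (Sections.map s L g.unop)
  map_id T := by
    ext x
    exact congr($(congr(Scheme.Modules.Hom.app
      $(baseChangeHom_id L T.unop.hom (Over.w (𝟙 T.unop))) ⊤)) x)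
  map_comp g h := by
    ext x
    exact congr($(congr(Scheme.Modules.Hom.app
      $(baseChangeHom_comp L _ _ _ g.unop.left h.unop.left (Over.w g.unop) (Over.w h.unop)
        (Over.w (h.unop ≫ g.unop))) ⊤)) x)

/-- A line bundle `𝔾_{a,L}`: an `S`-scheme that represents the functor
`(f : T ⟶ S) ↦ H⁰(T, f^* L)`. It is determined by `L` up to a unique isomorphism. -/
structure LineBundle where
  /-- The underlying `S`-scheme. -/
  X : Over S
  /-- The natural bijections `Hom_S(T, X) ≃ H⁰(T, f^* L)`. -/
  rep : (sectionsFunctor s L ⋙ forget (ModuleCat.{u} k)).RepresentableBy X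

end

namespace LineBundle

variable {k : Type u} [Field k] {s : S ⟶ Spec (.of k)} {L M : S.Modules}

/-- The group scheme structure of `𝔾_{a,L}`, which on `T`-valued points is the addition of
`H⁰(T, f^* L)`. -/
instance (V : LineBundle s L) : AddGrpObj V.X :=
  AddGrpObj.ofRepresentableBy V.X
    (sectionsFunctor s L ⋙ forget₂ (ModuleCat.{u} k) AddCommGrpCat.{u} ⋙
      forget₂ AddCommGrpCat.{u} AddGrpCat.{u}) V.rep

/-- The action of `c : k` on `𝔾_{a,L}`, which on `T`-valued points is the multiplication by `c`
on `H⁰(T, f^* L)`. -/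
def smul (V : LineBundle s L) (c : k) : V.X ⟶ V.X :=
  V.rep.homEquiv.symm (c • (V.rep.homEquiv (𝟙 V.X) : Sections s L V.X) : Sections s L V.X)

/-- `k`-linear homomorphisms of group schemes between line bundles. -/
structure IsFqHom (V : LineBundle s L) (W : LineBundle s M) (ξ : V.X ⟶ W.X) : Prop where
  isHom : IsAddMonHom ξ
  smul_comp : ∀ c : k, V.smul c ≫ ξ = ξ ≫ W.smul c

/-- Finite flat subgroup schemes `i : G ⟶ 𝔾_{a,L}` that are stable under the action of `k`. -/
structure IsFiniteFlatFqSubgroup (V : LineBundle s L) {G : Over S} [AddGrpObj G]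
    (i : G ⟶ V.X) : Prop where
  mono : Mono i
  isHom : IsAddMonHom i
  finite : IsFinite G.hom
  flat : Flat G.hom
  stable : ∀ c : k, ∃ a : G ⟶ G, a ≫ i = i ≫ V.smul c

end LineBundle

open scoped AddMonObj in
/-- Short exact sequences `0 ⟶ X ⟶ Y ⟶ Z ⟶ 0` of group schemes over `S`: for every group scheme
`T` over `S` the sequences of groups of homomorphisms `0 ⟶ Hom(T, X) ⟶ Hom(T, Y) ⟶ Hom(T, Z)` and
`0 ⟶ Hom(Z, T) ⟶ Hom(Y, T) ⟶ Hom(X, T)` are exact. Here `0` is the trivial homomorphism. -/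
structure IsShortExact {X Y Z : Over S} [AddGrpObj X] [AddGrpObj Y] [AddGrpObj Z]
    (i : X ⟶ Y) (p : Y ⟶ Z) : Prop where
  left_inj : ∀ (T : Over S) [AddGrpObj T] (a b : T ⟶ X), IsAddMonHom a → IsAddMonHom b →
    a ≫ i = b ≫ i → a = b
  left_exact : ∀ (T : Over S) [AddGrpObj T] (f : T ⟶ Y), IsAddMonHom f →
    (f ≫ p = 0 ↔ ∃ a : T ⟶ X, IsAddMonHom a ∧ a ≫ i = f)
  right_inj : ∀ (T : Over S) [AddGrpObj T] (a b : Z ⟶ T), IsAddMonHom a → IsAddMonHom b →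
    p ≫ a = p ≫ b → a = b
  right_exact : ∀ (T : Over S) [AddGrpObj T] (f : Y ⟶ T), IsAddMonHom f →
    (i ≫ f = 0 ↔ ∃ a : Z ⟶ T, IsAddMonHom a ∧ p ≫ a = f)

end FqBundle

end

/-! Locally `G` is the zero set of one additive polynomial, and that polynomial is the quotient map.
Over a chart Spec A of S with a generator of L, the bundle is the affine line and `G` is Spec B with
B finite flat over A, of rank r say. As `G` is a subobject, A[X] → B is an epimorphism of rings; it
is finite, hence surjective. By Cayley–Hamilton B = A[X]/(P) with P monic of degree r
(`exists_monic_aeval_eq_zero_iff`, `exists_isEqn`).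

The properties of P rest on one principle: two polynomials of degree r with the same leading
coefficient agree if a monic polynomial of degree r divides both. The roots of P are stable under
addition, so P(X + x) = P(X) for the universal root x, and P is additive (`eval₂_add_of_monic`). If
two generators of L differ by u, then P(uX) = u^r P'(X) (`eval₂_mul_of_monic`). For u = c in F_q and
r = q^n this reads P(cX) = cP(X). For a transition unit u of L it says that the maps X ↦ P(X) glue
to a morphism ξ into the bundle with transition units u^r, which is that of L^{⊗r}
(`PowerCharts.exists_isModel`).

The kernel of ξ is `G`. Since A[X] is free of rank r over A[P], ξ is finite and flat of rank r ≥ 1,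
hence surjective (`finite_flat_finrank_of_monic`). A faithfully flat quasi-compact homomorphism is
an effective epimorphism, so it is the quotient by its kernel (`isShortExact_of_flat`). Uniqueness
is then formal (`existsUnique_iso`).

For (3), an arbitrary pair is compared with the constructed one. The isomorphism of line bundles
obtained in this way is additive but perhaps not linear over functions; its linear part, visible on
elements of square zero, is an isomorphism of invertible sheaves (`nonempty_iso_of_lineBundle_iso`).
Over a disconnected base the rank is only locally constant, and M is put together from tensor powers
on the open and closed sets of constant rank (`locPow`). Line bundles themselves exist by gluing
affine lines (`nonempty_lineBundle`). -/

noncomputable section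

namespace FqBundle

variable {S : Scheme.{u}}

/-! ### Sections, gluing and free generators of sheaves of modules. -/

section ModuleBasics

variable {X : Scheme.{u}}

/-- Restriction of sections of a sheaf of modules. -/
def mres (M : X.Modules) {U V : X.Opens} (h : V ≤ U) : Γ(M, U) →+ Γ(M, V) :=
  (M.presheaf.map (homOfLE h).op).hom

/-- Restriction of functions. -/
def rres (X : Scheme.{u}) {U V : X.Opens} (h : V ≤ U) : Γ(X, U) →+* Γ(X, V) :=
  (X.presheaf.map (homOfLE h).op).hom

lemma mres_self (M : X.Modules) {U : X.Opens} (h : U ≤ U) (x : Γ(M, U)) : mres M h x = x :=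
  congr($(M.presheaf.map_id (.op U)) x)

lemma mres_mres (M : X.Modules) {U V W : X.Opens} (h : V ≤ U) (h' : W ≤ V) (x : Γ(M, U)) :
    mres M h' (mres M h x) = mres M (h'.trans h) x :=
  congr($(M.presheaf.map_comp (homOfLE h).op (homOfLE h').op) x).symm

lemma mres_smul (M : X.Modules) {U V : X.Opens} (h : V ≤ U) (a : Γ(X, U)) (x : Γ(M, U)) :
    mres M h (a • x) = rres X h a • mres M h x :=
  Scheme.Modules.map_smul M (homOfLE h) a x

lemma hom_mres {M N : X.Modules} (φ : M ⟶ N) {U V : X.Opens} (h : V ≤ U) (x : Γ(M, U)) :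
    φ.app V (mres M h x) = mres N h (φ.app U x) :=
  congr($(φ.mapPresheaf.naturality (homOfLE h).op) x)

lemma mres_bijective (M : X.Modules) {U V : X.Opens} (h : V ≤ U) (h' : U ≤ V) :
    Function.Bijective (mres M h) := by
  obtain rfl := le_antisymm h h'
  convert Function.bijective_id using 1
  ext x
  exact mres_self M _ x

lemma mres_ext (M : X.Modules) {ι : Type*} (V : X.Opens) (U : ι → X.Opens) (hU : ∀ i, U i ≤ V)
    (hV : ∀ x ∈ V, ∃ i, x ∈ U i) {s t : Γ(M, V)}
    (h : ∀ i, mres M (hU i) s = mres M (hU i) t) : s = t :=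
  TopCat.Sheaf.eq_of_locally_eq' ⟨M.presheaf, M.isSheaf⟩ U V (fun i => homOfLE (hU i))
    (fun x hx => by simpa using hV x hx) s t h

lemma mres_glue (M : X.Modules) {ι : Type*} (V : X.Opens) (U : ι → X.Opens) (hU : ∀ i, U i ≤ V)
    (hV : ∀ x ∈ V, ∃ i, x ∈ U i) (s : ∀ i, Γ(M, U i))
    (h : ∀ i j (W : X.Opens) (hi : W ≤ U i) (hj : W ≤ U j), mres M hi (s i) = mres M hj (s j)) :
    ∃ t : Γ(M, V), ∀ i, mres M (hU i) t = s i :=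
  (TopCat.Sheaf.existsUnique_gluing' ⟨M.presheaf, M.isSheaf⟩ U V (fun i => homOfLE (hU i))
    (fun x hx => by simpa using hV x hx) s
    (fun i j => h i j (U i ⊓ U j) inf_le_left inf_le_right)).exists

lemma rres_ext {ι : Type*} (V : X.Opens) (U : ι → X.Opens) (hU : ∀ i, U i ≤ V)
    (hV : ∀ x ∈ V, ∃ i, x ∈ U i) {s t : Γ(X, V)}
    (h : ∀ i, rres X (hU i) s = rres X (hU i) t) : s = t :=
  TopCat.Sheaf.eq_of_locally_eq' X.sheaf U V (fun i => homOfLE (hU i))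
    (fun x hx => by simpa using hV x hx) s t h

lemma rres_glue {ι : Type*} (V : X.Opens) (U : ι → X.Opens) (hU : ∀ i, U i ≤ V)
    (hV : ∀ x ∈ V, ∃ i, x ∈ U i) (s : ∀ i, Γ(X, U i))
    (h : ∀ i j (W : X.Opens) (hi : W ≤ U i) (hj : W ≤ U j), rres X hi (s i) = rres X hj (s j)) :
    ∃ t : Γ(X, V), ∀ i, rres X (hU i) t = s i :=
  (TopCat.Sheaf.existsUnique_gluing' X.sheaf U V (fun i => homOfLE (hU i))
    (fun x hx => by simpa using hV x hx) s
    (fun i j => h i j (U i ⊓ U j) inf_le_left inf_le_right)).exists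

/-- The homomorphism `𝒪 ⟶ M` that corresponds to a global section of `M`. -/
def ofSection (M : X.Modules) (m : Γ(M, ⊤)) : structureModule X ⟶ M :=
  (SheafOfModules.unitHomEquiv (R := X.ringCatSheaf) M).symm
    (PresheafOfModules.sectionsMk (M := M.val) (fun U => mres M (U := ⊤) (V := U.unop) le_top m)
      (fun U V f => mres_mres M (U := ⊤) (V := U.unop) (W := V.unop) le_top (leOfHom f.unop) m))

/-- A function, viewed as a section of the structure sheaf. -/
def toUnit {U : X.Opens} (a : Γ(X, U)) : Γ(structureModule X, U) := a

lemma toUnit_bijective (U : X.Opens) : Function.Bijective (toUnit (X := X) (U := U)) :=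
  Function.bijective_id

lemma ofSection_app (M : X.Modules) (m : Γ(M, ⊤)) (U : X.Opens) (a : Γ(X, U)) :
    (ofSection M m).app U (toUnit a) = a • mres M le_top m :=
  rfl

lemma toUnit_eq_smul {U : X.Opens} (a : Γ(X, U)) :
    toUnit a = a • mres (structureModule X) (le_top (a := U)) (toUnit 1) := by
  have e : mres (structureModule X) (le_top (a := U)) (toUnit 1) = toUnit 1 :=
    (rres X (le_top (a := U))).map_one
  rw [e]
  exact (mul_one a).symm

lemma structureModule_hom_app {M : X.Modules} (φ : structureModule X ⟶ M) (U : X.Opens)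
    (a : Γ(X, U)) : φ.app U (toUnit a) = a • mres M (le_top (a := U)) (φ.app ⊤ (toUnit 1)) := by
  rw [← hom_mres, ← Scheme.Modules.Hom.app_smul, ← toUnit_eq_smul]

lemma structureModule_hom_ext {M : X.Modules} {φ ψ : structureModule X ⟶ M}
    (h : φ.app ⊤ (toUnit 1) = ψ.app ⊤ (toUnit 1)) : φ = ψ := by
  ext U a
  obtain ⟨a, rfl⟩ := (toUnit_bijective U).2 a
  exact (structureModule_hom_app φ U a).trans (h ▸ (structureModule_hom_app ψ U a).symm)

lemma structureModule_hom_bijective (M : X.Modules) :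
    Function.Bijective fun φ : structureModule X ⟶ M => φ.app ⊤ (toUnit 1) := by
  refine ⟨fun φ ψ h => structureModule_hom_ext h, fun m => ⟨ofSection M m, ?_⟩⟩
  refine (ofSection_app M m ⊤ 1).trans ?_
  rw [one_smul, mres_self]

/-- `g` generates `M` freely over `U`. -/
def IsGen (M : X.Modules) (U : X.Opens) (g : Γ(M, U)) : Prop :=
  ∀ (V : X.Opens) (h : V ≤ U), Function.Bijective fun a : Γ(X, V) => a • mres M h g

lemma IsGen.mres {M : X.Modules} {U V : X.Opens} {g : Γ(M, U)} (hg : IsGen M U g) (h : V ≤ U) :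
    IsGen M V (mres M h g) := by
  intro W hW
  rw [mres_mres]
  exact hg W _

lemma IsGen.isIso {M : X.Modules} {m : Γ(M, ⊤)} (hm : IsGen M ⊤ m) : IsIso (ofSection M m) := by
  rw [Scheme.Modules.Hom.isIso_iff_isIso_app]
  intro U
  exact (ConcreteCategory.isIso_iff_bijective ((ofSection M m).app U)).mpr (hm U le_top)

lemma isGen_of_isIso {M : X.Modules} (φ : structureModule X ⟶ M) [IsIso φ] :
    IsGen M ⊤ (φ.app ⊤ (toUnit 1)) := by
  intro U h
  have := ((ConcreteCategory.isIso_iff_bijective (φ.app U)).mp inferInstance).comp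
    (toUnit_bijective U)
  convert this using 1
  funext a
  exact (structureModule_hom_app φ U a).symm

end ModuleBasics

/-! ### Transitivity of pullback, and pullback along open immersions. -/

section Mate

variable (L : S.Modules) {T T' : Scheme.{u}} (f : T ⟶ S) (f' : T' ⟶ S) (g : T' ⟶ T)
  (w : g ≫ f = f')

/-- The comparison `g^* f^* L ⟶ f'^* L` that corresponds to `baseChangeHom`. -/
def mate : (Scheme.Modules.pullback g).obj ((Scheme.Modules.pullback f).obj L) ⟶
    (Scheme.Modules.pullback f').obj L :=
  ((Scheme.Modules.pullbackPushforwardAdjunction g).homEquiv _ _).symm (baseChangeHom L f f' g w)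

lemma unit_mate : (Scheme.Modules.pullbackPushforwardAdjunction g).unit.app _ ≫
    (Scheme.Modules.pushforward g).map (mate L f f' g w) = baseChangeHom L f f' g w := by
  exact ((Scheme.Modules.pullbackPushforwardAdjunction g).homEquiv_unit _ _ _).symm.trans
    (Equiv.apply_symm_apply _ _)

/-- Under the two pullback adjunctions this map becomes the bijection Hom(L, f'_* N) ≅ Hom(L, f_*
g_* N) induced by f'_* ≅ f_* g_*. -/
lemma baseChangeHom_comp_bijective (N : T'.Modules) :
    Function.Bijective fun ψ : (Scheme.Modules.pullback f').obj L ⟶ N =>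
      baseChangeHom L f f' g w ≫ (Scheme.Modules.pushforward g).map ψ := by
  let e : (Scheme.Modules.pushforward f').obj N ≅
      (Scheme.Modules.pushforward f).obj ((Scheme.Modules.pushforward g).obj N) :=
    (Scheme.Modules.pushforwardCongr w.symm).app N ≪≫
      (Scheme.Modules.pushforwardComp g f).symm.app N
  have key : ((Scheme.Modules.pullbackPushforwardAdjunction f).homEquiv _ _) ∘
      (fun ψ : (Scheme.Modules.pullback f').obj L ⟶ N =>
      baseChangeHom L f f' g w ≫ (Scheme.Modules.pushforward g).map ψ) =
      (fun x => x ≫ e.hom) ∘ ((Scheme.Modules.pullbackPushforwardAdjunction f').homEquiv _ _) := by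
    funext ψ
    have := baseChangeHom_unit L f f' g w
    simp only [Function.comp, Adjunction.homEquiv_unit, Functor.map_comp, reassoc_of% this]
    simp only [Category.assoc]
    congr 1
    subst w
    ext U x
    have := ψ.mapPresheaf.naturality (homOfLE (le_refl ((g ≫ f) ⁻¹ᵁ U))).op
    exact congr($this x)
  have h2 : Function.Bijective ((fun x => x ≫ e.hom) ∘
      ((Scheme.Modules.pullbackPushforwardAdjunction f').homEquiv L N)) :=
    Function.Bijective.comp ⟨fun a b h => by simpa using h, fun b => ⟨b ≫ e.inv, by simp⟩⟩
      (Equiv.bijective _)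
  rw [← key] at h2
  exact (Function.Bijective.of_comp_iff' (Equiv.bijective _) _).mp h2

instance : IsIso (mate L f f' g w) := by
  apply isIso_of_coyoneda_map_bijective
  intro N
  have h := baseChangeHom_comp_bijective L f f' g w N
  have key : (fun ψ : (Scheme.Modules.pullback f').obj L ⟶ N =>
      baseChangeHom L f f' g w ≫ (Scheme.Modules.pushforward g).map ψ) =
      ((Scheme.Modules.pullbackPushforwardAdjunction g).homEquiv _ _) ∘
        (fun x => mate L f f' g w ≫ x) := by
    funext ψ
    rw [Function.comp, Adjunction.homEquiv_unit, Functor.map_comp, ← Category.assoc, unit_mate]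
  rw [key] at h
  exact (Function.Bijective.of_comp_iff' (Equiv.bijective _) _).mp h

/-- Pullback along an open immersion is restriction, by uniqueness of left adjoints, and restriction
loses nothing on open sets inside the range. -/
lemma pullback_unit_app_bijective (N : T.Modules) [IsOpenImmersion g] (U : T.Opens)
    (hU : U ≤ g.opensRange) : Function.Bijective
      (((Scheme.Modules.pullbackPushforwardAdjunction g).unit.app N).app U) := by
  have h := (Scheme.Modules.restrictAdjunction g).unit_leftAdjointUniq_hom_app
    (Scheme.Modules.pullbackPushforwardAdjunction g) N
  rw [← h, Scheme.Modules.Hom.comp_app, Scheme.Modules.pushforward_map_app,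
    Scheme.Modules.restrictAdjunction_unit_app_app]
  have h1 : Function.Bijective (N.presheaf.map (homOfLE (g.image_preimage_le U)).op) := by
    refine mres_bijective N (g.image_preimage_le U) ?_
    rw [g.image_preimage_eq_opensRange_inf]
    exact le_inf hU le_rfl
  have h2 := (ConcreteCategory.isIso_iff_bijective
    ((((Scheme.Modules.restrictAdjunction g).leftAdjointUniq
      (Scheme.Modules.pullbackPushforwardAdjunction g)).hom.app N).app (g ⁻¹ᵁ U))).mp inferInstance
  exact h2.comp h1

lemma baseChangeHom_app_bijective [IsOpenImmersion g] (U : T.Opens) (hU : U ≤ g.opensRange) :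
    Function.Bijective ((baseChangeHom L f f' g w).app U) := by
  rw [← unit_mate, Scheme.Modules.Hom.comp_app, Scheme.Modules.pushforward_map_app]
  have h2 := (ConcreteCategory.isIso_iff_bijective
    ((mate L f f' g w).app (g ⁻¹ᵁ U))).mp inferInstance
  exact h2.comp (pullback_unit_app_bijective g _ U hU)

/-- The pullback of global sections of `f^* L` along `g`. -/
def sectionPullback (m : Γ((Scheme.Modules.pullback f).obj L, ⊤)) :
    Γ((Scheme.Modules.pullback f').obj L, ⊤) :=
  (baseChangeHom L f f' g w).app ⊤ m

lemma comp_bijective_of_isIso {C : Type*} [Category C] {X Y Z : C} (a : X ⟶ Y) [IsIso a] :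
    Function.Bijective fun x : Y ⟶ Z => a ≫ x :=
  ⟨fun _ _ h => (cancel_epi a).mp h, fun b => ⟨inv a ≫ b, by simp⟩⟩

lemma ofSection_app_one {X : Scheme.{u}} (M : X.Modules) (m : Γ(M, ⊤)) :
    (ofSection M m).app ⊤ (toUnit 1) = m := by
  refine (ofSection_app _ _ _ _).trans ?_
  rw [one_smul, mres_self]

/-- A generator of `f^* L` remains a generator after pullback. -/
lemma IsGen.baseChange {m : Γ((Scheme.Modules.pullback f).obj L, ⊤)}
    (hm : IsGen ((Scheme.Modules.pullback f).obj L) ⊤ m) :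
    IsGen ((Scheme.Modules.pullback f').obj L) ⊤ (sectionPullback L f f' g w m) := by
  have := hm.isIso
  let φ := ofSection ((Scheme.Modules.pullback f').obj L) (sectionPullback L f f' g w m)
  have hφ : φ.app ⊤ (toUnit 1) = sectionPullback L f f' g w m := ofSection_app_one _ _
  have hm' := ofSection_app_one _ m
  -- By Yoneda: homomorphisms f'^* L → N correspond to f^* L → g_* N, then through the generator `m`
  -- to 𝒪 → g_* N, that is, to global sections of N.
  have : IsIso φ := by
    apply isIso_of_coyoneda_map_bijective
    intro N
    refine (Function.Bijective.of_comp_iff' (structureModule_hom_bijective N) _).mp ?_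
    have h1 := baseChangeHom_comp_bijective L f f' g w N
    have h2 := structureModule_hom_bijective ((Scheme.Modules.pushforward g).obj N)
    have h3 := comp_bijective_of_isIso (Z := (Scheme.Modules.pushforward g).obj N) (ofSection _ m)
    have h4 := (h2.comp h3).comp h1
    have key (ψ : (Scheme.Modules.pullback f').obj L ⟶ N) :
        (φ ≫ ψ).app ⊤ (toUnit 1) = (ofSection _ m ≫ baseChangeHom L f f' g w ≫
          (Scheme.Modules.pushforward g).map ψ).app ⊤ (toUnit 1) := by
      refine (congrArg (fun y => ψ.app ⊤ y) hφ).trans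
        (congrArg (fun y => ψ.app ⊤ (sectionPullback L f f' g w y)) hm').symm
    exact ⟨fun a b h => h4.1 ((key a).symm.trans (h.trans (key b))),
      fun y => (h4.2 y).imp fun a h => (key a).trans h⟩
  rw [← hφ]
  exact isGen_of_isIso φ

end Mate

/-! ### The functor of sections on S-schemes is a Zariski sheaf. -/

section SectionsBasics

variable {k : Type u} [Field k] {s : S ⟶ Spec (.of k)} {L : S.Modules}

instance (T : Over S) : Module Γ(T.left, ⊤) (Sections s L T) :=
  inferInstanceAs (Module Γ(T.left, ⊤) Γ((Scheme.Modules.pullback T.hom).obj L, ⊤))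

lemma scalars_smul {T : Over S} (c : k) (x : Sections s L T) : c • x = scalars s T c • x := rfl

/-- Pullback of functions along a morphism of `S`-schemes. -/
def fn {T T' : Over S} (g : T' ⟶ T) : Γ(T.left, ⊤) →+* Γ(T'.left, ⊤) := g.left.appTop.hom

/-- Pullback of sections along a morphism of `S`-schemes. -/
def pb {T T' : Over S} (g : T' ⟶ T) : Sections s L T →+ Sections s L T' :=
  (Sections.map s L g).toAddMonoidHom

lemma fn_id (T : Over S) (a : Γ(T.left, ⊤)) : fn (𝟙 T) a = a := by simp [fn]

lemma fn_comp {T T' T'' : Over S} (g : T' ⟶ T) (h : T'' ⟶ T') (a : Γ(T.left, ⊤)) :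
    fn (h ≫ g) a = fn h (fn g a) :=
  congr($(Scheme.Hom.comp_appTop h.left g.left) a)

lemma fn_scalars {T T' : Over S} (g : T' ⟶ T) (c : k) : fn g (scalars s T c) = scalars s T' c :=
  scalars_comp s g c

lemma pb_smul {T T' : Over S} (g : T' ⟶ T) (a : Γ(T.left, ⊤)) (x : Sections s L T) :
    pb g (a • x) = fn g a • pb g x :=
  Scheme.Modules.Hom.app_smul (baseChangeHom L T.hom T'.hom g.left (Over.w g)) a x

lemma pb_id {T : Over S} (x : Sections s L T) : pb (𝟙 T) x = x :=
  congr($((sectionsFunctor s L).map_id (.op T)) x)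

lemma pb_comp {T T' T'' : Over S} (g : T' ⟶ T) (h : T'' ⟶ T') (x : Sections s L T) :
    pb (h ≫ g) x = pb h (pb g x) :=
  congr($((sectionsFunctor s L).map_comp g.op h.op) x)

lemma pb_scalar_smul {T T' : Over S} (g : T' ⟶ T) (c : k) (x : Sections s L T) :
    pb g (c • x) = c • pb g x :=
  (Sections.map s L g).map_smul c x

/-- Evaluation at `g : T' ⟶ T` of a section of `f^* L` over an open subset through which `g`
factors. -/
def evalAt {T T' : Over S} (g : T' ⟶ T) (U : T.left.Opens) (h : ⊤ ≤ g.left ⁻¹ᵁ U)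
    (t : Γ((Scheme.Modules.pullback T.hom).obj L, U)) : Sections s L T' :=
  mres ((Scheme.Modules.pullback T'.hom).obj L) h
    ((baseChangeHom L T.hom T'.hom g.left (Over.w g)).app U t)

lemma evalAt_mres {T T' : Over S} (g : T' ⟶ T) {U U' : T.left.Opens} (h : ⊤ ≤ g.left ⁻¹ᵁ U)
    (hU : U ≤ U') (t : Γ((Scheme.Modules.pullback T.hom).obj L, U')) :
    evalAt (s := s) g U h (mres _ hU t) = evalAt g U' (h.trans (fun _ hx => hU hx)) t := by
  unfold evalAt
  rw [hom_mres]
  exact mres_mres _ _ _ _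

lemma evalAt_top {T T' : Over S} (g : T' ⟶ T) (t : Sections s L T) :
    evalAt g ⊤ le_rfl t = pb g t :=
  mres_self _ _ _

lemma pb_evalAt {T T' T'' : Over S} (g : T' ⟶ T) (a : T'' ⟶ T') (U : T.left.Opens)
    (h : ⊤ ≤ g.left ⁻¹ᵁ U) (h' : ⊤ ≤ (a ≫ g).left ⁻¹ᵁ U)
    (t : Γ((Scheme.Modules.pullback T.hom).obj L, U)) :
    pb a (evalAt (s := s) g U h t) = evalAt (a ≫ g) U h' t := by
  have e := congr($(congr(Scheme.Modules.Hom.app $(baseChangeHom_comp L T.hom T'.hom T''.hom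
    g.left a.left (Over.w g) (Over.w a) (Over.w (a ≫ g))) U)) t)
  unfold evalAt
  refine Eq.trans ?_ (congrArg (mres ((Scheme.Modules.pullback T''.hom).obj L) h') e.symm)
  exact hom_mres (baseChangeHom L T'.hom T''.hom a.left (Over.w a)) h _

lemma evalAt_bijective {T T' : Over S} (g : T' ⟶ T) [IsOpenImmersion g.left] (U : T.left.Opens)
    (h : ⊤ ≤ g.left ⁻¹ᵁ U) (hU : U ≤ g.left.opensRange) :
    Function.Bijective (evalAt (s := s) (L := L) g U h) :=
  (mres_bijective _ h le_top).comp
    (baseChangeHom_app_bijective L T.hom T'.hom g.left (Over.w g) U hU)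

lemma top_le_preimage_opensRange {X Y : Scheme.{u}} (g : X ⟶ Y) [IsOpenImmersion g] :
    ⊤ ≤ g ⁻¹ᵁ g.opensRange := by simp

lemma sections_ext {T : Over S} {ι : Type*} {T' : ι → Over S} (j : ∀ i, T' i ⟶ T)
    [∀ i, IsOpenImmersion (j i).left] (hj : ∀ x : T.left, ∃ i, x ∈ (j i).left.opensRange)
    {x y : Sections s L T} (h : ∀ i, pb (j i) x = pb (j i) y) : x = y := by
  refine mres_ext _ ⊤ (fun i => (j i).left.opensRange) (fun i => le_top) (fun x _ => hj x)
    fun i => ?_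
  apply (evalAt_bijective (s := s) (L := L) (j i) _ (top_le_preimage_opensRange _) le_rfl).1
  have := h i
  rw [← evalAt_top, ← evalAt_top] at this
  exact (evalAt_mres (s := s) (L := L) (j i) _ _ _).trans (this.trans
    (evalAt_mres (s := s) (L := L) (j i) _ _ _).symm)

/-- Each local section is moved to the range of its open immersion, where the sheaf property of f^*
L applies. Compatibility is asked on all test schemes, so no fibre products have to be chosen. -/
lemma sections_glue {T : Over S} {ι : Type*} {T' : ι → Over S} (j : ∀ i, T' i ⟶ T)
    [∀ i, IsOpenImmersion (j i).left] (hj : ∀ x : T.left, ∃ i, x ∈ (j i).left.opensRange)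
    (x : ∀ i, Sections s L (T' i))
    (hx : ∀ (i i' : ι) (T'' : Over S) (a : T'' ⟶ T' i) (b : T'' ⟶ T' i'),
      a ≫ j i = b ≫ j i' → pb a (x i) = pb b (x i')) :
    ∃ y : Sections s L T, ∀ i, pb (j i) y = x i := by
  choose t ht using fun i =>
    (evalAt_bijective (s := s) (L := L) (j i) _ (top_le_preimage_opensRange _) le_rfl).2 (x i)
  -- An open set W inside both ranges is itself a test scheme that maps to both members of the
  -- cover.
  have compat : ∀ i i' (W : T.left.Opens) (hi : W ≤ (j i).left.opensRange)
      (hi' : W ≤ (j i').left.opensRange), mres ((Scheme.Modules.pullback T.hom).obj L) hi (t i) =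
        mres ((Scheme.Modules.pullback T.hom).obj L) hi' (t i') := by
    intro i i' W hi hi'
    let w : Over.mk (W.ι ≫ T.hom) ⟶ T := Over.homMk W.ι
    have key (i : ι) (hi : W ≤ (j i).left.opensRange) :
        ∃ a : Over.mk (W.ι ≫ T.hom) ⟶ T' i, a ≫ j i = w := by
      have hr : Set.range W.ι ⊆ Set.range (j i).left := by
        intro y hy
        exact hi (by simpa using hy)
      refine ⟨Over.homMk (IsOpenImmersion.lift (j i).left W.ι hr) ?_, ?_⟩
      · rw [← Over.w (j i), IsOpenImmersion.lift_fac_assoc]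
        rfl
      · ext : 1
        exact IsOpenImmersion.lift_fac _ _ _
    have hw : IsOpenImmersion w.left := inferInstanceAs (IsOpenImmersion W.ι)
    have hW : ⊤ ≤ w.left ⁻¹ᵁ W := by
      change ⊤ ≤ W.ι ⁻¹ᵁ W
      simp
    have hW' : W ≤ w.left.opensRange := by
      change W ≤ W.ι.opensRange
      simp
    have hW'' (i : ι) (hi : W ≤ (j i).left.opensRange) : evalAt (s := s) w W hW (mres _ hi (t i)) =
        pb (key i hi).choose (x i) := by
      rw [evalAt_mres, ← ht i, pb_evalAt _ _ _ _ (by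
        rw [(key i hi).choose_spec]
        exact hW.trans (fun _ h => hi h))]
      congr 1
      exact (key i hi).choose_spec.symm
    apply (evalAt_bijective (s := s) (L := L) w W hW hW').1
    rw [hW'', hW'']
    apply hx
    rw [(key i hi).choose_spec, (key i' hi').choose_spec]
  obtain ⟨y, hy⟩ := mres_glue ((Scheme.Modules.pullback T.hom).obj L) ⊤
    (fun i => (j i).left.opensRange) (fun i => le_top) (fun x _ => hj x) t compat
  refine ⟨y, fun i => ?_⟩
  have e := evalAt_mres (s := s) (L := L) (j i) (top_le_preimage_opensRange _) le_top y
  rw [hy, ht] at e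
  rw [e]
  exact (evalAt_top (s := s) (L := L) (j i) y).symm

/-- The section of `f^* L` defined by a section of `L` over an open subset that contains the image
of `f`. -/
def ofOpen (s : S ⟶ Spec (.of k)) (T : Over S) (U : S.Opens) (h : ⊤ ≤ T.hom ⁻¹ᵁ U) (t : Γ(L, U)) :
    Sections s L T :=
  mres ((Scheme.Modules.pullback T.hom).obj L) h
    (((Scheme.Modules.pullbackPushforwardAdjunction T.hom).unit.app L).app U t)

lemma ofOpen_mres {T : Over S} {U U' : S.Opens} (h : ⊤ ≤ T.hom ⁻¹ᵁ U)
    (hU : U ≤ U') (t : Γ(L, U')) :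
    ofOpen s T U h (mres _ hU t) = ofOpen s T U' (h.trans (fun _ hx => hU hx)) t := by
  refine (congrArg (mres ((Scheme.Modules.pullback T.hom).obj L) h)
    (hom_mres ((Scheme.Modules.pullbackPushforwardAdjunction T.hom).unit.app L) hU t)).trans ?_
  exact mres_mres ((Scheme.Modules.pullback T.hom).obj L) (U := T.hom ⁻¹ᵁ U')
    (V := T.hom ⁻¹ᵁ U) (W := ⊤) _ h _

lemma pb_ofOpen {T T' : Over S} (a : T' ⟶ T) (U : S.Opens)
    (h : ⊤ ≤ T.hom ⁻¹ᵁ U) (h' : ⊤ ≤ T'.hom ⁻¹ᵁ U) (t : Γ(L, U)) :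
    pb a (ofOpen s T U h t) = ofOpen s T' U h' t := by
  have e := congr($(congr(Scheme.Modules.Hom.app $(baseChangeHom_unit L T.hom T'.hom
    a.left (Over.w a)) U)) t)
  have e2 : a.left ⁻¹ᵁ T.hom ⁻¹ᵁ U = T'.hom ⁻¹ᵁ U := by
    rw [← Scheme.Hom.comp_preimage, Over.w]
  have e1 := hom_mres (baseChangeHom L T.hom T'.hom a.left (Over.w a)) h
    (((Scheme.Modules.pullbackPushforwardAdjunction T.hom).unit.app L).app U t)
  refine e1.trans ((congrArg (mres ((Scheme.Modules.pullback T'.hom).obj L)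
    (U := a.left ⁻¹ᵁ T.hom ⁻¹ᵁ U) (h'.trans e2.ge)) e).trans ?_)
  exact mres_mres ((Scheme.Modules.pullback T'.hom).obj L) (U := T'.hom ⁻¹ᵁ U)
    (V := a.left ⁻¹ᵁ T.hom ⁻¹ᵁ U) (W := ⊤) e2.le (h'.trans e2.ge) _

lemma ofOpen_bijective {T : Over S} [IsOpenImmersion T.hom] (U : S.Opens)
    (h : ⊤ ≤ T.hom ⁻¹ᵁ U) (hU : U ≤ T.hom.opensRange) :
    Function.Bijective (ofOpen (L := L) s T U h) :=
  (mres_bijective _ h le_top).comp (pullback_unit_app_bijective T.hom L U hU)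

lemma ofOpen_smul {T : Over S} (U : S.Opens) (h : ⊤ ≤ T.hom ⁻¹ᵁ U) (a : Γ(S, U)) (t : Γ(L, U)) :
    ofOpen s T U h (a • t) = rres T.left h (T.hom.app U a) • ofOpen s T U h t := by
  refine (congrArg (mres ((Scheme.Modules.pullback T.hom).obj L) h)
    (Scheme.Modules.Hom.app_smul ((Scheme.Modules.pullbackPushforwardAdjunction T.hom).unit.app L)
      a t)).trans ?_
  exact mres_smul ((Scheme.Modules.pullback T.hom).obj L) h (T.hom.app U a) _

lemma ofOpen_add {T : Over S} (U : S.Opens) (h : ⊤ ≤ T.hom ⁻¹ᵁ U) (t t' : Γ(L, U)) :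
    ofOpen s T U h (t + t') = ofOpen s T U h t + ofOpen s T U h t' := by
  unfold ofOpen
  rw [map_add]
  exact map_add _ _ _

/-- `g` generates `f^* L` freely, universally. -/
def IsGenerator {T : Over S} (g : Sections s L T) : Prop :=
  ∀ (T' : Over S) (h : T' ⟶ T), Function.Bijective fun a : Γ(T'.left, ⊤) => a • pb h g

lemma IsGenerator.pb {T T' : Over S} {g : Sections s L T} (hg : IsGenerator g) (h : T' ⟶ T) :
    IsGenerator (pb h g) := by
  intro T'' h'
  rw [← pb_comp]
  exact hg T'' (h' ≫ h)

lemma IsGenerator.bijective {T : Over S} {g : Sections s L T} (hg : IsGenerator g) :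
    Function.Bijective fun a : Γ(T.left, ⊤) => a • g := by
  have := hg T (𝟙 T)
  rwa [pb_id] at this

lemma IsGen.isGenerator {T : Over S} {g : Sections s L T}
    (hg : IsGen ((Scheme.Modules.pullback T.hom).obj L) ⊤ g) : IsGenerator g := by
  intro T' h
  have := hg.baseChange L T.hom T'.hom h.left (Over.w h) ⊤ le_rfl
  rwa [mres_self] at this

lemma IsGen.map_iso {X : Scheme.{u}} {M N : X.Modules} (φ : M ⟶ N) [IsIso φ] {U : X.Opens}
    {g : Γ(M, U)} (hg : IsGen M U g) : IsGen N U (φ.app U g) := by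
  intro V h
  have h2 := (ConcreteCategory.isIso_iff_bijective (φ.app V)).mp inferInstance
  convert h2.comp (hg V h) using 1
  funext a
  rw [← hom_mres, ← Scheme.Modules.Hom.app_smul]
  rfl

lemma IsGen.restrict {X Y : Scheme.{u}} {M : X.Modules} (f : Y ⟶ X) [IsOpenImmersion f]
    {U : X.Opens} {g : Γ(M, U)} (hg : IsGen M U g) (hU : f ''ᵁ ⊤ ≤ U) :
    IsGen (M.restrict f) ⊤ (FqBundle.mres M hU g : Γ(M, f ''ᵁ ⊤)) := by
  intro V h
  have h1 := hg (f ''ᵁ V) ((f.image_mono h).trans hU)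
  have h2 : Function.Bijective (f.appIso V).inv := ConcreteCategory.bijective_of_isIso _
  have h3 := h1.comp h2
  rw [← mres_mres M hU (f.image_mono h)] at h3
  exact h3

lemma restrict_unit_mres {X Y : Scheme.{u}} (M : X.Modules) (f : Y ⟶ X) [IsOpenImmersion f]
    {U : X.Opens} (h : f ''ᵁ ⊤ ≤ U) (h' : ⊤ ≤ f ⁻¹ᵁ U) (g : Γ(M, U)) :
    mres (M.restrict f) h' (((Scheme.Modules.restrictAdjunction f).unit.app M).app U g) =
      mres M h g :=
  mres_mres M (U := U) (V := f ''ᵁ f ⁻¹ᵁ U) (W := f ''ᵁ ⊤) (f.image_preimage_le U)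
    (f.image_mono h') g

lemma pullback_unit_mres {X Y : Scheme.{u}} (M : X.Modules) (f : Y ⟶ X) [IsOpenImmersion f]
    {U : X.Opens} (h : f ''ᵁ ⊤ ≤ U) (h' : ⊤ ≤ f ⁻¹ᵁ U) (g : Γ(M, U)) :
    mres ((Scheme.Modules.pullback f).obj M) h'
      (((Scheme.Modules.pullbackPushforwardAdjunction f).unit.app M).app U g) =
      ((Scheme.Modules.restrictFunctorIsoPullback f).hom.app M).app ⊤ (mres M h g) := by
  have e : (Scheme.Modules.restrictAdjunction f).unit.app M ≫ (Scheme.Modules.pushforward f).map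
      ((Scheme.Modules.restrictFunctorIsoPullback f).hom.app M) =
      (Scheme.Modules.pullbackPushforwardAdjunction f).unit.app M :=
    (Scheme.Modules.restrictAdjunction f).unit_leftAdjointUniq_hom_app
      (Scheme.Modules.pullbackPushforwardAdjunction f) M
  have e' := congr($(congr(Scheme.Modules.Hom.app $e U)) g)
  have e1 := restrict_unit_mres M f h h' g
  have e2 := hom_mres ((Scheme.Modules.restrictFunctorIsoPullback f).hom.app M) h'
    (((Scheme.Modules.restrictAdjunction f).unit.app M).app U g)
  rw [← e']
  exact e2.symm.trans (congrArg _ e1)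

/-- It suffices to treat the S-scheme U, where pullback is restriction: every T in question maps to
it, and generators are stable under base change. -/
lemma IsGen.isGenerator_ofOpen {U : S.Opens} {g : Γ(L, U)} (hg : IsGen L U g) (T : Over S)
    (h : ⊤ ≤ T.hom ⁻¹ᵁ U) : IsGenerator (ofOpen s T U h g) := by
  have h0 : IsGenerator (ofOpen s (Over.mk U.ι) U (by simp) g) := by
    apply IsGen.isGenerator
    have h1 : U.ι ''ᵁ ⊤ ≤ U := by simp
    have h2 := (hg.restrict U.ι h1).map_iso
      ((Scheme.Modules.restrictFunctorIsoPullback U.ι).hom.app L)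
    exact (congrArg (IsGen ((Scheme.Modules.pullback U.ι).obj L) ⊤)
      (pullback_unit_mres L U.ι h1 (by simp) g)).mpr h2
  have hr : Set.range T.hom ⊆ Set.range U.ι := by
    rintro _ ⟨x, rfl⟩
    simpa using h (show x ∈ ⊤ from trivial)
  let p : T ⟶ Over.mk U.ι := Over.homMk (IsOpenImmersion.lift U.ι T.hom hr)
    (IsOpenImmersion.lift_fac _ _ _)
  rw [← pb_ofOpen p U (by simp) h g]
  exact h0.pb p

end SectionsBasics

/-! ### Morphisms of S-schemes into an affine scheme, as ring homomorphisms. -/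

section AffineTests

/-- The ring homomorphism `A → Γ(T, 𝒪)` defined by an `S`-morphism `T ⟶ Spec A`. -/
def ringOf {A : CommRingCat.{u}} {j : Spec A ⟶ S} {T : Over S} (t : T ⟶ Over.mk j) :
    A →+* Γ(T.left, ⊤) :=
  (fn t).comp (Scheme.ΓSpecIso A).inv.hom

lemma ringOf_comp {A : CommRingCat.{u}} {j : Spec A ⟶ S} {T T' : Over S} (t : T ⟶ Over.mk j)
    (h : T' ⟶ T) : ringOf (h ≫ t) = (fn h).comp (ringOf t) := by
  ext a
  exact fn_comp t h _

lemma ringOf_comp_apply {A : CommRingCat.{u}} {j : Spec A ⟶ S} {T T' : Over S}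
    (t : T ⟶ Over.mk j) (h : T' ⟶ T) (a : A) : ringOf (h ≫ t) a = fn h (ringOf t a) :=
  fn_comp t h _

lemma ringOf_id {A : CommRingCat.{u}} {j : Spec A ⟶ S} (a : A) :
    ringOf (𝟙 (Over.mk j)) a = (Scheme.ΓSpecIso A).inv.hom a :=
  fn_id _ _

lemma ringOf_id_bijective {A : CommRingCat.{u}} (j : Spec A ⟶ S) :
    Function.Bijective (ringOf (𝟙 (Over.mk j))) := by
  have h : Function.Bijective (Scheme.ΓSpecIso A).inv.hom :=
    ConcreteCategory.bijective_of_isIso (Scheme.ΓSpecIso A).inv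
  exact (congrArg Function.Bijective (funext ringOf_id)).mpr h

lemma ringOf_injective {A : CommRingCat.{u}} {j : Spec A ⟶ S} {T : Over S}
    {t t' : T ⟶ Over.mk j} (h : ringOf t = ringOf t') : t = t' := by
  ext : 1
  refine ext_of_isAffine (Y := Spec A) ?_
  rw [← cancel_epi (Scheme.ΓSpecIso A).inv]
  ext a
  exact congr($h a)

/-- The morphism of `S`-schemes `Spec C ⟶ Spec A` defined by a ring homomorphism. -/
def specOver {A C : CommRingCat.{u}} (j : Spec A ⟶ S) (φ : A ⟶ C) :
    Over.mk (Spec.map φ ≫ j) ⟶ Over.mk j :=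
  Over.homMk (Spec.map φ)

lemma ringOf_specOver {A C : CommRingCat.{u}} (j : Spec A ⟶ S) (φ : A ⟶ C) (a : A) :
    ringOf (specOver j φ) a = ringOf (𝟙 (Over.mk (Spec.map φ ≫ j))) (φ.hom a) := by
  rw [ringOf_id]
  exact congr($((Scheme.ΓSpecIso_inv_naturality φ).symm) a)

lemma ringOf_comp_specOver {A C : CommRingCat.{u}} {j : Spec A ⟶ S} {φ : A ⟶ C} {T : Over S}
    (t : T ⟶ Over.mk (Spec.map φ ≫ j)) (a : A) :
    ringOf (t ≫ specOver j φ) a = ringOf t (φ.hom a) := by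
  rw [ringOf_comp_apply, ringOf_specOver, ← ringOf_comp_apply, Category.comp_id]

lemma exists_specLift {A C : CommRingCat.{u}} {j : Spec A ⟶ S} (φ : A ⟶ C) {T : Over S}
    (t : T ⟶ Over.mk j) (ψ : C →+* Γ(T.left, ⊤)) (h : ∀ a, ψ (φ.hom a) = ringOf t a) :
    ∃ t' : T ⟶ Over.mk (Spec.map φ ≫ j), t' ≫ specOver j φ = t ∧ ringOf t' = ψ := by
  let ψ' : C ⟶ Γ(T.left, ⊤) := CommRingCat.ofHom ψ
  let p : T.left ⟶ Spec C := T.left.toSpecΓ ≫ Spec.map ψ'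
  have hp : (Scheme.ΓSpecIso C).inv ≫ p.appTop = ψ' := by
    have := Scheme.ΓSpecIso_inv_naturality ψ'
    simp only [p, Scheme.Hom.comp_appTop]
    rw [← reassoc_of% this, Scheme.toSpecΓ_appTop]
    simp
  have hpt : p ≫ Spec.map φ = t.left := by
    apply ext_of_isAffine
    rw [← cancel_epi (Scheme.ΓSpecIso A).inv, Scheme.Hom.comp_appTop,
      ← reassoc_of% (Scheme.ΓSpecIso_inv_naturality φ), hp]
    ext a
    exact h a
  refine ⟨Over.homMk p ?_, ?_, ?_⟩
  · have := Over.w t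
    simp only [Over.mk_hom] at this ⊢
    rw [← Category.assoc, hpt, this]
  · ext : 1
    exact hpt
  · ext a
    exact congr($hp a)

end AffineTests

/-! ### Group schemes and line bundles through their points. -/

section Points

open scoped AddMonObj

variable {k : Type u} [Field k] {s : S ⟶ Spec (.of k)} {L M : S.Modules}

lemma isAddMonHom_of_add {G H : Over S} [AddGrpObj G] [AddGrpObj H] (f : G ⟶ H)
    (h : ∀ (T : Over S) (a b : T ⟶ G), (a + b) ≫ f = a ≫ f + b ≫ f) : IsAddMonHom f where
  zero_hom := by
    have h1 := h _ (0 : 𝟙_ (Over S) ⟶ G) 0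
    rw [add_zero, left_eq_add, Hom.zero_def, Hom.zero_def] at h1
    have e : CartesianMonoidalCategory.toUnit (𝟙_ (Over S)) = 𝟙 _ :=
      CartesianMonoidalCategory.toUnit_unique _ _
    simpa [e] using h1
  add_hom := by
    have h1 := h _ (CartesianMonoidalCategory.fst G G) (CartesianMonoidalCategory.snd G G)
    rw [Hom.add_def, Hom.add_def] at h1
    simp only [CartesianMonoidalCategory.lift_fst_snd, Category.id_comp] at h1
    rw [h1]
    congr 1

lemma add_comp_of_isAddMonHom {G H T : Over S} [AddGrpObj G] [AddGrpObj H] (f : G ⟶ H)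
    (hf : IsAddMonHom f) (a b : T ⟶ G) : (a + b) ≫ f = a ≫ f + b ≫ f :=
  (IsAddMonHom.addMonoidHom f T).map_add a b

lemma zero_comp_of_isAddMonHom {G H T : Over S} [AddGrpObj G] [AddGrpObj H] (f : G ⟶ H)
    (hf : IsAddMonHom f) : (0 : T ⟶ G) ≫ f = 0 :=
  (IsAddMonHom.addMonoidHom f T).map_zero

lemma sub_comp_of_isAddMonHom {G H T : Over S} [AddGrpObj G] [AddGrpObj H] (f : G ⟶ H)
    (hf : IsAddMonHom f) (a b : T ⟶ G) : (a - b) ≫ f = a ≫ f - b ≫ f :=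
  (IsAddMonHom.addMonoidHom f T).map_sub a b

namespace LineBundle

/-- The section of `f^* L` that corresponds to a `T`-valued point of `𝔾_{a,L}`. -/
def val (V : LineBundle s L) {T : Over S} (f : T ⟶ V.X) : Sections s L T := V.rep.homEquiv f

/-- The `T`-valued point of `𝔾_{a,L}` that corresponds to a section of `f^* L`. -/
def pt (V : LineBundle s L) {T : Over S} (x : Sections s L T) : T ⟶ V.X := V.rep.homEquiv.symm x

@[simp] lemma val_pt (V : LineBundle s L) {T : Over S} (x : Sections s L T) :
    V.val (V.pt x) = x := V.rep.homEquiv.apply_symm_apply x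

lemma val_injective (V : LineBundle s L) {T : Over S} {f g : T ⟶ V.X} (h : V.val f = V.val g) :
    f = g := V.rep.homEquiv.injective h

lemma val_comp (V : LineBundle s L) {T T' : Over S} (h : T' ⟶ T) (f : T ⟶ V.X) :
    V.val (h ≫ f) = pb h (V.val f) :=
  V.rep.homEquiv_comp h f

lemma comp_pt (V : LineBundle s L) {T T' : Over S} (h : T' ⟶ T) (x : Sections s L T) :
    h ≫ V.pt x = V.pt (pb h x) := by
  apply V.val_injective
  rw [val_comp, val_pt, val_pt]

lemma val_add (V : LineBundle s L) {T : Over S} (f g : T ⟶ V.X) :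
    V.val (f + g) = V.val f + V.val g := by
  rw [Hom.add_def, val_comp]
  have h : V.val (AddMonObj.add (X := V.X)) = V.val (CartesianMonoidalCategory.fst V.X V.X) +
      V.val (CartesianMonoidalCategory.snd V.X V.X) := V.rep.homEquiv.apply_symm_apply _
  rw [h, map_add, ← val_comp, ← val_comp, CartesianMonoidalCategory.lift_fst,
    CartesianMonoidalCategory.lift_snd]

lemma val_zero (V : LineBundle s L) {T : Over S} : V.val (0 : T ⟶ V.X) = 0 := by
  have := V.val_add (0 : T ⟶ V.X) 0
  rwa [add_zero, left_eq_add] at this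

lemma val_smul (V : LineBundle s L) {T : Over S} (c : k) (f : T ⟶ V.X) :
    V.val (f ≫ V.smul c) = c • V.val f := by
  have h : V.val (V.smul c) = c • V.val (𝟙 V.X) := V.rep.homEquiv.apply_symm_apply _
  rw [val_comp, h, pb_scalar_smul, ← val_comp, Category.comp_id]

lemma isAddMonHom_smul (V : LineBundle s L) (c : k) : IsAddMonHom (V.smul c) :=
  isAddMonHom_of_add _ fun T a b => V.val_injective <| by
    rw [val_smul, val_add, val_add, val_smul, val_smul, smul_add]

end LineBundle

end Points

/-! ### The affine line as the local form of a line bundle. -/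

section AffineLine

variable {k : Type u} [Field k] {s : S ⟶ Spec (.of k)} {L M : S.Modules}

/-- The affine line over `Spec A`, as an `S`-scheme. -/
abbrev affLine {A : CommRingCat.{u}} (j : Spec A ⟶ S) : Over S :=
  Over.mk (Spec.map (CommRingCat.ofHom (Polynomial.C : A →+* Polynomial A)) ≫ j)

/-- The projection from the affine line over `Spec A` to `Spec A`. -/
abbrev affLineProj {A : CommRingCat.{u}} (j : Spec A ⟶ S) : affLine j ⟶ Over.mk j :=
  specOver j (CommRingCat.ofHom (Polynomial.C : A →+* Polynomial A))

/-- The coordinate of the affine line. -/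
def affCoord {A : CommRingCat.{u}} (j : Spec A ⟶ S) : Γ((affLine j).left, ⊤) :=
  ringOf (𝟙 (affLine j)) (Polynomial.X : Polynomial A)

lemma ringOf_affLine {A : CommRingCat.{u}} {j : Spec A ⟶ S} {T : Over S} (h : T ⟶ affLine j)
    (p : Polynomial A) :
    ringOf h p = p.eval₂ (ringOf (h ≫ affLineProj j)) (fn h (affCoord j)) := by
  have h1 : ringOf h = Polynomial.eval₂RingHom (ringOf (h ≫ affLineProj j))
      (fn h (affCoord j)) := by
    apply Polynomial.ringHom_ext
    · intro a
      rw [Polynomial.coe_eval₂RingHom, Polynomial.eval₂_C, ringOf_comp_specOver]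
      rfl
    · rw [Polynomial.coe_eval₂RingHom, Polynomial.eval₂_X, affCoord, ← ringOf_comp_apply,
        Category.comp_id]
  rw [h1]
  rfl

lemma affLine_ext {A : CommRingCat.{u}} {j : Spec A ⟶ S} {T : Over S} {h h' : T ⟶ affLine j}
    (h1 : h ≫ affLineProj j = h' ≫ affLineProj j) (h2 : fn h (affCoord j) = fn h' (affCoord j)) :
    h = h' := by
  refine ringOf_injective (RingHom.ext fun (p : Polynomial A) => ?_)
  exact (ringOf_affLine h p).trans (by rw [h1, h2, ← ringOf_affLine])

lemma exists_affLine_hom {A : CommRingCat.{u}} {j : Spec A ⟶ S} {T : Over S} (t : T ⟶ Over.mk j)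
    (a : Γ(T.left, ⊤)) :
    ∃ h : T ⟶ affLine j, h ≫ affLineProj j = t ∧ fn h (affCoord j) = a := by
  obtain ⟨h, h1, h2⟩ := exists_specLift
    (CommRingCat.ofHom (Polynomial.C : A →+* Polynomial A)) t
    (Polynomial.eval₂RingHom (ringOf t) a) (fun b => Polynomial.eval₂_C (ringOf t) a)
  refine ⟨h, h1, ?_⟩
  rw [affCoord, ← ringOf_comp_apply, Category.comp_id, h2]
  exact Polynomial.eval₂_X _ _

/-- The tautological section of `L` over the affine line defined by a generator of `L`. -/
def affTaut {A : CommRingCat.{u}} {j : Spec A ⟶ S} (g : Sections s L (Over.mk j)) :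
    Sections s L (affLine j) :=
  affCoord j • pb (affLineProj j) g

lemma pb_affTaut {A : CommRingCat.{u}} {j : Spec A ⟶ S} (g : Sections s L (Over.mk j)) {T : Over S}
    (h : T ⟶ affLine j) :
    pb h (affTaut g) = fn h (affCoord j) • pb (h ≫ affLineProj j) g := by
  rw [affTaut, pb_smul, pb_comp]

/-- Together with `exists_affLine_lift` this says that, once L has a generator over Spec A, the
affine line with `affTaut g` represents the sections of L over Spec A. -/
lemma affLine_hom_ext {A : CommRingCat.{u}} {j : Spec A ⟶ S} {g : Sections s L (Over.mk j)}
    (hg : IsGenerator g) {T : Over S} {h h' : T ⟶ affLine j}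
    (h1 : h ≫ affLineProj j = h' ≫ affLineProj j) (h2 : pb h (affTaut g) = pb h' (affTaut g)) :
    h = h' := by
  rw [pb_affTaut, pb_affTaut, h1] at h2
  exact affLine_ext h1 ((hg _ _).1 h2)

lemma exists_affLine_lift {A : CommRingCat.{u}} {j : Spec A ⟶ S} {g : Sections s L (Over.mk j)}
    (hg : IsGenerator g) {T : Over S} (t : T ⟶ Over.mk j) (x : Sections s L T) :
    ∃ h : T ⟶ affLine j, h ≫ affLineProj j = t ∧ pb h (affTaut g) = x := by
  obtain ⟨a, ha⟩ := (hg T t).2 x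
  obtain ⟨h, h1, h2⟩ := exists_affLine_hom t a
  exact ⟨h, h1, by rw [pb_affTaut, h1, h2, ← ha]⟩

/-- The generator is the image of 1 under a local trivialization; the work lies in identifying open
subsets of U with open subsets of S. -/
lemma IsInvertible.exists_isGen (hL : IsInvertible L) (x : S) :
    ∃ (U : S.Opens) (_ : x ∈ U) (g : Γ(L, U)), IsGen L U g := by
  obtain ⟨U, hx, ⟨e⟩⟩ := hL x
  have h1 : U ≤ U.ι ''ᵁ ⊤ := by simp
  have hg := isGen_of_isIso e.inv
  let g : Γ(L, U.ι ''ᵁ ⊤) := e.inv.app ⊤ (toUnit 1)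
  refine ⟨U.ι ''ᵁ ⊤, by simpa using hx, g, fun V hV => ?_⟩
  have hV' : V ≤ U := hV.trans (by simp)
  have h2 := hg (U.ι ⁻¹ᵁ V) le_top
  have h3 : Function.Bijective (U.ι.appIso (U.ι ⁻¹ᵁ V)).hom := ConcreteCategory.bijective_of_isIso _
  have e1 : U.ι ''ᵁ U.ι ⁻¹ᵁ V ≤ V := U.ι.image_preimage_le V
  have e2 : V ≤ U.ι ''ᵁ U.ι ⁻¹ᵁ V := by
    rw [U.ι.image_preimage_eq_opensRange_inf]
    exact le_inf (by simpa using hV') le_rfl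
  have h4 := h2.comp h3
  have h5 (a : Γ(S, U.ι ''ᵁ U.ι ⁻¹ᵁ V)) :
      (U.ι.appIso (U.ι ⁻¹ᵁ V)).hom a •
        FqBundle.mres (L.restrict U.ι) le_top (e.inv.app ⊤ (toUnit 1))
        = (a • FqBundle.mres L (e1.trans hV) g : Γ(L, U.ι ''ᵁ U.ι ⁻¹ᵁ V)) := by
    have : (U.ι.appIso (U.ι ⁻¹ᵁ V)).inv ((U.ι.appIso (U.ι ⁻¹ᵁ V)).hom a) = a :=
      congr($((U.ι.appIso (U.ι ⁻¹ᵁ V)).hom_inv_id) a)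
    conv_rhs => rw [← this]
    rfl
  have h6 : Function.Bijective fun a : Γ(S, U.ι ''ᵁ U.ι ⁻¹ᵁ V) =>
      a • FqBundle.mres L (e1.trans hV) g :=
    (congrArg Function.Bijective (funext h5)).mp h4
  obtain e3 := le_antisymm e1 e2
  have gen (W : S.Opens) (hW : W ≤ U.ι ''ᵁ ⊤) (hWV : W = V) :
      (Function.Bijective fun a : Γ(S, W) => a • FqBundle.mres L hW g) →
      Function.Bijective fun a : Γ(S, V) => a • FqBundle.mres L hV g := by
    subst hWV
    exact id
  exact gen _ _ e3 h6

lemma isInvertible_of_isGen (h : ∀ x : S, ∃ (U : S.Opens) (_ : x ∈ U) (g : Γ(L, U)), IsGen L U g) :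
    IsInvertible L := by
  intro x
  obtain ⟨U, hx, g, hg⟩ := h x
  have h1 := hg.restrict U.ι (by simp)
  have := h1.isIso
  exact ⟨U, hx, ⟨(@asIso _ _ _ _ _ this).symm⟩⟩

lemma IsInvertible.exists_affine (hL : IsInvertible L) (x : S) :
    ∃ (U : S.Opens) (_ : IsAffineOpen U) (_ : x ∈ U) (g : Γ(L, U)), IsGen L U g := by
  obtain ⟨U, hx, g, hg⟩ := hL.exists_isGen x
  obtain ⟨_, ⟨V, hV, rfl⟩, hxV, hVU⟩ := S.isBasis_affineOpens.exists_subset_of_mem_open hx U.isOpen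
  exact ⟨V, hV, hxV, _, hg.mres hVU⟩

end AffineLine

/-! ### Existence of the line bundle, by local representability. -/

section Representability

variable {k : Type u} [Field k] {s : S ⟶ Spec (.of k)} {L M : S.Modules}

/-- Identity of a scheme, as a morphism between `S`-schemes with equal structure morphisms. -/
def castOver {T : Scheme.{u}} {f f' : T ⟶ S} (h : f = f') : Over.mk f ⟶ Over.mk f' :=
  Over.homMk (𝟙 T) (by simp [h])

instance {T : Scheme.{u}} {f f' : T ⟶ S} (h : f = f') : IsIso (castOver h) := by
  subst h
  exact inferInstanceAs (IsIso (𝟙 (Over.mk f)))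

/-- Pairs of a morphism `f : T ⟶ S` and a section of `f^* L`. -/
structure TotalSections (s : S ⟶ Spec (.of k)) (L : S.Modules) (T : Scheme.{u}) : Type u where
  /-- The structure morphism. -/
  fst : T ⟶ S
  /-- The section. -/
  snd : Sections s L (Over.mk fst)

/-- Only the underlying morphisms of schemes are compared, which absorbs the changes of structure
morphism in `TotalSections`. -/
lemma pb_pb_eq {T T' T'' : Over S} {g : T' ⟶ T} {h : T'' ⟶ T'} {m : T'' ⟶ T}
    (e : h.left ≫ g.left = m.left) (x : Sections s L T) : pb h (pb g x) = pb m x := by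
  have : h ≫ g = m := by
    ext : 1
    exact e
  rw [← this, pb_comp]

/-- Pullback of pairs. -/
def TotalSections.comap {T T' : Scheme.{u}} (g : T' ⟶ T) (a : TotalSections s L T) :
    TotalSections s L T' :=
  ⟨g ≫ a.fst, pb (Over.homMk g : Over.mk (g ≫ a.fst) ⟶ Over.mk a.fst) a.snd⟩

lemma TotalSections.ext_iff {T : Scheme.{u}} {a b : TotalSections s L T} :
    a = b ↔ ∃ h : a.fst = b.fst, a.snd = pb (castOver h) b.snd := by
  constructor
  · rintro rfl
    exact ⟨rfl, (pb_id _).symm⟩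
  · obtain ⟨f, x⟩ := a
    obtain ⟨f', y⟩ := b
    rintro ⟨h, h'⟩
    dsimp only at h
    subst h
    congr 1
    exact h'.trans (pb_id _)

lemma TotalSections.comap_comap {T T' T'' : Scheme.{u}} (g : T' ⟶ T) (h : T'' ⟶ T')
    (a : TotalSections s L T) : (a.comap g).comap h = a.comap (h ≫ g) :=
  by
  have e := (Category.assoc h g a.fst).symm
  refine TotalSections.ext_iff.mpr ⟨e, ?_⟩
  let m₁ : Over.mk (g ≫ a.fst) ⟶ Over.mk a.fst := Over.homMk g
  let m₂ : Over.mk (h ≫ g ≫ a.fst) ⟶ Over.mk (g ≫ a.fst) := Over.homMk h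
  let m₃ : Over.mk ((h ≫ g) ≫ a.fst) ⟶ Over.mk a.fst := Over.homMk (h ≫ g)
  have hm : m₂ ≫ m₁ = castOver e ≫ m₃ := by
    ext : 1
    exact (Category.id_comp _).symm
  have := congrArg (fun m => pb m a.snd) hm
  exact (pb_comp m₁ m₂ a.snd).symm.trans (this.trans (pb_comp m₃ (castOver e) a.snd))

/-- The functor of pairs of a morphism `f : T ⟶ S` and a section of `f^* L`. -/
def totalSectionsFunctor (s : S ⟶ Spec (.of k)) (L : S.Modules) : Scheme.{u}ᵒᵖ ⥤ Type u where
  obj T := TotalSections s L T.unop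
  map g := ↾(TotalSections.comap g.unop)
  map_id T := by
    ext a
    refine TotalSections.ext_iff.mpr ⟨Category.id_comp _, ?_⟩
    rfl
  map_comp g h := by
    ext a
    exact (a.comap_comap g.unop h.unop).symm

lemma comap_eq_comap_iff {T T' T'' : Scheme.{u}} (g : T'' ⟶ T) (g' : T'' ⟶ T')
    (a : TotalSections s L T) (a' : TotalSections s L T') :
    a.comap g = a'.comap g' ↔ ∃ h : g ≫ a.fst = g' ≫ a'.fst,
      pb (Over.homMk g : Over.mk (g ≫ a.fst) ⟶ Over.mk a.fst) a.snd =
        pb (Over.homMk g' h.symm : Over.mk (g ≫ a.fst) ⟶ Over.mk a'.fst) a'.snd := by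
  rw [TotalSections.ext_iff]
  refine exists_congr fun h => ?_
  exact Eq.congr_right (pb_pb_eq (Category.id_comp _) _)

/-- The criterion for local representability concerns functors on all schemes, so the structure
morphism is part of the data: it is glued first, and the section afterwards over the glued morphism.
-/
lemma isSheaf_totalSectionsFunctor :
    Presieve.IsSheaf Scheme.zariskiTopology (totalSectionsFunctor s L) := by
  rw [Scheme.zariskiTopology, Scheme.grothendieckTopology,
    Precoverage.isSheaf_toGrothendieck_iff_of_isStableUnderBaseChange]
  rintro Y R hR x hx
  obtain ⟨(𝓤 : Scheme.OpenCover Y), rfl⟩ := Scheme.exists_cover_of_mem_pretopology hR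
  let x' (i : 𝓤.I₀) : TotalSections s L (𝓤.X i) := x (𝓤.f i) (.mk i)
  have hx' (i i' : 𝓤.I₀) (Z : Scheme.{u}) (a : Z ⟶ 𝓤.X i) (b : Z ⟶ 𝓤.X i')
      (h : a ≫ 𝓤.f i = b ≫ 𝓤.f i') : (x' i).comap a = (x' i').comap b := hx _ _ _ _ h
  let f : Y ⟶ S := 𝓤.glueMorphisms (fun i => (x' i).fst) fun i i' =>
    ((comap_eq_comap_iff _ _ _ _).mp (hx' i i' _ _ _ pullback.condition)).1
  have hf (i : 𝓤.I₀) : 𝓤.f i ≫ f = (x' i).fst := 𝓤.ι_glueMorphisms _ _ i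
  let j (i : 𝓤.I₀) : Over.mk (x' i).fst ⟶ Over.mk f := Over.homMk (𝓤.f i) (hf i)
  have hj (i : 𝓤.I₀) : IsOpenImmersion (j i).left := inferInstanceAs (IsOpenImmersion (𝓤.f i))
  have hcov (y : Y) : ∃ i, y ∈ (j i).left.opensRange := ⟨𝓤.idx y, 𝓤.covers y⟩
  obtain ⟨y, hy⟩ := sections_glue (s := s) (L := L) j hcov (fun i => (x' i).snd) (by
    intro i i' T a b hab
    obtain ⟨h, h'⟩ := (comap_eq_comap_iff _ _ _ _).mp
      (hx' i i' T.left a.left b.left congr($(hab).left))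
    have e := congrArg (pb (Over.homMk (𝟙 _) (by simpa using Over.w a) :
      T ⟶ Over.mk (a.left ≫ (x' i).fst))) h'
    rw [← pb_comp, ← pb_comp] at e
    convert e using 3 <;> (ext : 1; exact (Category.id_comp _).symm))
  refine ⟨(⟨f, y⟩ : TotalSections s L Y), ?_, ?_⟩
  · rintro Z e ⟨i⟩
    refine TotalSections.ext_iff.mpr ⟨hf i, ?_⟩
    rw [← hy]
    exact (pb_pb_eq (Category.id_comp _) _).symm
  · intro y' hy'
    have h1 (i : 𝓤.I₀) : TotalSections.comap (𝓤.f i) y' = x' i := hy' (𝓤.f i) (.mk i)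
    have h2 (i : 𝓤.I₀) := TotalSections.ext_iff.mp (h1 i)
    have h3 : y'.fst = f := 𝓤.hom_ext _ _ fun i => (h2 i).1.trans (hf i).symm
    refine TotalSections.ext_iff.mpr ⟨h3, ?_⟩
    have : IsIso (castOver h3.symm) := inferInstance
    let j' (i : 𝓤.I₀) : Over.mk (𝓤.f i ≫ y'.fst) ⟶ Over.mk y'.fst := Over.homMk (𝓤.f i)
    have hj' (i : 𝓤.I₀) : IsOpenImmersion (j' i).left := inferInstanceAs (IsOpenImmersion (𝓤.f i))
    refine sections_ext j' hcov fun i => ?_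
    obtain ⟨e1, e2⟩ := h2 i
    refine e2.trans ?_
    rw [← hy]
    exact (pb_comp _ _ _).symm.trans (pb_pb_eq (m := castOver e1 ≫ j i)
      ((Category.comp_id (𝓤.f i)).trans (Category.id_comp (𝓤.f i)).symm) y).symm

/-- The fibre over a pair (f, x) on T is T ×_S Spec A, which is open in T: there x is a unique
multiple of the generator, hence a unique point of the affine line. -/
lemma isOpenImmersion_presheaf_affTaut {A : CommRingCat.{u}} (j : Spec A ⟶ S) [IsOpenImmersion j]
    {g : Sections s L (Over.mk j)} (hg : IsGenerator g) :
    IsOpenImmersion.presheaf (yonedaEquiv.symm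
      (⟨(affLine j).hom, affTaut g⟩ : TotalSections s L (affLine j).left) :
      yoneda.obj (affLine j).left ⟶ totalSectionsFunctor s L) := by
  refine MorphismProperty.relative.of_exists fun T a => ?_
  let a' : TotalSections s L T := yonedaEquiv a
  let t : Over.mk (pullback.fst a'.fst j ≫ a'.fst) ⟶ Over.mk j :=
    Over.homMk (pullback.snd a'.fst j) pullback.condition.symm
  obtain ⟨h, h1, h2⟩ := exists_affLine_lift hg t
    (pb (Over.homMk (pullback.fst a'.fst j) : _ ⟶ Over.mk a'.fst) a'.snd)
  refine ⟨_, yoneda.map h.left, pullback.fst a'.fst j, ?_, inferInstance⟩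
  let e : TotalSections s L (affLine j).left := ⟨(affLine j).hom, affTaut g⟩
  have ha (Z : Scheme.{u}) (q : Z ⟶ T) : a.app (.op Z) q = a'.comap q := by
    have := yonedaEquiv_naturality a q
    exact (congrArg (fun x => (a.app (.op Z)) x) (Category.comp_id q).symm).trans
      (ConcreteCategory.congr_hom (a.naturality q.op) (𝟙 T))
  have w0 : e.comap h.left = a'.comap (pullback.fst a'.fst j) := by
    refine (comap_eq_comap_iff _ _ _ _).mpr ⟨Over.w h, ?_⟩
    have e2 := congrArg (pb (castOver (Over.w h))) h2
    refine (pb_pb_eq (Category.id_comp _) _).symm.trans (e2.trans ?_)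
    exact pb_pb_eq (Category.id_comp _) _
  refine IsPullback.of_forall_isPullback_app fun Z =>
    (Types.isPullback_iff _ _ _ _).mpr ⟨?_, ?_, ?_⟩
  · ext x
    have := congrArg (TotalSections.comap x) w0
    rw [TotalSections.comap_comap, TotalSections.comap_comap] at this
    exact this.trans (ha _ _).symm
  · rintro x y ⟨-, hxy⟩
    exact (cancel_mono (pullback.fst a'.fst j)).mp hxy
  · intro p q hpq
    obtain ⟨Z⟩ := Z
    change Z ⟶ _ at p q
    have hpq' : e.comap p = a'.comap q := hpq.trans (ha _ _)
    obtain ⟨e1, e2⟩ := (comap_eq_comap_iff _ _ _ _).mp hpq'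
    let x : Z ⟶ pullback a'.fst j := pullback.lift q (p ≫ (affLineProj j).left) (by
      rw [← e1, Category.assoc]
      rfl)
    have hxq : x ≫ pullback.fst a'.fst j = q := pullback.lift_fst _ _ _
    refine ⟨x, ?_, hxq⟩
    have hx : (x ≫ h.left) ≫ e.fst = p ≫ e.fst := by
      rw [Category.assoc]
      refine (congrArg (x ≫ ·) (Over.w h)).trans ?_
      change x ≫ pullback.fst a'.fst j ≫ a'.fst = _
      rw [reassoc_of% hxq, ← e1]
    let p' : Over.mk (p ≫ e.fst) ⟶ affLine j := Over.homMk p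
    let h' : Over.mk (p ≫ e.fst) ⟶ affLine j := Over.homMk (x ≫ h.left) hx
    have : h' = p' := by
      apply affLine_hom_ext hg
      · ext : 1
        change (x ≫ h.left) ≫ _ = p ≫ _
        have e3 : h.left ≫ (affLineProj j).left = pullback.snd a'.fst j := congr($(h1).left)
        rw [Category.assoc, e3]
        exact pullback.lift_snd _ _ _
      · refine Eq.trans ?_ e2.symm
        let y : Over.mk (p ≫ e.fst) ⟶ Over.mk (pullback.fst a'.fst j ≫ a'.fst) :=
          Over.homMk x (by
            change x ≫ pullback.fst a'.fst j ≫ a'.fst = p ≫ e.fst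
            rw [reassoc_of% hxq, e1])
        have e4 := congrArg (pb y) h2
        refine (pb_pb_eq rfl _).symm.trans (e4.trans (pb_pb_eq hxq _))
    exact congr($(this).left)

/-- A scheme that represents the functor of pairs is a line bundle. -/
def LineBundle.ofTotal {X : Scheme.{u}} (R : (totalSectionsFunctor s L).RepresentableBy X) :
    LineBundle s L :=
  let τ : TotalSections s L X := R.homEquiv (𝟙 X)
  have hR {Z : Scheme.{u}} (f : Z ⟶ X) : R.homEquiv f = τ.comap f := R.homEquiv_eq f
  { X := Over.mk τ.fst
    rep :=
      { homEquiv := fun {T} => Equiv.ofBijective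
          (fun φ : T ⟶ Over.mk τ.fst => (pb φ τ.snd : Sections s L T)) (by
          constructor
          · intro φ φ' h
            ext : 1
            apply R.homEquiv.injective
            rw [hR, hR]
            refine (comap_eq_comap_iff _ _ _ _).mpr ⟨(Over.w φ).trans (Over.w φ').symm, ?_⟩
            have e := congrArg (pb (Over.homMk (𝟙 T.left) ((Category.id_comp _).trans
              (Over.w φ).symm) : Over.mk (φ.left ≫ τ.fst) ⟶ T)) h
            exact (pb_pb_eq (Category.id_comp _) _).symm.trans
              (e.trans (pb_pb_eq (Category.id_comp _) _))
          · intro x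
            let x' : TotalSections s L T.left := ⟨T.hom, x⟩
            have e := R.homEquiv.apply_symm_apply x'
            let φ : T.left ⟶ X := R.homEquiv.symm x'
            have e' : τ.comap φ = x' := (hR φ).symm.trans e
            obtain ⟨e1, e2⟩ := TotalSections.ext_iff.mp e'
            refine ⟨Over.homMk φ e1, ?_⟩
            have e3 := congrArg (pb (Over.homMk (𝟙 T.left) ((Category.id_comp _).trans e1) :
              T ⟶ Over.mk (φ ≫ τ.fst))) e2
            refine (pb_pb_eq (Category.id_comp _) _).symm.trans (e3.trans ?_)
            refine (pb_pb_eq (m := 𝟙 T) (Category.id_comp _) _).trans (pb_id x))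
        homEquiv_comp := fun f g => pb_comp g f τ.snd } }

/-- The affine lines over affine open sets with a generator are open subfunctors that cover the
sheaf of pairs. -/
lemma nonempty_lineBundle (hL : IsInvertible L) : Nonempty (LineBundle s L) := by
  choose U hU hx g hg using hL.exists_affine
  let G (x : S) : Sections s L (Over.mk (hU x).fromSpec) :=
    ofOpen s (Over.mk (hU x).fromSpec) (U x) (by simp) (g x)
  have hG (x : S) : IsGenerator (G x) := (hg x).isGenerator_ofOpen _ _
  let F : Sheaf Scheme.zariskiTopology.{u} (Type u) := ⟨totalSectionsFunctor s L,
    (isSheaf_iff_isSheaf_of_type _ _).mpr isSheaf_totalSectionsFunctor⟩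
  let f (x : S) : yoneda.obj (affLine (hU x).fromSpec).left ⟶ F.1 := yonedaEquiv.symm
      (⟨(affLine (hU x).fromSpec).hom, affTaut (G x)⟩ : TotalSections s L _)
  have hf (x : S) : IsOpenImmersion.presheaf (f x) :=
    isOpenImmersion_presheaf_affTaut (hU x).fromSpec (hG x)
  -- A pair on T comes from the affine line over U x as soon as it is restricted to the preimage of
  -- U x.
  have hsurj : Presheaf.IsLocallySurjective Scheme.zariskiTopology (Sigma.desc f) := by
    refine ⟨fun {T} a => ?_⟩
    obtain ⟨φ, y⟩ : TotalSections s L T := a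
    rw [Scheme.mem_grothendieckTopology_iff]
    let 𝒰 := T.openCoverOfIsOpenCover (fun x : S => φ ⁻¹ᵁ U x) (by
      rw [TopologicalSpace.IsOpenCover, eq_top_iff]
      intro y _
      exact TopologicalSpace.Opens.mem_iSup.mpr ⟨φ y, hx _⟩)
    refine ⟨𝒰, ?_⟩
    rintro _ _ ⟨x⟩
    have hr : Set.range ((φ ⁻¹ᵁ U x).ι ≫ φ) ⊆ Set.range (hU x).fromSpec := by
      rintro _ ⟨z, rfl⟩
      simpa using! z.2
    let t : Over.mk ((φ ⁻¹ᵁ U x).ι ≫ φ) ⟶ Over.mk (hU x).fromSpec :=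
      Over.homMk (IsOpenImmersion.lift _ _ hr) (IsOpenImmersion.lift_fac _ _ _)
    obtain ⟨h, h1, h2⟩ := exists_affLine_lift (hG x) t
      (pb (Over.homMk (φ ⁻¹ᵁ U x).ι : _ ⟶ Over.mk φ) y)
    refine ⟨(Sigma.ι (fun x => yoneda.obj (affLine (hU x).fromSpec).left) x).app _ h.left, ?_⟩
    have e1 := congr($(congr(NatTrans.app $(Sigma.ι_desc f x) (.op (φ ⁻¹ᵁ U x).toScheme))) h.left)
    refine e1.trans ?_
    refine (comap_eq_comap_iff _ _ _ _).mpr ⟨Over.w h, ?_⟩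
    have e2 := congrArg (pb (castOver (Over.w h))) h2
    refine (pb_pb_eq (Category.id_comp _) _).symm.trans (e2.trans ?_)
    exact pb_pb_eq (Category.id_comp _) _
  have R := Scheme.LocalRepresentability.representableBy hf
  exact ⟨LineBundle.ofTotal R⟩

end Representability

/-! ### Monogenic finite flat algebras, and monic polynomials determined by their roots. -/

section Monogenic

open Polynomial

/-- Division by Q with remainder expresses p(f)v through the powers of f below the degree of Q. -/
lemma aeval_apply_mem_of_monic {R M : Type*} [CommRing R] [AddCommGroup M] [Module R M]
    {f : Module.End R M} {v : M} {Q : R[X]} (hQ : Q.Monic) (h0 : aeval f Q = 0)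
    (N : Submodule R M) (hN : ∀ i < Q.natDegree, (f ^ i) v ∈ N) (p : R[X]) : aeval f p v ∈ N := by
  cases subsingleton_or_nontrivial R
  · rw [Subsingleton.elim p 0, map_zero, LinearMap.zero_apply]
    exact N.zero_mem
  have h1 : aeval f p = aeval f (p %ₘ Q) := by
    conv_lhs => rw [← modByMonic_add_div p Q]
    simp [h0]
  rw [h1, aeval_eq_sum_range, LinearMap.sum_apply]
  refine sum_mem fun i hi => N.smul_mem _ ?_
  by_cases hi' : i < Q.natDegree
  · exact hN i hi'
  -- For Q = 1 the remainder is 0 and its `natDegree` is not below that of Q; but then all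
  -- endomorphisms of M vanish.
  · rcases eq_or_ne Q 1 with rfl | hQ1
    · have : f ^ i = 0 := by
        rw [map_one] at h0
        rw [← mul_one (f ^ i), h0, mul_zero]
      simp [this]
    · have := natDegree_modByMonic_lt p hQ hQ1
      simp at hi
      omega

attribute [local instance] Module.free_of_flat_of_isLocalRing

/-- A finite flat algebra of constant rank `r` that is generated by one element is the quotient
of the polynomial ring by a monic polynomial of degree `r`. -/
theorem exists_monic_aeval_eq_zero_iff {A B : Type u} [CommRing A] [CommRing B] [Algebra A B]
    [Module.Finite A B] [Module.Flat A B] (x : B)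
    (hx : Function.Surjective (aeval x : A[X] →ₐ[A] B)) (r : ℕ)
    (hr : ∀ p, Module.rankAtStalk (R := A) B p = r) :
    ∃ P : A[X], P.Monic ∧ (Nontrivial A → P.natDegree = r) ∧ ∀ p, aeval x p = 0 ↔ P ∣ p := by
  cases subsingleton_or_nontrivial A
  -- Over the zero ring every `natDegree` is 0 while r is arbitrary, so the degree is claimed only
  -- for nontrivial A.
  · exact ⟨1, monic_one, fun h => (not_nontrivial A h).elim, fun p => by
      simp [Subsingleton.elim p 0]⟩
  let ψ : (Fin r → A) →ₗ[A] B := Fintype.linearCombination A fun i : Fin r => x ^ (i : ℕ)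
  have hψ1 (i : Fin r) : ψ (Pi.single i 1) = x ^ (i : ℕ) := by
    simp [ψ, Fintype.linearCombination_apply_single]
  -- At a maximal ideal B becomes free of rank r. The characteristic polynomial of multiplication by
  -- x then has degree r, and by Cayley–Hamilton 1, x, …, x^(r-1) span.
  have hψ : Function.Surjective ψ := by
    refine surjective_of_localized_maximal ψ fun m hm => ?_
    let R := Localization m.primeCompl
    let f : Module.End R (LocalizedModule m.primeCompl B) :=
      LocalizedModule.map m.primeCompl (LinearMap.mulLeft A x)
    have hf (n : ℕ) (b : B) (t : m.primeCompl) :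
        (f ^ n) (LocalizedModule.mk b t) = LocalizedModule.mk (x ^ n * b) t := by
      induction n with
      | zero => simp
      | succ n ih =>
        rw [pow_succ', Module.End.mul_apply, ih]
        refine (LocalizedModule.map_mk _ _ _ _).trans ?_
        simp [pow_succ', mul_assoc]
    have hdeg : f.charpoly.natDegree = r := by
      rw [LinearMap.charpoly_natDegree]
      exact hr ⟨m, inferInstance⟩
    have key (p : R[X]) := aeval_apply_mem_of_monic (v := LocalizedModule.mk 1 1)
      f.charpoly_monic f.aeval_self_charpoly
      (LinearMap.range (LocalizedModule.map m.primeCompl ψ)) (fun i hi => by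
        rw [hdeg] at hi
        refine ⟨LocalizedModule.mk (Pi.single ⟨i, hi⟩ 1) 1, ?_⟩
        rw [LocalizedModule.map_mk, hψ1, hf, mul_one]) p
    intro y
    induction y using LocalizedModule.induction_on with
    | h b t =>
      obtain ⟨p, rfl⟩ := hx b
      suffices h : LocalizedModule.mk (aeval x p) t ∈
          LinearMap.range (LocalizedModule.map m.primeCompl ψ) from h
      rw [aeval_eq_sum_range]
      have : LocalizedModule.mk (∑ i ∈ Finset.range (p.natDegree + 1), p.coeff i • x ^ i) t =
          (Localization.mk 1 t : R) • ∑ i ∈ Finset.range (p.natDegree + 1),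
            p.coeff i • LocalizedModule.mk (x ^ i) (1 : m.primeCompl) := by
        have h2 : ∑ i ∈ Finset.range (p.natDegree + 1),
            p.coeff i • LocalizedModule.mk (x ^ i) (1 : m.primeCompl) =
            LocalizedModule.mk (∑ i ∈ Finset.range (p.natDegree + 1), p.coeff i • x ^ i) 1 := by
          simp only [← LocalizedModule.mkLinearMap_apply, map_sum, map_smul]
        rw [h2, LocalizedModule.mk_smul_mk, one_smul, mul_one]
      rw [this]
      refine Submodule.smul_mem _ _ (sum_mem fun i _ => ?_)
      have h3 := key (X ^ i)
      rw [aeval_X_pow, hf, mul_one] at h3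
      exact Submodule.smul_of_tower_mem _ _ h3
  -- Expressing x^r through lower powers yields the monic relation X^r - q.
  obtain ⟨c, hc⟩ := hψ (x ^ r)
  let q : A[X] := ∑ i : Fin r, C (c i) * X ^ (i : ℕ)
  have hq : q.degree < r := by
    refine degree_lt_iff_coeff_zero _ _ |>.mpr fun n hn => ?_
    simp only [q, finsetSum_coeff, coeff_C_mul, coeff_X_pow]
    refine Finset.sum_eq_zero fun i _ => ?_
    rw [if_neg (by omega), mul_zero]
  have hP : (X ^ r - q).Monic := monic_X_pow_sub (by simpa using hq)
  have hPd : (X ^ r - q).natDegree = r := by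
    refine natDegree_eq_of_degree_eq_some ?_
    rw [degree_sub_eq_left_of_degree_lt] <;> simp [hq]
  have hP0 : aeval x (X ^ r - q) = 0 := by
    rw [map_sub, aeval_X_pow, ← hc]
    simp [q, ψ, Fintype.linearCombination_apply, Algebra.smul_def]
  have := hP.free_adjoinRoot
  have := hP.finite_adjoinRoot
  let φ : AdjoinRoot (X ^ r - q) →ₐ[A] B := AdjoinRoot.liftAlgHom _ (Algebra.ofId A B) x hP0
  have hφ (p : A[X]) : φ (AdjoinRoot.mk _ p) = aeval x p := by
    rfl
  -- A[X]/(X^r - q) maps onto B, and both are finite and flat of rank r, so the map is bijective.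
  have hb := Module.bijective_of_surjective_of_rankAtStalk_eq (φ := φ.toLinearMap)
    (fun b => by
      obtain ⟨p, rfl⟩ := hx b
      exact ⟨AdjoinRoot.mk _ p, hφ p⟩)
    (fun m _ => by
      rw [hr, Module.rankAtStalk_eq_finrank_of_free]
      exact (finrank_quotient_span_eq_natDegree' hP).trans hPd)
  refine ⟨_, hP, fun _ => hPd, fun p => ?_⟩
  rw [← hφ, ← AdjoinRoot.mk_eq_zero, ← (map_eq_zero_iff φ hb.1)]

lemma eq_zero_of_monic_dvd {A : Type*} [CommRing A] {P Q : A[X]} (hP : P.Monic) (h : P ∣ Q)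
    (hd : ∀ n, P.natDegree ≤ n → Q.coeff n = 0) : Q = 0 := by
  nontriviality A
  by_contra h0
  refine hP.not_dvd_of_degree_lt h0 ?_ h
  rw [degree_eq_natDegree hP.ne_zero]
  exact (degree_lt_iff_coeff_zero _ _).mpr hd

lemma map_hasseDeriv {A B : Type*} [CommRing A] [CommRing B] (φ : A →+* B) (P : A[X]) (i : ℕ) :
    (hasseDeriv i P).map φ = hasseDeriv i (P.map φ) := by
  ext n
  simp [hasseDeriv_coeff]

/-- A monic polynomial without constant term whose roots are stable under addition, universally,
is additive. -/
theorem eval₂_add_of_monic {A : Type u} [CommRing A] {P : A[X]} (hP : P.Monic)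
    (h0 : P.coeff 0 = 0)
    (h : ∀ (R : Type u) [CommRing R] (φ : A →+* R) (a b : R), P.eval₂ φ a = 0 →
      P.eval₂ φ b = 0 → P.eval₂ φ (a + b) = 0)
    {R : Type*} [CommRing R] (φ : A →+* R) (a b : R) :
    P.eval₂ φ (a + b) = P.eval₂ φ a + P.eval₂ φ b := by
  have key (i : ℕ) (hi : i ≠ 0) : hasseDeriv i P = C (P.coeff i) := by
    let Q := P.map (AdjoinRoot.of P)
    have hQ : Q.Monic := hP.map _
    let x : AdjoinRoot P := AdjoinRoot.root P
    -- In A[x][Y]/(Q(Y)) both x and the class of Y are roots of P, hence so is their sum: this is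
    -- the universal pair of roots.
    have h1 : Q ∣ taylor x Q := by
      rw [← AdjoinRoot.mk_eq_zero, ← AdjoinRoot.aeval_eq, aeval_def, taylor_apply, eval₂_comp,
        eval₂_add, eval₂_X, eval₂_C, eval₂_map]
      refine h _ _ _ _ ?_ ?_
      · rw [← eval₂_map]
        exact AdjoinRoot.eval₂_root Q
      · rw [← hom_eval₂, AdjoinRoot.eval₂_root, map_zero]
    have h2 : taylor x Q = Q :=
      (eq_of_monic_of_dvd_of_natDegree_le hQ (by
        rw [Monic, leadingCoeff, natDegree_taylor, coeff_taylor_natDegree]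
        exact hQ) h1 (natDegree_taylor _ _).le)
    have h3 := congr(coeff $h2 i)
    rw [taylor_coeff] at h3
    -- Comparing coefficients in P(X + x) = P(X) shows that the i-th Hasse derivative takes the
    -- value `P.coeff i` at x. For i > 0 its degree is below that of P, so the congruence modulo P
    -- is an equality.
    have h4 : P ∣ hasseDeriv i P - C (P.coeff i) := by
      rw [← AdjoinRoot.mk_eq_zero, map_sub, sub_eq_zero, ← AdjoinRoot.aeval_eq, aeval_def,
        ← Polynomial.eval_map, AdjoinRoot.mk_C, AdjoinRoot.algebraMap_eq]
      rw [coeff_map] at h3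
      rw [← h3, ← map_hasseDeriv]
    nontriviality A
    have h5 : P.natDegree ≠ 0 := fun h5 => by
      rw [← h5] at h0
      exact hP.ne_zero (leadingCoeff_eq_zero.mp h0)
    refine sub_eq_zero.mp (eq_zero_of_monic_dvd hP h4 fun n hn => ?_)
    rw [coeff_sub, hasseDeriv_coeff, coeff_eq_zero_of_natDegree_lt (by omega), mul_zero,
      coeff_C_of_ne_zero (by omega), sub_zero]
  -- The Taylor coefficients at a are the values of the Hasse derivatives there; only the constant
  -- one depends on a.
  have h2 : taylor a (P.map φ) = P.map φ + C ((P.map φ).eval a) := by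
    ext i
    rw [taylor_coeff, coeff_add, coeff_C]
    split_ifs with hi
    · subst hi
      simp [h0]
    · rw [← map_hasseDeriv, key i hi]
      simp
  have h3 := congr(eval b $h2)
  rw [taylor_eval, eval_add, eval_C, Polynomial.eval_map, Polynomial.eval_map,
    Polynomial.eval_map] at h3
  rw [add_comm a b, h3, add_comm]

/-- If multiplication by `u` maps the roots of `P'` to the roots of `P`, universally, and `P` and
`P'` are monic of the same degree, then `P (u X) = u ^ deg P * P' X`. -/
theorem eval₂_mul_of_monic {A : Type u} [CommRing A] {P P' : A[X]} (hP : P.Monic)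
    (hP' : P'.Monic) (hd : P.natDegree = P'.natDegree) (u : A)
    (h : ∀ (R : Type u) [CommRing R] (φ : A →+* R) (a : R), P'.eval₂ φ a = 0 →
      P.eval₂ φ (φ u * a) = 0)
    {R : Type*} [CommRing R] (φ : A →+* R) (a : R) :
    P.eval₂ φ (φ u * a) = φ u ^ P.natDegree * P'.eval₂ φ a := by
  have h1 : P' ∣ P.comp (C u * X) := by
    rw [← AdjoinRoot.mk_eq_zero, ← AdjoinRoot.aeval_eq, aeval_def, eval₂_comp, eval₂_mul, eval₂_X,
      eval₂_C]
    exact h _ _ _ (AdjoinRoot.eval₂_root P')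
  -- Both sides have top coefficient u^(deg P), so the difference has degree below that of P', which
  -- divides it.
  have h2 : P.comp (C u * X) = C (u ^ P.natDegree) * P' := by
    refine sub_eq_zero.mp (eq_zero_of_monic_dvd hP'
      (dvd_sub h1 (dvd_mul_left _ _)) fun n hn => ?_)
    rw [coeff_sub, comp_C_mul_X_coeff, coeff_C_mul]
    rcases hn.eq_or_lt with rfl | hn
    · rw [hP'.coeff_natDegree, ← hd, hP.coeff_natDegree, one_mul, mul_one, sub_self]
    · rw [coeff_eq_zero_of_natDegree_lt hn, coeff_eq_zero_of_natDegree_lt (by omega), zero_mul,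
        mul_zero, sub_zero]
  have h3 := congr(eval₂ φ a $h2)
  rwa [eval₂_comp, eval₂_mul, eval₂_mul, eval₂_X, eval₂_C, eval₂_C, map_pow] at h3

end Monogenic

/-! ### The equation of G in a chart. -/

section Equation

open Polynomial

variable {k : Type u} [Field k] {s : S ⟶ Spec (.of k)} {L M : S.Modules}

/-- `P = 0` is the equation of `G` in `𝔾_{a,L}` over `Spec A`, in the coordinate given by the
section `g`. -/
def IsEqn (V : LineBundle s L) {G : Over S} (i : G ⟶ V.X) {A : CommRingCat.{u}} {j : Spec A ⟶ S}
    (g : Sections s L (Over.mk j)) (P : A[X]) : Prop :=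
  ∀ (T : Over S) (t : T ⟶ Over.mk j) (a : Γ(T.left, ⊤)),
    (∃ y : T ⟶ G, y ≫ i = V.pt (a • pb t g)) ↔ P.eval₂ (ringOf t) a = 0

lemma exists_affine_pullback {G : Over S} [IsFinite G.hom] [Flat G.hom] {A : CommRingCat.{u}}
    (j : Spec A ⟶ S) :
    ∃ (B : CommRingCat.{u}) (φ : A ⟶ B) (y : Spec B ⟶ G.left),
      IsPullback y (Spec.map φ) G.hom j ∧ φ.hom.Finite ∧ φ.hom.Flat := by
  have : IsAffine (pullback G.hom j) := isAffine_of_isAffineHom (pullback.snd G.hom j)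
  obtain ⟨φ, hφ⟩ := Spec.map_surjective ((pullback G.hom j).isoSpec.inv ≫ pullback.snd G.hom j)
  have h : IsPullback ((pullback G.hom j).isoSpec.inv ≫ pullback.fst G.hom j) (Spec.map φ)
      G.hom j := (IsPullback.of_hasPullback G.hom j).of_iso' (pullback G.hom j).isoSpec.symm
        (Iso.refl _) (Iso.refl _) (Iso.refl _) (by simp) (by simp [hφ]) (by simp) (by simp)
  refine ⟨_, φ, _, h, ?_, ?_⟩
  · rw [← IsFinite.SpecMap_iff]
    exact MorphismProperty.of_isPullback h inferInstance
  · rw [← Flat.SpecMap_iff]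
    exact MorphismProperty.of_isPullback h inferInstance

/-- The pullback of `G` to the chart is Spec B, and its inclusion into the affine line is given by
an element x of B. Once x generates B, the polynomial with B = A[X]/(P) is an equation, because
points of Spec B are then roots of P. -/
theorem LineBundle.IsFiniteFlatFqSubgroup.exists_isEqn {V : LineBundle s L} {G : Over S}
    [AddGrpObj G] {i : G ⟶ V.X} (hi : V.IsFiniteFlatFqSubgroup i) {A : CommRingCat.{u}}
    {j : Spec A ⟶ S} {g : Sections s L (Over.mk j)} (hg : IsGenerator g) (r : ℕ)
    (hr : ∀ x, G.hom.finrank (j x) = r) :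
    ∃ P : A[X], P.Monic ∧ (Nontrivial A → P.natDegree = r) ∧ IsEqn V i g P := by
  have := hi.finite
  have := hi.flat
  have := hi.mono
  obtain ⟨B, φ, y', hpb, hfin, hflat⟩ := exists_affine_pullback (G := G) j
  let Y : Over S := Over.mk (Spec.map φ ≫ j)
  let y : Y ⟶ G := Over.homMk y' hpb.w
  have hY {T : Over S} {h h' : T ⟶ Y} (h1 : h ≫ specOver j φ = h' ≫ specOver j φ)
      (h2 : h ≫ y = h' ≫ y) : h = h' := by
    ext : 1
    exact hpb.hom_ext congr(($h2).left) congr(($h1).left)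
  have hY' {T : Over S} (t : T ⟶ Over.mk j) (z : T ⟶ G) :
      ∃ h : T ⟶ Y, h ≫ specOver j φ = t ∧ h ≫ y = z := by
    have hw : z.left ≫ G.hom = t.left ≫ j := (Over.w z).trans (Over.w t).symm
    refine ⟨Over.homMk (hpb.lift z.left t.left hw) ?_, ?_, ?_⟩
    · refine (Category.assoc _ _ _).symm.trans ?_
      rw [hpb.lift_snd]
      exact Over.w t
    · ext : 1
      exact hpb.lift_snd _ _ _
    · ext : 1
      exact hpb.lift_fst _ _ _
  obtain ⟨a0, ha0⟩ := (hg Y (specOver j φ)).2 (V.val (y ≫ i))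
  obtain ⟨x, rfl⟩ := (ringOf_id_bijective (Spec.map φ ≫ j)).2 a0
  have hval {T : Over S} (h : T ⟶ Y) :
      h ≫ y ≫ i = V.pt (ringOf h x • pb (h ≫ specOver j φ) g) := by
    apply V.val_injective
    rw [V.val_comp, ← ha0, V.val_pt, pb_smul, ← pb_comp, ← ringOf_comp_apply, Category.comp_id]
  let f : CommRingCat.of A[X] ⟶ B := CommRingCat.ofHom (eval₂RingHom φ.hom x)
  have hfC (a : A) : f.hom (C a) = φ.hom a := eval₂_C φ.hom x
  have hfX : f.hom (Polynomial.X (R := A)) = x := eval₂_X φ.hom x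
  -- Two ring maps out of B that agree on A[X] define two points of `G` with the same image under
  -- the monomorphism `i`.
  have : Epi f := by
    refine ⟨fun {D} u v huv => ?_⟩
    have e (a : A) : v.hom (φ.hom a) = u.hom (φ.hom a) := by
      rw [← hfC]
      exact congr($(huv.symm) (C a))
    obtain ⟨hu, hu1, hu2⟩ := exists_specLift φ (specOver j (φ ≫ u))
      ((ringOf (𝟙 (Over.mk (Spec.map (φ ≫ u) ≫ j)))).comp u.hom)
      fun a => (ringOf_specOver j (φ ≫ u) a).symm
    obtain ⟨hv, hv1, hv2⟩ := exists_specLift φ (specOver j (φ ≫ u))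
      ((ringOf (𝟙 (Over.mk (Spec.map (φ ≫ u) ≫ j)))).comp v.hom)
      fun a => (congrArg (ringOf (𝟙 (Over.mk (Spec.map (φ ≫ u) ≫ j)))) (e a)).trans
        (ringOf_specOver j (φ ≫ u) a).symm
    have e1 : hu ≫ y = hv ≫ y := by
      rw [← cancel_mono i, Category.assoc, Category.assoc, hval, hval, hu1, hv1, hu2, hv2]
      have : u.hom x = v.hom x := by
        rw [← hfX]
        exact congr($huv (Polynomial.X (R := A)))
      rw [RingHom.comp_apply, RingHom.comp_apply, this]
    have e2 := congrArg ringOf (hY (hu1.trans hv1.symm) e1)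
    rw [hu2, hv2] at e2
    ext b
    exact (ringOf_id_bijective _).1 congr($e2 b)
  have hfφ : f.hom.comp (C : A →+* A[X]) = φ.hom := RingHom.ext hfC
  have hfs : Function.Surjective f.hom := RingHom.surjective_of_epi_of_finite f
    (RingHom.Finite.of_comp_finite (f := (C : A →+* A[X])) (hfφ ▸ hfin))
  algebraize [φ.hom]
  obtain ⟨P, hP, hPd, hP0⟩ := exists_monic_aeval_eq_zero_iff (A := A) (B := B) x hfs r (fun p => by
    rw [← Scheme.Hom.finrank_SpecMap_algebraMap, ← hr p]
    exact Scheme.Hom.finrank_of_isPullback _ _ _ _ hpb p)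
  refine ⟨P, hP, hPd, fun T t a => ⟨?_, fun ha => ?_⟩⟩
  · rintro ⟨z, hz⟩
    obtain ⟨h, rfl, rfl⟩ := hY' t z
    rw [Category.assoc, hval] at hz
    have h1 := (hg T _).1 (V.rep.homEquiv.symm.injective hz)
    have h2 : ringOf (h ≫ specOver j φ) = (ringOf h).comp φ.hom :=
      RingHom.ext (ringOf_comp_specOver h)
    rw [h2, ← h1, ← hom_eval₂]
    exact (congrArg (ringOf h) ((hP0 P).mpr dvd_rfl)).trans (map_zero _)
  -- Evaluation at a root of P factors through B = A[X]/(P), and so defines a point of `G`.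
  · let ψ := f.hom.liftOfSurjective hfs ⟨eval₂RingHom (ringOf t) a, fun p hp => by
      obtain ⟨q, rfl⟩ := (hP0 p).mp hp
      rw [RingHom.mem_ker, map_mul, coe_eval₂RingHom, ha, zero_mul]⟩
    have hψ (p : A[X]) : ψ (f.hom p) = p.eval₂ (ringOf t) a :=
      f.hom.liftOfRightInverse_comp_apply _ _ _ p
    obtain ⟨h, h1, h2⟩ := exists_specLift φ t ψ (fun b => by rw [← hfC, hψ, eval₂_C])
    refine ⟨h ≫ y, ?_⟩
    rw [Category.assoc, hval, h1, h2, ← hfX, hψ, eval₂_X]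

end Equation

/-! ### Additivity, homogeneity and F_q-linearity of the equation. -/

section EquationProperties

open Polynomial
open scoped AddMonObj

variable {k : Type u} [Field k] {s : S ⟶ Spec (.of k)} {L M : S.Modules}

lemma LineBundle.pt_add (V : LineBundle s L) {T : Over S} (x y : Sections s L T) :
    V.pt (x + y) = V.pt x + V.pt y :=
  V.val_injective <| by rw [V.val_add, V.val_pt, V.val_pt, V.val_pt]

lemma LineBundle.pt_zero (V : LineBundle s L) {T : Over S} :
    V.pt (0 : Sections s L T) = 0 :=
  V.val_injective <| by rw [V.val_zero, V.val_pt]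

lemma LineBundle.pt_smul (V : LineBundle s L) {T : Over S} (c : k) (x : Sections s L T) :
    V.pt (c • x) = V.pt x ≫ V.smul c :=
  V.val_injective <| by rw [V.val_smul, V.val_pt, V.val_pt]

lemma exists_ringOf_eq {A C : CommRingCat.{u}} {j : Spec A ⟶ S} {j' : Spec C ⟶ S}
    (t : Over.mk j' ⟶ Over.mk j) :
    ∃ α : A →+* C, ∀ a, ringOf t a = ringOf (𝟙 (Over.mk j')) (α a) := by
  let e := RingEquiv.ofBijective _ (ringOf_id_bijective j')
  exact ⟨e.symm.toRingHom.comp (ringOf t), fun a => (e.apply_symm_apply _).symm⟩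

lemma ringOf_comp_eq {A C : CommRingCat.{u}} {j : Spec A ⟶ S} {j' : Spec C ⟶ S}
    {t : Over.mk j' ⟶ Over.mk j} {α : A →+* C}
    (hα : ∀ a, ringOf t a = ringOf (𝟙 (Over.mk j')) (α a)) {T : Over S} (h : T ⟶ Over.mk j') :
    ringOf (h ≫ t) = (ringOf h).comp α := by
  ext a
  rw [ringOf_comp_apply, hα, ← ringOf_comp_apply, Category.comp_id]
  rfl

namespace IsEqn

variable {V : LineBundle s L} {G : Over S} {i : G ⟶ V.X} {A : CommRingCat.{u}} {j : Spec A ⟶ S}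
  {g : Sections s L (Over.mk j)} {P : A[X]}

lemma baseChange (hP : IsEqn V i g P) {C : CommRingCat.{u}} {j' : Spec C ⟶ S}
    (t : Over.mk j' ⟶ Over.mk j) {α : A →+* C}
    (hα : ∀ a, ringOf t a = ringOf (𝟙 (Over.mk j')) (α a)) :
    IsEqn V i (pb t g) (P.map α) := fun T t' a => by
  rw [← pb_comp, hP, eval₂_map, ringOf_comp_eq hα]

/-- The defining property of an equation, for points with values in an `A`-algebra. -/
lemma eval₂_eq_zero_iff (hP : IsEqn V i g P) {R : Type u} [CommRing R] (φ : A →+* R) (a : R) :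
    P.eval₂ φ a = 0 ↔
      ∃ y : Over.mk (Spec.map (CommRingCat.ofHom φ) ≫ j) ⟶ G, y ≫ i =
        V.pt (ringOf (A := .of R) (𝟙 (Over.mk (Spec.map (CommRingCat.ofHom φ) ≫ j))) a •
          pb (specOver j (CommRingCat.ofHom φ)) g) := by
  rw [hP]
  have h := ringOf_id_bijective (A := .of R) (Spec.map (CommRingCat.ofHom φ) ≫ j)
  have e : ringOf (specOver j (CommRingCat.ofHom φ)) =
      (ringOf (A := .of R) (𝟙 (Over.mk (Spec.map (CommRingCat.ofHom φ) ≫ j)))).comp φ :=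
    RingHom.ext (ringOf_specOver j (CommRingCat.ofHom φ))
  rw [e, ← hom_eval₂]
  exact (map_eq_zero_iff _ h.1).symm

section Group

variable [AddGrpObj G]

lemma coeff_zero (hP : IsEqn V i g P) (hi : IsAddMonHom i) : P.coeff 0 = 0 := by
  have h := (hP _ (𝟙 _) 0).mp ⟨0, by
    rw [zero_smul, V.pt_zero, zero_comp_of_isAddMonHom i hi]⟩
  rw [eval₂_at_zero] at h
  exact (map_eq_zero_iff _ (ringOf_id_bijective j).1).mp h

lemma eval₂_add (hP : IsEqn V i g P) (hm : P.Monic) (hi : IsAddMonHom i) {R : Type*} [CommRing R]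
    (φ : A →+* R) (a b : R) : P.eval₂ φ (a + b) = P.eval₂ φ a + P.eval₂ φ b := by
  refine eval₂_add_of_monic hm (hP.coeff_zero hi) (fun R _ φ a b ha hb => ?_) φ a b
  rw [hP.eval₂_eq_zero_iff] at ha hb ⊢
  obtain ⟨y, hy⟩ := ha
  obtain ⟨z, hz⟩ := hb
  exact ⟨y + z, by rw [add_comp_of_isAddMonHom i hi, hy, hz, map_add, add_smul, V.pt_add]⟩

end Group

/-- The equations of `G` for two generators that differ by a unit. -/
lemma eval₂_mul (hP : IsEqn V i g P) (hm : P.Monic) {g' : Sections s L (Over.mk j)} {P' : A[X]}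
    (hP' : IsEqn V i g' P') (hm' : P'.Monic) (hd : P.natDegree = P'.natDegree) (u : A)
    (hu : g' = ringOf (𝟙 (Over.mk j)) u • g) {R : Type*} [CommRing R] (φ : A →+* R) (a : R) :
    P.eval₂ φ (φ u * a) = φ u ^ P.natDegree * P'.eval₂ φ a := by
  refine eval₂_mul_of_monic hm hm' hd u (fun R _ φ a ha => ?_) φ a
  rw [IsEqn.eval₂_eq_zero_iff ‹_›] at ha ⊢
  obtain ⟨y, hy⟩ := ha
  refine ⟨y, hy.trans ?_⟩
  rw [hu, pb_smul, ← ringOf_comp_apply, Category.comp_id, smul_smul, ringOf_specOver, map_mul,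
    mul_comm]
  rfl

/-- Stability under c gives P(cX) = c^(deg P) P(X), and c^(q^n) = c in a field with q elements. -/
lemma eval₂_scalar (hP : IsEqn V i g P) (hm : P.Monic) [Finite k]
    (hs : ∀ c : k, ∃ a : G ⟶ G, a ≫ i = i ≫ V.smul c)
    (hd : Nontrivial A → ∃ n, P.natDegree = Nat.card k ^ n) (c : k) {T : Over S}
    (t : T ⟶ Over.mk j) (a : Γ(T.left, ⊤)) :
    P.eval₂ (ringOf t) (scalars s T c * a) = scalars s T c * P.eval₂ (ringOf t) a := by
  obtain ⟨b, hb⟩ := (ringOf_id_bijective j).2 (scalars s (Over.mk j) c)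
  have hb' {T : Over S} (t : T ⟶ Over.mk j) : ringOf t b = scalars s T c := by
    rw [← Category.comp_id t, ringOf_comp_apply, hb, fn_scalars]
  have key := eval₂_mul_of_monic hm hm rfl b (fun R _ φ a ha => by
    rw [hP.eval₂_eq_zero_iff] at ha ⊢
    obtain ⟨y, hy⟩ := ha
    obtain ⟨z, hz⟩ := hs c
    refine ⟨y ≫ z, ?_⟩
    rw [Category.assoc, hz, reassoc_of% hy, ← V.pt_smul, scalars_smul, smul_smul, map_mul]
    congr 3
    rw [← hb' (specOver j (CommRingCat.ofHom φ)), ringOf_specOver]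
    rfl) (ringOf t) a
  rw [hb'] at key
  rw [key]
  congr 1
  cases subsingleton_or_nontrivial A
  · have := (ringOf t).codomain_trivial
    exact Subsingleton.elim _ _
  · obtain ⟨n, hn⟩ := hd inferInstance
    have := Fintype.ofFinite k
    rw [hn, ← map_pow, Nat.card_eq_fintype_card, FiniteField.pow_card_pow]

end IsEqn

end EquationProperties

/-! ### Charts for L and a power of L, and compatibility of the local equations. -/

section Charts

open Polynomial
open scoped AddMonObj

variable {k : Type u} [Field k] {s : S ⟶ Spec (.of k)} {L M : S.Modules}

lemma exists_cover {ι : Type u} {A : ι → CommRingCat.{u}} (j : ∀ a, Spec (A a) ⟶ S)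
    [∀ a, IsOpenImmersion (j a)] (hj : ∀ x : S, ∃ a, ∃ y, j a y = x) (T : Over S) :
    ∃ (T' : ι → Over S) (e : ∀ a, T' a ⟶ T) (_ : ∀ a, T' a ⟶ Over.mk (j a)),
      (∀ a, IsOpenImmersion (e a).left) ∧ ∀ x : T.left, ∃ a, ∃ y, (e a).left y = x := by
  refine ⟨fun a => Over.mk (pullback.fst T.hom (j a) ≫ T.hom),
    fun a => Over.homMk (pullback.fst T.hom (j a)),
    fun a => Over.homMk (pullback.snd T.hom (j a)) pullback.condition.symm,
    fun a => (inferInstance : IsOpenImmersion (pullback.fst T.hom (j a))), fun x => ?_⟩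
  obtain ⟨a, y, hy⟩ := hj (T.hom x)
  obtain ⟨z, hz, -⟩ := Scheme.Pullback.exists_preimage_pullback x y hy.symm
  exact ⟨a, z, hz⟩

lemma sections_ext_of_cover {ι : Type u} {A : ι → CommRingCat.{u}} (j : ∀ a, Spec (A a) ⟶ S)
    [∀ a, IsOpenImmersion (j a)] (hj : ∀ x : S, ∃ a, ∃ y, j a y = x) {T : Over S}
    {x y : Sections s L T}
    (h : ∀ (a : ι) (T' : Over S) (e : T' ⟶ T) (_ : T' ⟶ Over.mk (j a)), pb e x = pb e y) :
    x = y := by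
  obtain ⟨T', e, t, he, hT'⟩ := exists_cover j hj T
  exact sections_ext e hT' fun a => h a _ (e a) (t a)

lemma sections_ext_of_affine {T : Over S} {x y : Sections s L T}
    (h : ∀ (C : CommRingCat.{u}) (j : Spec C ⟶ S) (e : Over.mk j ⟶ T), pb e x = pb e y) :
    x = y := by
  let 𝒰 := T.left.affineOpenCover
  let e (i : 𝒰.I₀) : Over.mk (𝒰.f i ≫ T.hom) ⟶ T := Over.homMk (𝒰.f i)
  have (i : 𝒰.I₀) : IsOpenImmersion (e i).left := inferInstanceAs (IsOpenImmersion (𝒰.f i))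
  exact sections_ext e (fun x => ⟨𝒰.idx x, 𝒰.covers x⟩) fun i => h _ _ (e i)

/-- Affine charts of `S` with generators of `L` and `M`, such that the transition units of `M` are
the `ρ`-th powers of those of `L`. -/
structure PowerCharts (s : S ⟶ Spec (.of k)) (L M : S.Modules) (ρ : S → ℕ) where
  ι : Type u
  A : ι → CommRingCat.{u}
  j : ∀ a, Spec (A a) ⟶ S
  imm : ∀ a, IsOpenImmersion (j a)
  surj : ∀ x : S, ∃ a, ∃ y, j a y = x
  r : ι → ℕ
  hr : ∀ a x, ρ (j a x) = r a
  g : ∀ a, Sections s L (Over.mk (j a))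
  hg : ∀ a, IsGenerator (g a)
  h : ∀ a, Sections s M (Over.mk (j a))
  hh : ∀ a, IsGenerator (h a)
  compat : ∀ (a b : ι) (T : Over S) (t : T ⟶ Over.mk (j a)) (t' : T ⟶ Over.mk (j b))
    (u : Γ(T.left, ⊤)), pb t' (g b) = u • pb t (g a) → pb t' (h b) = u ^ r a • pb t (h a)

namespace PowerCharts

attribute [instance] PowerCharts.imm

variable {V : LineBundle s L} {G : Over S} {i : G ⟶ V.X} {ρ : S → ℕ} (D : PowerCharts s L M ρ)

/-- With g_b = u g_a one has x = u x', so P_a(x) = u^r P_b(x'), while h_b = u^r h_a: the two powers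
of u cancel. -/
lemma eval₂_smul_eq (P : ∀ a, (D.A a)[X]) (hP : ∀ a, (P a).Monic)
    (hd : ∀ a, Nontrivial (D.A a) → (P a).natDegree = D.r a) (he : ∀ a, IsEqn V i (D.g a) (P a))
    (a b : D.ι) {T : Over S} (t : T ⟶ Over.mk (D.j a)) (t' : T ⟶ Over.mk (D.j b))
    (x x' : Γ(T.left, ⊤)) (hx : x • pb t (D.g a) = x' • pb t' (D.g b)) :
    (P a).eval₂ (ringOf t) x • pb t (D.h a) = (P b).eval₂ (ringOf t') x' • pb t' (D.h b) := by
  refine sections_ext_of_affine fun C j e => ?_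
  replace hx := congrArg (pb e) hx
  rw [pb_smul, pb_smul, ← pb_comp, ← pb_comp] at hx ⊢
  rw [hom_eval₂, hom_eval₂, ← ringOf_comp, ← ringOf_comp]
  generalize fn e x = x at hx ⊢
  generalize fn e x' = x' at hx ⊢
  generalize e ≫ t = t at hx ⊢
  generalize e ≫ t' = t' at hx ⊢
  -- If C is nontrivial, so are both chart rings; the degrees are then known, and a point of Spec C
  -- shows that they are equal.
  cases subsingleton_or_nontrivial C
  · have h1 : Subsingleton Γ((Over.mk j).left, ⊤) := (ringOf (𝟙 (Over.mk j))).codomain_trivial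
    have := Module.subsingleton Γ((Over.mk j).left, ⊤) (Sections s M (Over.mk j))
    exact Subsingleton.elim _ _
  obtain ⟨α, hα⟩ := exists_ringOf_eq t
  obtain ⟨β, hβ⟩ := exists_ringOf_eq t'
  obtain ⟨u', hu'⟩ := (D.hg a _ t).2 (pb t' (D.g b))
  obtain ⟨u, rfl⟩ := (ringOf_id_bijective j).2 u'
  obtain rfl : x = ringOf (𝟙 (Over.mk j)) u * x' := by
    rw [← hu', smul_smul, mul_comm] at hx
    exact (D.hg a _ t).1 hx
  have hA := α.domain_nontrivial
  have hB := β.domain_nontrivial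
  have hr : D.r a = D.r b := by
    obtain ⟨p⟩ : Nonempty (Spec C) := inferInstance
    rw [← D.hr a (t.left p), ← D.hr b (t'.left p)]
    have h1 : t.left ≫ D.j a = t'.left ≫ D.j b := (Over.w t).trans (Over.w t').symm
    congr 1
    exact congr($h1 p)
  have e1 (a : D.ι) (t : Over.mk j ⟶ Over.mk (D.j a)) (α : D.A a →+* C)
      (hα : ∀ c, ringOf t c = ringOf (𝟙 (Over.mk j)) (α c)) (x) :
      (P a).eval₂ (ringOf t) x = ((P a).map α).eval₂ (ringOf (𝟙 (Over.mk j))) x := by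
    rw [eval₂_map]
    congr 1
    exact RingHom.ext hα
  rw [e1 a t α hα, e1 b t' β hβ]
  rw [IsEqn.eval₂_mul ((he a).baseChange t hα) ((hP a).map α) ((he b).baseChange t' hβ)
    ((hP b).map β) (by rw [(hP a).natDegree_map, (hP b).natDegree_map, hd a hA, hd b hB, hr])
    u hu'.symm, (hP a).natDegree_map, hd a hA, D.compat a b _ t t' _ hu'.symm, smul_smul, mul_comm]

end PowerCharts

end Charts

/-! ### Gluing the local equations to a morphism ξ with kernel G. -/

section Construction

open Polynomial
open scoped AddMonObj

variable {k : Type u} [Field k] {s : S ⟶ Spec (.of k)} {L M : S.Modules}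

/-- The chart of `𝔾_{a,L}` given by a generator of `L` over `Spec A`. -/
def LineBundle.chart (V : LineBundle s L) {A : CommRingCat.{u}} {j : Spec A ⟶ S}
    (g : Sections s L (Over.mk j)) : affLine j ⟶ V.X := V.pt (affTaut g)

lemma LineBundle.val_comp_chart (V : LineBundle s L) {A : CommRingCat.{u}} {j : Spec A ⟶ S}
    (g : Sections s L (Over.mk j)) {T : Over S} (h : T ⟶ affLine j) :
    V.val (h ≫ V.chart g) = pb h (affTaut g) := by
  rw [LineBundle.chart, V.comp_pt, V.val_pt]

/-- A point of 𝔾_{a,L} ×_S Spec A is a morphism to Spec A with a section of L, which is what the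
affine line represents. -/
lemma LineBundle.isPullback_chart (V : LineBundle s L) {A : CommRingCat.{u}} {j : Spec A ⟶ S}
    {g : Sections s L (Over.mk j)} (hg : IsGenerator g) :
    IsPullback (V.chart g).left (affLineProj j).left V.X.hom j := by
  refine ⟨⟨(Over.w (V.chart g)).trans (Over.w (affLineProj j)).symm⟩, ⟨PullbackCone.IsLimit.mk _
    (fun c => (exists_affLine_lift hg (T := Over.mk (c.snd ≫ j)) (Over.homMk c.snd)
      (V.val (Over.homMk c.fst c.condition))).choose.left) (fun c => ?_) (fun c => ?_) ?_⟩⟩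
  · obtain ⟨-, h2⟩ := (exists_affLine_lift hg (T := Over.mk (c.snd ≫ j)) (Over.homMk c.snd)
      (V.val (Over.homMk c.fst c.condition))).choose_spec
    exact congr(($(V.val_injective ((V.val_comp_chart g _).trans h2))).left)
  · obtain ⟨h1, -⟩ := (exists_affLine_lift hg (T := Over.mk (c.snd ≫ j)) (Over.homMk c.snd)
      (V.val (Over.homMk c.fst c.condition))).choose_spec
    exact congr(($h1).left)
  · intro c m hm1 hm2
    obtain ⟨h1, h2⟩ := (exists_affLine_lift hg (T := Over.mk (c.snd ≫ j)) (Over.homMk c.snd)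
      (V.val (Over.homMk c.fst c.condition))).choose_spec
    have w : m ≫ (affLine j).hom = c.snd ≫ j := by
      rw [← hm2, Category.assoc]
      rfl
    refine congr(($(affLine_hom_ext hg (h := (Over.homMk m w : Over.mk (c.snd ≫ j) ⟶ _))
      (Eq.trans ?_ h1.symm) (Eq.trans ?_ h2.symm))).left)
    · ext : 1
      exact hm2
    · refine (V.val_comp_chart g _).symm.trans (congrArg V.val ?_)
      ext : 1
      exact hm1

lemma comp_chart (V : LineBundle s L) {A : CommRingCat.{u}} {j : Spec A ⟶ S}
    (g : Sections s L (Over.mk j)) {T : Over S} (h : T ⟶ affLine j) :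
    h ≫ V.chart g = V.pt (fn h (affCoord j) • pb (h ≫ affLineProj j) g) := by
  rw [LineBundle.chart, V.comp_pt, pb_affTaut]

lemma LineBundle.isOpenImmersion_chart (V : LineBundle s L) {A : CommRingCat.{u}} {j : Spec A ⟶ S}
    [IsOpenImmersion j] {g : Sections s L (Over.mk j)} (hg : IsGenerator g) :
    IsOpenImmersion (V.chart g).left :=
  MorphismProperty.of_isPullback (V.isPullback_chart hg).flip inferInstance

lemma LineBundle.exists_chart (V : LineBundle s L) {ι : Type u} {A : ι → CommRingCat.{u}}
    {j : ∀ a, Spec (A a) ⟶ S} (hj : ∀ x : S, ∃ a, ∃ y, j a y = x)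
    {g : ∀ a, Sections s L (Over.mk (j a))} (hg : ∀ a, IsGenerator (g a)) (x : V.X.left) :
    ∃ a, ∃ y, (V.chart (g a)).left y = x := by
  obtain ⟨a, y, hy⟩ := hj (V.X.hom x)
  obtain ⟨z, hz, -⟩ := Scheme.exists_preimage_of_isPullback (V.isPullback_chart (hg a)) x y hy.symm
  exact ⟨a, z, hz⟩

/-- Factorizations through a monomorphism are unique, hence the local ones glue. -/
lemma exists_factorization_of_openCover {X Y Z : Scheme.{u}} (𝒰 : X.OpenCover) (i : Y ⟶ Z)
    [Mono i] (f : X ⟶ Z) (h : ∀ a, ∃ y, y ≫ i = 𝒰.f a ≫ f) : ∃ z, z ≫ i = f := by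
  choose y hy using h
  refine ⟨𝒰.glueMorphisms y fun a b => ?_, 𝒰.hom_ext _ _ fun a => ?_⟩
  · rw [← cancel_mono i, Category.assoc, Category.assoc, hy, hy, pullback.condition_assoc]
  · rw [𝒰.ι_glueMorphisms_assoc, hy]

namespace PowerCharts

variable {V : LineBundle s L} {W : LineBundle s M} {G : Over S} {i : G ⟶ V.X} {ρ : S → ℕ}
  (D : PowerCharts s L M ρ)

/-- `ξ` is given in the charts by the polynomials `P`. -/
def IsModel (V : LineBundle s L) (W : LineBundle s M) (P : ∀ a, (D.A a)[X]) (ξ : V.X ⟶ W.X) :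
    Prop :=
  ∀ (a : D.ι) (T : Over S) (t : T ⟶ Over.mk (D.j a)) (x : Γ(T.left, ⊤)),
    V.pt (x • pb t (D.g a)) ≫ ξ = W.pt ((P a).eval₂ (ringOf t) x • pb t (D.h a))

/-- A morphism to 𝔾_{a,M} is a section of M over 𝔾_{a,L}; on the chart of index a it is P_a(X) h_a,
and `eval₂_smul_eq` is the gluing condition. -/
theorem exists_isModel (W : LineBundle s M) (P : ∀ a, (D.A a)[X]) (hP : ∀ a, (P a).Monic)
    (hd : ∀ a, Nontrivial (D.A a) → (P a).natDegree = D.r a) (he : ∀ a, IsEqn V i (D.g a) (P a)) :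
    ∃ ξ, D.IsModel V W P ξ := by
  have (a : D.ι) := V.isOpenImmersion_chart (D.hg a)
  obtain ⟨m, hm⟩ := sections_glue (s := s) (L := M) (fun a => V.chart (D.g a))
    (V.exists_chart D.surj D.hg)
    (fun a => (P a).eval₂ (ringOf (affLineProj (D.j a))) (affCoord (D.j a)) •
      pb (affLineProj (D.j a)) (D.h a)) (by
    intro a b T t t' h
    simp only [pb_smul, hom_eval₂, ← ringOf_comp, ← pb_comp]
    rw [comp_chart, comp_chart] at h
    exact D.eval₂_smul_eq P hP hd he a b _ _ _ _ (V.rep.homEquiv.symm.injective h))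
  refine ⟨W.pt m, fun a T t x => ?_⟩
  obtain ⟨h, rfl, rfl⟩ := exists_affLine_hom t x
  rw [← comp_chart, Category.assoc, W.comp_pt, hm, W.comp_pt]
  simp only [pb_smul, hom_eval₂, ← ringOf_comp, ← pb_comp]

variable {D} {P : ∀ a, (D.A a)[X]} {ξ : V.X ⟶ W.X}

lemma exists_smul_eq (D : PowerCharts s L M ρ) {T : Over S} {a : D.ι} (t : T ⟶ Over.mk (D.j a))
    (f : T ⟶ V.X) :
    ∃ x : Γ(T.left, ⊤), f = V.pt (x • pb t (D.g a)) := by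
  obtain ⟨x, hx⟩ := (D.hg a _ t).2 (V.val f)
  exact ⟨x, V.val_injective (by rw [V.val_pt, ← hx])⟩

lemma hom_ext_of_cover (D : PowerCharts s L M ρ) {T : Over S} {f g : T ⟶ W.X}
    (h : ∀ (a : D.ι) (T' : Over S) (e : T' ⟶ T) (_ : T' ⟶ Over.mk (D.j a)), e ≫ f = e ≫ g) :
    f = g :=
  W.val_injective (sections_ext_of_cover D.j D.surj fun a T' e t => by
    rw [← W.val_comp, ← W.val_comp, h a T' e t])

lemma IsModel.isAddMonHom [AddGrpObj G] (hξ : D.IsModel V W P ξ) (hP : ∀ a, (P a).Monic)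
    (he : ∀ a, IsEqn V i (D.g a) (P a)) (hi : IsAddMonHom i) : IsAddMonHom ξ := by
  refine isAddMonHom_of_add _ fun T f g => hom_ext_of_cover D fun a T' e t => ?_
  rw [← Category.assoc, AddMonObj.comp_add, AddMonObj.comp_add, ← Category.assoc, ← Category.assoc]
  obtain ⟨x, hx⟩ := exists_smul_eq D t (e ≫ f)
  obtain ⟨y, hy⟩ := exists_smul_eq D t (e ≫ g)
  rw [hx, hy, ← V.pt_add, ← add_smul, hξ, hξ, hξ, (he a).eval₂_add (hP a) hi, add_smul, W.pt_add]

lemma IsModel.smul_comp [Finite k] (hξ : D.IsModel V W P ξ) (hP : ∀ a, (P a).Monic)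
    (he : ∀ a, IsEqn V i (D.g a) (P a)) (hs : ∀ c : k, ∃ a : G ⟶ G, a ≫ i = i ≫ V.smul c)
    (hd : ∀ a, Nontrivial (D.A a) → ∃ n, (P a).natDegree = Nat.card k ^ n) (c : k) :
    V.smul c ≫ ξ = ξ ≫ W.smul c := by
  refine hom_ext_of_cover D fun a T e t => ?_
  obtain ⟨x, rfl⟩ := exists_smul_eq D t e
  rw [← Category.assoc, ← Category.assoc, hξ, ← V.pt_smul, ← W.pt_smul, scalars_smul, scalars_smul,
    smul_smul, smul_smul, hξ, (he a).eval₂_scalar (hP a) hs (hd a)]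

/-- In a chart the point is x g, and P(x) h = 0 means P(x) = 0, which is the equation of `G`; the
local lifts to `G` glue. -/
lemma IsModel.comp_eq_zero_iff [Mono i] (hξ : D.IsModel V W P ξ)
    (he : ∀ a, IsEqn V i (D.g a) (P a)) {T : Over S} (f : T ⟶ V.X) :
    f ≫ ξ = 0 ↔ ∃ y : T ⟶ G, y ≫ i = f := by
  have key {T : Over S} {a : D.ι} (t : T ⟶ Over.mk (D.j a)) (f : T ⟶ V.X) :
      f ≫ ξ = 0 ↔ ∃ y : T ⟶ G, y ≫ i = f := by
    obtain ⟨x, rfl⟩ := exists_smul_eq D t f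
    rw [hξ, he a, ← W.pt_zero, ← (D.hh a T t).1.eq_iff (b := 0), zero_smul]
    exact W.rep.homEquiv.symm.injective.eq_iff
  constructor
  · intro h
    obtain ⟨T', e, t, hei, hcov⟩ := exists_cover D.j D.surj T
    have h1 (a : D.ι) : ∃ y : T' a ⟶ G, y ≫ i = e a ≫ f := (key (t a) _).mp (by
      rw [Category.assoc, h, AddMonObj.comp_zero])
    obtain ⟨z, hzi⟩ := exists_factorization_of_openCover
      (Scheme.Cover.mkOfCovers D.ι (fun a => (T' a).left) (fun a => (e a).left) hcov hei)
      i.left f.left fun a => ⟨(h1 a).choose.left, congr(($((h1 a).choose_spec)).left)⟩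
    refine ⟨Over.homMk z ?_, ?_⟩
    · rw [← Over.w i, reassoc_of% hzi, Over.w f]
    · ext : 1
      exact hzi
  · rintro ⟨y, rfl⟩
    refine hom_ext_of_cover D fun a T' e t => ?_
    rw [AddMonObj.comp_zero, ← Category.assoc]
    exact (key t _).mpr ⟨e ≫ y, Category.assoc _ _ _⟩

end PowerCharts

end Construction

/-! ### A[X] is finite free over A[P]. -/

section FiniteFlat

open Polynomial
open scoped AddMonObj

/-- The polynomial ring is generated over the subring of polynomials in `P` by a root of
`P - Y`. -/
lemma exists_adjoinRoot_equiv {A : Type u} [CommRing A] (P : A[X]) :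
    ∃ e : AdjoinRoot (P.map (C : A →+* A[X]) - C (Polynomial.X : A[X])) ≃+* A[X],
      ∀ p, e (AdjoinRoot.of _ p) = p.eval₂ C P := by
  have hQ : eval₂ (eval₂RingHom C P) Polynomial.X
      (P.map (C : A →+* A[X]) - C (Polynomial.X : A[X])) = 0 := by
    rw [eval₂_sub, eval₂_map, eval₂_C, coe_eval₂RingHom, eval₂_X, sub_eq_zero]
    have : (eval₂RingHom C P).comp C = (C : A →+* A[X]) := by
      ext a : 1
      simp
    rw [this, eval₂_C_X]
  generalize hq : P.map (C : A →+* A[X]) - C (Polynomial.X : A[X]) = Q at hQ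
  refine ⟨RingEquiv.ofRingHom (AdjoinRoot.lift (eval₂RingHom C P) Polynomial.X hQ)
    (eval₂RingHom ((AdjoinRoot.of Q).comp C) (AdjoinRoot.root Q)) ?_ ?_, fun p => ?_⟩
  · refine Polynomial.ringHom_ext (fun a => ?_) ?_ <;> simp
  · refine AdjoinRoot.ringHom_ext (Polynomial.ringHom_ext (fun a => ?_) ?_) ?_
    · simp
    · have := AdjoinRoot.eval₂_root Q
      rw [← hq, eval₂_sub, eval₂_map, eval₂_C, sub_eq_zero, hq] at this
      simp [this]
    · simp
  · exact AdjoinRoot.lift_of hQ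

/-- The endomorphism `X ↦ P` of the affine line, for a monic polynomial `P` of positive degree,
is finite and flat of rank `deg P`. -/
theorem finite_flat_finrank_of_monic {A : Type u} [CommRing A] [Nontrivial A] {P : A[X]}
    (hP : P.Monic) (hd : P.natDegree ≠ 0) :
    IsFinite (Spec.map (CommRingCat.ofHom (eval₂RingHom C P))) ∧
      Flat (Spec.map (CommRingCat.ofHom (eval₂RingHom C P))) ∧
      ∀ x, (Spec.map (CommRingCat.ofHom (eval₂RingHom C P))).finrank x = P.natDegree := by
  obtain ⟨e, he⟩ := exists_adjoinRoot_equiv P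
  have hQd : (P.map (C : A →+* A[X]) - C (Polynomial.X : A[X])).natDegree = P.natDegree := by
    rw [natDegree_sub_C, hP.natDegree_map]
  -- Positive degree of P is needed here: subtracting the new variable must not touch the leading
  -- coefficient.
  have hQ : (P.map (C : A →+* A[X]) - C (Polynomial.X : A[X])).Monic := by
    refine (hP.map C).sub_of_left ?_
    rw [degree_eq_natDegree (hP.map C).ne_zero, hP.natDegree_map]
    exact degree_C_le.trans_lt (by exact_mod_cast hd.bot_lt)
  generalize P.map (C : A →+* A[X]) - C (Polynomial.X : A[X]) = Q at *
  have := hQ.free_adjoinRoot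
  have := hQ.finite_adjoinRoot
  have h1 : Spec.map (CommRingCat.ofHom (eval₂RingHom C P)) =
      Spec.map e.toCommRingCatIso.hom ≫
        Spec.map (CommRingCat.ofHom (algebraMap A[X] (AdjoinRoot Q))) := by
    rw [← Spec.map_comp]
    congr 1
    exact CommRingCat.hom_ext (RingHom.ext fun p => (he p).symm)
  have hfin : IsFinite (Spec.map (CommRingCat.ofHom (algebraMap A[X] (AdjoinRoot Q)))) :=
    (IsFinite.SpecMap_iff _).mpr (RingHom.finite_algebraMap.mpr inferInstance)
  have hflat : Flat (Spec.map (CommRingCat.ofHom (algebraMap A[X] (AdjoinRoot Q)))) :=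
    Flat.SpecMap_iff.mpr (RingHom.flat_algebraMap_iff.mpr inferInstance)
  rw [h1]
  refine ⟨inferInstance, inferInstance, fun x => ?_⟩
  rw [Scheme.Hom.finrank_comp_left_of_isIso]
  refine (Scheme.Hom.finrank_SpecMap_algebraMap A[X] (AdjoinRoot Q) x).trans ?_
  rw [Module.rankAtStalk_eq_finrank_of_free, ← hQd]
  exact finrank_quotient_span_eq_natDegree' hQ

end FiniteFlat

/-! ### Faithfully flat homomorphisms are quotients by their kernels. -/

section Exactness

open Polynomial
open scoped AddMonObj

variable {k : Type u} [Field k] {s : S ⟶ Spec (.of k)} {L M : S.Modules}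

lemma exists_epi_lift {X Y T : Over S} (ξ : X ⟶ Y) [Flat ξ.left] [Surjective ξ.left]
    [QuasiCompact ξ.left] (a : T ⟶ Y) :
    ∃ (T' : Over S) (e : T' ⟶ T) (b : T' ⟶ X), Epi e ∧ b ≫ ξ = e ≫ a := by
  have h : Epi (pullback.fst a.left ξ.left) := Flat.epi_of_flat_of_surjective _
  refine ⟨Over.mk (pullback.fst a.left ξ.left ≫ T.hom), Over.homMk (pullback.fst a.left ξ.left),
    Over.homMk (pullback.snd a.left ξ.left) ?_, ?_, ?_⟩
  · rw [← Over.w ξ, ← pullback.condition_assoc, Over.w a]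
    rfl
  · exact @Over.epi_of_epi_left _ _ _ _ _ _ h
  · ext : 1
    exact pullback.condition.symm

/-- A faithfully flat quasi-compact homomorphism of group schemes is the quotient by its kernel. -/
theorem isShortExact_of_flat {X Y Z : Over S} [AddGrpObj X] [AddGrpObj Y] [AddGrpObj Z]
    {i : X ⟶ Y} {p : Y ⟶ Z} [Mono i] (hi : IsAddMonHom i) (hp : IsAddMonHom p)
    [Flat p.left] [Surjective p.left] [QuasiCompact p.left]
    (hker : ∀ (T : Over S) (f : T ⟶ Y), f ≫ p = 0 ↔ ∃ y : T ⟶ X, y ≫ i = f) :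
    IsShortExact i p := by
  have : Epi p.left := Flat.epi_of_flat_of_surjective _
  have : Epi p := Over.epi_of_epi_left p
  have hip : i ≫ p = 0 := (hker _ i).mpr ⟨𝟙 _, Category.id_comp _⟩
  refine ⟨fun T _ a b _ _ h => (cancel_mono i).mp h, fun T _ f hf => ⟨fun h => ?_, ?_⟩,
    fun T _ a b _ _ h => (cancel_epi p).mp h, fun T _ f hf => ⟨fun h => ?_, ?_⟩⟩
  · obtain ⟨y, rfl⟩ := (hker T f).mp h
    refine ⟨y, isAddMonHom_of_add _ fun T' a b => ?_, rfl⟩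
    rw [← cancel_mono i, add_comp_of_isAddMonHom i hi, Category.assoc, Category.assoc,
      Category.assoc, add_comp_of_isAddMonHom _ hf]
  · rintro ⟨a, ha, rfl⟩
    exact (hker T _).mpr ⟨a, rfl⟩
  · have key (Q : Over S) (a b : Q ⟶ Y) (hab : a ≫ p = b ≫ p) : a ≫ f = b ≫ f := by
      obtain ⟨y, hy⟩ := (hker Q (a - b)).mp (by
        rw [sub_comp_of_isAddMonHom p hp, hab, sub_self])
      have h1 : (a - b) ≫ f = 0 := by
        rw [← hy, Category.assoc, h, AddMonObj.comp_zero]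
      rwa [sub_comp_of_isAddMonHom f hf, sub_eq_zero] at h1
    -- `p` is an effective epimorphism, and `f` descends because points with equal image under `p`
    -- differ by a point of the kernel, which `f` kills.
    let d : Z.left ⟶ T.left := EffectiveEpi.desc p.left f.left fun {Q} a b hab => by
      have w : b ≫ Y.hom = a ≫ Y.hom := by
        rw [← Over.w p, reassoc_of% hab]
      exact congr(($(key (Over.mk (a ≫ Y.hom)) (Over.homMk a) (Over.homMk b w) (by
        ext : 1
        exact hab))).left)
    have hd : p.left ≫ d = f.left := EffectiveEpi.fac _ _ _
    let d' : Z ⟶ T := Over.homMk d (by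
      rw [← cancel_epi p.left, reassoc_of% hd, Over.w f, Over.w p])
    have hd' : p ≫ d' = f := by
      ext : 1
      exact hd
    refine ⟨d', isAddMonHom_of_add _ fun Q a b => ?_, hd'⟩
    -- Additivity of the descended morphism may be tested after two epimorphisms, over which both
    -- points lift to Y.
    obtain ⟨Q1, e1, a1, he1, ha1⟩ := exists_epi_lift p a
    obtain ⟨Q2, e2, b2, he2, hb2⟩ := exists_epi_lift p (e1 ≫ b)
    rw [← cancel_epi e1, ← cancel_epi e2]
    have ha2 : e2 ≫ e1 ≫ a = (e2 ≫ a1) ≫ p := by rw [Category.assoc, ha1]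
    simp only [← Category.assoc, AddMonObj.comp_add]
    rw [Category.assoc e2 e1 a, Category.assoc e2 e1 b, ha2, ← hb2,
      ← add_comp_of_isAddMonHom p hp, Category.assoc _ p, Category.assoc _ p, Category.assoc _ p,
      hd', add_comp_of_isAddMonHom f hf]
  · rintro ⟨a, ha, rfl⟩
    rw [reassoc_of% hip, zero_comp_of_isAddMonHom a ha]

end Exactness

/-! ### Finiteness, flatness and rank of ξ, and the exact sequence. -/

section Quotient

open Polynomial
open scoped AddMonObj

variable {k : Type u} [Field k] {s : S ⟶ Spec (.of k)} {L M : S.Modules}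

lemma ringOf_homMk {A C : CommRingCat.{u}} {j : Spec A ⟶ S} {j' : Spec C ⟶ S} (φ : A ⟶ C)
    (w : Spec.map φ ≫ j = j') (a : A) :
    ringOf (Over.homMk (Spec.map φ) w : Over.mk j' ⟶ Over.mk j) a =
      ringOf (𝟙 (Over.mk j')) (φ.hom a) := by
  subst w
  exact ringOf_specOver j φ a

/-- The endomorphism of the affine line over `Spec A` defined by a polynomial. -/
def affMap {A : CommRingCat.{u}} (j : Spec A ⟶ S) (P : A[X]) : affLine j ⟶ affLine j :=
  Over.homMk (Spec.map (CommRingCat.ofHom (eval₂RingHom C P))) (by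
    refine (Category.assoc _ _ _).symm.trans (congrArg (· ≫ j) ?_)
    refine (Spec.map_comp _ _).symm.trans (congrArg Spec.map ?_)
    exact CommRingCat.hom_ext (RingHom.ext fun a => eval₂_C C P))

lemma affMap_proj {A : CommRingCat.{u}} (j : Spec A ⟶ S) (P : A[X]) :
    affMap j P ≫ affLineProj j = affLineProj j := by
  ext : 1
  refine (Spec.map_comp _ _).symm.trans (congrArg Spec.map ?_)
  exact CommRingCat.hom_ext (RingHom.ext fun a => eval₂_C C P)

lemma fn_affMap {A : CommRingCat.{u}} (j : Spec A ⟶ S) (P : A[X]) :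
    fn (affMap j P) (affCoord j) = P.eval₂ (ringOf (affLineProj j)) (affCoord j) := by
  have h1 := ringOf_affLine (𝟙 (affLine j)) P
  rw [Category.id_comp, fn_id] at h1
  rw [← h1, affCoord, ← ringOf_comp_apply, Category.comp_id]
  refine (ringOf_homMk _ _ _).trans (congrArg _ ?_)
  exact eval₂_X C P

lemma affMap_finite_flat {A : CommRingCat.{u}} (j : Spec A ⟶ S) {P : A[X]} (hP : P.Monic)
    {r : ℕ} (hd : Nontrivial A → P.natDegree = r) (hr : Nontrivial A → r ≠ 0) :
    IsFinite (affMap j P).left ∧ Flat (affMap j P).left ∧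
      ∀ x, (affMap j P).left.finrank x = r := by
  cases subsingleton_or_nontrivial A
  -- For A = 0 the affine line is empty, so nothing is asked of the rank.
  · have hb : Function.Bijective (eval₂RingHom C P) :=
      ⟨fun _ _ _ => Subsingleton.elim _ _, fun b => ⟨b, Subsingleton.elim _ _⟩⟩
    refine ⟨(IsFinite.SpecMap_iff _).mpr (.of_surjective _ hb.2),
      Flat.SpecMap_iff.mpr (.of_bijective hb), fun x => ?_⟩
    have : Subsingleton A[X] := inferInstance
    have : IsEmpty (PrimeSpectrum A[X]) := PrimeSpectrum.isEmpty_iff_subsingleton.mpr this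
    exact isEmptyElim (α := PrimeSpectrum A[X]) x
  · obtain ⟨h1, h2, h3⟩ := finite_flat_finrank_of_monic hP (by
      rw [hd inferInstance]
      exact hr inferInstance)
    exact ⟨h1, h2, fun x => (h3 x).trans (hd inferInstance)⟩

namespace PowerCharts

variable {V : LineBundle s L} {W : LineBundle s M} {G : Over S} {i : G ⟶ V.X} {ρ : S → ℕ}
  {D : PowerCharts s L M ρ} {P : ∀ a, (D.A a)[X]} {ξ : V.X ⟶ W.X}

/-- Both charts are base changes of their bundles along the same Spec A → S, so the square is
cartesian by pasting. Thus ξ is, locally on its target, the map X ↦ P(X). -/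
lemma IsModel.isPullback (hξ : D.IsModel V W P ξ) (a : D.ι) :
    IsPullback (V.chart (D.g a)).left (affMap (D.j a) (P a)).left ξ.left
      (W.chart (D.h a)).left := by
  have h1 := (V.isPullback_chart (D.hg a)).flip
  have h2 := (W.isPullback_chart (D.hh a)).flip
  rw [← affMap_proj (D.j a) (P a), ← Over.w ξ] at h1
  refine (IsPullback.of_right h1 ?_ h2).flip
  have := comp_chart W (D.h a) (affMap (D.j a) (P a))
  rw [fn_affMap, affMap_proj, ← hξ] at this
  exact congr(($this).left)

lemma IsModel.finite_flat (hξ : D.IsModel V W P ξ) (hP : ∀ a, (P a).Monic)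
    (hd : ∀ a, Nontrivial (D.A a) → (P a).natDegree = D.r a)
    (hr : ∀ a, Nontrivial (D.A a) → D.r a ≠ 0) :
    IsFinite ξ.left ∧ Flat ξ.left ∧ ∀ y, ξ.left.finrank y = ρ (W.X.hom y) := by
  have key (a : D.ι) := affMap_finite_flat (D.j a) (hP a) (hd a) (hr a)
  have (a : D.ι) := W.isOpenImmersion_chart (D.hh a)
  let 𝒰 : W.X.left.OpenCover := Scheme.Cover.mkOfCovers D.ι (fun a => (affLine (D.j a)).left)
    (fun a => (W.chart (D.h a)).left) (W.exists_chart D.surj D.hh) this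
  have h𝒰 (Q : MorphismProperty Scheme.{u}) (hQ : IsZariskiLocalAtTarget Q)
      (h : ∀ a, Q (affMap (D.j a) (P a)).left) : Q ξ.left := by
    refine IsZariskiLocalAtTarget.of_openCover 𝒰 fun a => ?_
    refine (MorphismProperty.cancel_left_of_respectsIso Q (hξ.isPullback a).isoPullback.hom _).mp ?_
    have := h a
    rwa [← (hξ.isPullback a).isoPullback_hom_snd] at this
  have hfin : IsFinite ξ.left := h𝒰 @IsFinite
    (@HasAffineProperty.instIsZariskiLocalAtTarget _ _
      IsFinite.instHasAffinePropertyAndIsAffineFiniteCarrierObjOppositeOpensCarrierCarrierCommRingCatPresheafOpOpensTopHomAppTop)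
    fun a => (key a).1
  have hflat : Flat ξ.left := h𝒰 @Flat
    (HasRingHomProperty.instIsZariskiLocalAtTarget (P := @Flat)) fun a => (key a).2.1
  refine ⟨hfin, hflat, fun y => ?_⟩
  obtain ⟨a, z, rfl⟩ := W.exists_chart D.surj D.hh y
  rw [← Scheme.Hom.finrank_of_isPullback _ _ _ _ (hξ.isPullback a), (key a).2.2 z, ← D.hr a
    ((affLineProj (D.j a)).left z)]
  congr 1
  have h1 := (W.isPullback_chart (D.hh a)).w
  exact congr($h1 z).symm

/-- The quotient of `𝔾_{a,L}` by a finite flat subgroup scheme with equations of degree a power of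
the number of elements of `k`. -/
theorem exists_quotient [Finite k] [AddGrpObj G] (hi : V.IsFiniteFlatFqSubgroup i)
    (hG : ∀ x : S, ∃ n : ℕ, G.hom.finrank x = Nat.card k ^ n)
    (D : PowerCharts s L M G.hom.finrank) (W : LineBundle s M) :
    ∃ ξ : V.X ⟶ W.X, V.IsFqHom W ξ ∧ IsShortExact i ξ ∧ IsFinite ξ.left ∧ Flat ξ.left ∧
      ∀ y, ξ.left.finrank y = G.hom.finrank (W.X.hom y) := by
  have := hi.mono
  choose P hP hd he using fun a => hi.exists_isEqn (D.hg a) (D.r a) (D.hr a)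
  obtain ⟨ξ, hξ⟩ := D.exists_isModel W P hP hd he
  have hn (a : D.ι) (_ : Nontrivial (D.A a)) : ∃ n, D.r a = Nat.card k ^ n := by
    obtain ⟨x⟩ : Nonempty (Spec (D.A a)) := inferInstance
    rw [← D.hr a x]
    exact hG _
  have hr (y : S) : G.hom.finrank y ≠ 0 := by
    obtain ⟨n, hn⟩ := hG y
    rw [hn]
    exact pow_ne_zero _ Nat.card_pos.ne'
  have h1 := hξ.isAddMonHom hP he hi.isHom
  obtain ⟨hfin, hflat, hrank⟩ := hξ.finite_flat hP hd fun a ha => by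
    obtain ⟨n, hn⟩ := hn a ha
    rw [hn]
    exact pow_ne_zero _ Nat.card_pos.ne'
  -- A power of q is at least 1, so no fibre of ξ is empty.
  have hsurj : Surjective ξ.left := ξ.left.one_le_finrank_iff_surjective.mp fun y => by
    rw [hrank]
    exact Nat.one_le_iff_ne_zero.mpr (hr _)
  exact ⟨ξ, ⟨h1, hξ.smul_comp hP he hi.stable fun a ha => (hd a ha).symm ▸ hn a ha⟩,
    isShortExact_of_flat hi.isHom h1 fun T f => hξ.comp_eq_zero_iff he f, hfin, hflat, hrank⟩

end PowerCharts

end Quotient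

/-! ### Uniqueness of the quotient. -/

section Uniqueness

open scoped AddMonObj

variable {k : Type u} [Field k] {s : S ⟶ Spec (.of k)} {L M M' : S.Modules}
  {V : LineBundle s L} {W : LineBundle s M} {W' : LineBundle s M'} {G : Over S} [AddGrpObj G]
  {i : G ⟶ V.X} {ξ : V.X ⟶ W.X} {ξ' : V.X ⟶ W'.X}

lemma isAddMonHom_id (G : Over S) [AddGrpObj G] : IsAddMonHom (𝟙 G) :=
  isAddMonHom_of_add _ fun T a b => by simp

lemma isAddMonHom_comp {G H K : Over S} [AddGrpObj G] [AddGrpObj H] [AddGrpObj K] {f : G ⟶ H}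
    {g : H ⟶ K} (hf : IsAddMonHom f) (hg : IsAddMonHom g) : IsAddMonHom (f ≫ g) :=
  isAddMonHom_of_add _ fun T a b => by
    rw [← Category.assoc, ← Category.assoc, ← Category.assoc, add_comp_of_isAddMonHom f hf,
      add_comp_of_isAddMonHom g hg]

/-- Left exactness of the second sequence gives i ≫ ξ' = 0, so right exactness of the first factors
ξ' through ξ; commutation with scalars can be checked after composing with ξ. -/
lemma exists_desc (hi : IsAddMonHom i) (hξ : V.IsFqHom W ξ) (he : IsShortExact i ξ)
    (hξ' : V.IsFqHom W' ξ') (he' : IsShortExact i ξ') :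
    ∃ a : W.X ⟶ W'.X, W.IsFqHom W' a ∧ ξ ≫ a = ξ' := by
  have h0 : i ≫ ξ' = 0 :=
    (he'.left_exact G i hi).mpr ⟨𝟙 G, isAddMonHom_id G, Category.id_comp i⟩
  obtain ⟨a, ha, hξa⟩ := (he.right_exact W'.X ξ' hξ'.isHom).mp h0
  refine ⟨a, ⟨ha, fun c => ?_⟩, hξa⟩
  refine he.right_inj W'.X _ _ (isAddMonHom_comp (W.isAddMonHom_smul c) ha)
    (isAddMonHom_comp ha (W'.isAddMonHom_smul c)) ?_
  rw [← Category.assoc, ← hξ.smul_comp, Category.assoc, reassoc_of% hξa, hξa, hξ'.smul_comp]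

/-- The quotient of `𝔾_{a,L}` by `G` is unique up to a unique isomorphism. -/
theorem existsUnique_iso (hi : IsAddMonHom i) (hξ : V.IsFqHom W ξ) (he : IsShortExact i ξ)
    (hξ' : V.IsFqHom W' ξ') (he' : IsShortExact i ξ') :
    ∃! θ : W.X ≅ W'.X, W.IsFqHom W' θ.hom ∧ ξ ≫ θ.hom = ξ' := by
  obtain ⟨a, ha, hξa⟩ := exists_desc hi hξ he hξ' he'
  obtain ⟨b, hb, hξb⟩ := exists_desc hi hξ' he' hξ he
  refine ⟨⟨a, b, ?_, ?_⟩, ⟨ha, hξa⟩, fun θ hθ => Iso.ext ?_⟩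
  · refine he.right_inj _ _ _ (isAddMonHom_comp ha.isHom hb.isHom) (isAddMonHom_id _) ?_
    rw [reassoc_of% hξa, hξb, Category.comp_id]
  · refine he'.right_inj _ _ _ (isAddMonHom_comp hb.isHom ha.isHom) (isAddMonHom_id _) ?_
    rw [reassoc_of% hξb, hξa, Category.comp_id]
  · exact he.right_inj _ _ _ hθ.1.isHom ha.isHom (hθ.2.trans hξa.symm)

lemma finite_flat_of_iso (θ : W.X ≅ W'.X) (hθ : ξ ≫ θ.hom = ξ') (hfin : IsFinite ξ'.left)
    (hflat : Flat ξ'.left) :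
    IsFinite ξ.left ∧ Flat ξ.left ∧ ∀ y, ξ.left.finrank y = ξ'.left.finrank (θ.hom.left y) := by
  have : IsIso θ.hom.left := inferInstanceAs (IsIso ((Over.forget S).map θ.hom))
  have h : IsPullback (𝟙 V.X.left) ξ.left ξ'.left θ.hom.left :=
    IsPullback.of_horiz_isIso ⟨by rw [Category.id_comp, ← hθ]; rfl⟩
  exact ⟨MorphismProperty.of_isPullback h hfin, MorphismProperty.of_isPullback h hflat,
    fun y => Scheme.Hom.finrank_of_isPullback _ _ _ _ h y⟩

end Uniqueness

/-! ### The linear part of a homomorphism of line bundles. -/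

section ModuleHoms

variable {X : Scheme.{u}}

/-- A compatible family of linear maps between sections is a morphism of sheaves of modules. -/
lemma exists_modules_hom (M N : X.Modules) (f : ∀ U : X.Opens, Γ(M, U) → Γ(N, U))
    (hadd : ∀ U x y, f U (x + y) = f U x + f U y) (hsmul : ∀ U (a : Γ(X, U)) x,
      f U (a • x) = a • f U x)
    (hres : ∀ (U V : X.Opens) (h : V ≤ U) x, f V (mres M h x) = mres N h (f U x)) :
    ∃ φ : M ⟶ N, ∀ U x, φ.app U x = f U x := by
  refine ⟨⟨⟨fun U => ModuleCat.ofHom ⟨⟨f U.unop, hadd _⟩, hsmul _⟩, fun {U V} g => ?_⟩⟩,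
    fun U x => rfl⟩
  ext x
  exact hres _ _ (leOfHom g.unop) x

end ModuleHoms

section LinearPart

open Polynomial
open scoped AddMonObj

variable {k : Type u} [Field k] {s : S ⟶ Spec (.of k)} {M M' : S.Modules}

/-- The linear part of `θ` maps the section `m` of `M` to the section `m'` of `M'`. -/
def LinearPartRel {W : LineBundle s M} {W' : LineBundle s M'} (θ : W.X ⟶ W'.X) (U : S.Opens)
    (m : Γ(M, U)) (m' : Γ(M', U)) : Prop :=
  ∀ (T : Over S) (h : ⊤ ≤ T.hom ⁻¹ᵁ U) (e : Γ(T.left, ⊤)), e * e = 0 →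
    W.pt (e • ofOpen s T U h m) ≫ θ = W'.pt (e • ofOpen s T U h m')

/-- Elements of square zero isolate the linear coefficient. This is needed because an additive
automorphism of the affine line can have higher terms with nilpotent coefficients. -/
lemma eval₂_of_mul_self_eq_zero {A B : Type*} [CommRing A] [CommRing B] (φ : A →+* B) {e : B}
    (P : A[X]) (he : e * e = 0) :
    P.eval₂ φ e = φ (P.coeff 0) + φ (P.coeff 1) * e := by
  conv_lhs => rw [← P.divX_mul_X_add, ← P.divX.divX_mul_X_add]
  simp only [eval₂_add, eval₂_mul, eval₂_X, eval₂_C, coeff_divX, zero_add, add_mul, mul_assoc, he,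
    mul_zero]
  rw [add_comm]

namespace LinearPartRel

variable {W : LineBundle s M} {W' : LineBundle s M'} {θ : W.X ⟶ W'.X} {U : S.Opens}
  {m n : Γ(M, U)} {m' n' : Γ(M', U)}

lemma mres {U' : S.Opens} (hU : U' ≤ U) (h : LinearPartRel θ U m m') :
    LinearPartRel θ U' (FqBundle.mres M hU m) (FqBundle.mres M' hU m') := by
  intro T hT e he
  rw [ofOpen_mres, ofOpen_mres]
  exact h T _ e he

lemma add (hθ : IsAddMonHom θ) (h : LinearPartRel θ U m m') (h' : LinearPartRel θ U n n') :
    LinearPartRel θ U (m + n) (m' + n') := by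
  intro T hT e he
  rw [ofOpen_add, ofOpen_add, smul_add, smul_add, W.pt_add, W'.pt_add,
    add_comp_of_isAddMonHom θ hθ, h T hT e he, h' T hT e he]

lemma smul (h : LinearPartRel θ U m m') (a : Γ(S, U)) :
    LinearPartRel θ U (a • m) (a • m') := by
  intro T hT e he
  rw [ofOpen_smul, ofOpen_smul, smul_smul, smul_smul]
  refine h T hT _ ?_
  rw [mul_mul_mul_comm, he, zero_mul]

lemma symm {θ : W.X ≅ W'.X} (h : LinearPartRel θ.hom U m m') : LinearPartRel θ.inv U m' m := by
  intro T hT e he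
  rw [← h T hT e he, Category.assoc, θ.hom_inv_id, Category.comp_id]

/-- Two sections of an invertible sheaf agree if they agree after multiplication by functions of
square zero. -/
lemma _root_.FqBundle.eq_of_forall_smul_eq (hM : IsInvertible M) {U : S.Opens} {m n : Γ(M, U)}
    (h : ∀ (T : Over S) (hT : ⊤ ≤ T.hom ⁻¹ᵁ U) (e : Γ(T.left, ⊤)), e * e = 0 →
      e • ofOpen s T U hT m = e • ofOpen s T U hT n) : m = n := by
  have h1 (x : U) : ∃ (V : S.Opens) (_ : V ≤ U) (_ : IsAffineOpen V) (_ : x.1 ∈ V) (g : Γ(M, V)),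
      IsGen M V g := by
    obtain ⟨V1, hx1, g, hg⟩ := hM.exists_isGen x.1
    obtain ⟨_, ⟨V, hV, rfl⟩, hxV, hVU⟩ := S.isBasis_affineOpens.exists_subset_of_mem_open
      (show x.1 ∈ V1 ⊓ U from ⟨hx1, x.2⟩) (V1 ⊓ U).isOpen
    exact ⟨V, fun y hy => (hVU hy).2, hV, hxV, _, hg.mres fun y hy => (hVU hy).1⟩
  choose V hVU hV hx g hg using h1
  refine mres_ext M U V hVU (fun x hx' => ⟨⟨x, hx'⟩, hx _⟩) fun x => ?_
  let A : CommRingCat.{u} := Γ(S, V x)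
  let j : Spec A ⟶ S := (hV x).fromSpec
  have hj : ⊤ ≤ j ⁻¹ᵁ V x := by simp [j]
  have hjU : ⊤ ≤ (Over.mk j).hom ⁻¹ᵁ U := fun y _ => hVU x (hj trivial)
  have : IsOpenImmersion (Over.mk j).hom := (hV x).isOpenImmersion_fromSpec
  refine (ofOpen_bijective (s := s) (T := Over.mk j) (V x) hj (hV x).opensRange_fromSpec.ge).1 ?_
  rw [ofOpen_mres, ofOpen_mres]
  have hg0 := (hg x).isGenerator_ofOpen (s := s) (Over.mk j) hj
  obtain ⟨a', ha⟩ := hg0.bijective.2 (ofOpen s (Over.mk j) U hjU m)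
  obtain ⟨b', hb⟩ := hg0.bijective.2 (ofOpen s (Over.mk j) U hjU n)
  obtain ⟨a, rfl⟩ := (ringOf_id_bijective j).2 a'
  obtain ⟨b, rfl⟩ := (ringOf_id_bijective j).2 b'
  -- Over the dual numbers, a is recovered as the coefficient of ε in εa.
  let B : CommRingCat.{u} := .of (DualNumber A)
  let φ : A ⟶ B := CommRingCat.ofHom (TrivSqZeroExt.inlHom A A)
  let e : Γ((Over.mk (Spec.map φ ≫ j)).left, ⊤) :=
    ringOf (A := B) (𝟙 (Over.mk (Spec.map φ ≫ j))) (DualNumber.eps : DualNumber A)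
  have he : e * e = 0 := by
    refine (map_mul _ _ _).symm.trans ?_
    refine (congrArg _ DualNumber.eps_mul_eps).trans (map_zero _)
  have hT : ⊤ ≤ (Over.mk (Spec.map φ ≫ j)).hom ⁻¹ᵁ U := fun y _ => hVU x (hj trivial)
  have key := h _ hT e he
  rw [← pb_ofOpen (specOver j φ) U hjU hT, ← pb_ofOpen (specOver j φ) U hjU hT, ← ha, ← hb, pb_smul,
    pb_smul, smul_smul, smul_smul, ← ringOf_comp_apply, ← ringOf_comp_apply, Category.comp_id,
    ringOf_specOver, ringOf_specOver] at key
  have key2 := (hg0 _ _).1 key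
  rw [← map_mul, ← map_mul] at key2
  have key3 := congrArg TrivSqZeroExt.snd ((ringOf_id_bijective _).1 key2)
  have hs (c : A) : TrivSqZeroExt.snd ((DualNumber.eps : DualNumber A) *
      TrivSqZeroExt.inlHom A A c) = c := by
    change TrivSqZeroExt.snd ((TrivSqZeroExt.inr 1 : DualNumber A) * TrivSqZeroExt.inl c) = c
    rw [TrivSqZeroExt.inr_mul_inl, TrivSqZeroExt.snd_inr]
    simp
  have key4 : a = b := (hs a).symm.trans (key3.trans (hs b))
  rw [← ha, ← hb, key4]

lemma unique (hM' : IsInvertible M') (h : LinearPartRel θ U m m') (h' : LinearPartRel θ U m n') :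
    m' = n' :=
  eq_of_forall_smul_eq (s := s) hM' fun T hT e he =>
    W'.rep.homEquiv.symm.injective ((h T hT e he).symm.trans (h' T hT e he))

lemma of_cover {ι : Type*} (U' : ι → S.Opens) (hU : ∀ i, U' i ≤ U) (hcov : ∀ x ∈ U, ∃ i, x ∈ U' i)
    (h : ∀ i, LinearPartRel θ (U' i) (FqBundle.mres M (hU i) m) (FqBundle.mres M' (hU i) m')) :
    LinearPartRel θ U m m' := by
  intro T hT e he
  let T' (i : ι) : Over S := Over.mk ((T.hom ⁻¹ᵁ U' i).ι ≫ T.hom)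
  let p (i : ι) : T' i ⟶ T := Over.homMk (T.hom ⁻¹ᵁ U' i).ι
  have hp (i : ι) : IsOpenImmersion (p i).left :=
    inferInstanceAs (IsOpenImmersion (T.hom ⁻¹ᵁ U' i).ι)
  have hT' (i : ι) : ⊤ ≤ (T' i).hom ⁻¹ᵁ U' i := fun x _ => x.2
  have hT'' (i : ι) : ⊤ ≤ (T' i).hom ⁻¹ᵁ U := (hT' i).trans fun x hx => hU i hx
  refine W'.val_injective (sections_ext p (fun x => ?_) fun i => ?_)
  · obtain ⟨i, hi⟩ := hcov (T.hom x) (hT trivial)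
    exact ⟨i, ⟨x, hi⟩, rfl⟩
  · have e1 := h i (T' i) (hT' i) (fn (p i) e) (by rw [← map_mul, he, map_zero])
    rw [ofOpen_mres, ofOpen_mres] at e1
    rw [← W'.val_comp, ← W'.val_comp, ← Category.assoc, W.comp_pt, W'.comp_pt, pb_smul, pb_smul,
      pb_ofOpen (p i) U hT (hT'' i), pb_ofOpen (p i) U hT (hT'' i), e1]

/-- In coordinates θ is a polynomial Q, read off from the tautological point, with Q(0) = 0; its
linear part is multiplication by `Q.coeff 1`. -/
lemma exists_of_isGen (hθ : IsAddMonHom θ) (hU : IsAffineOpen U) {g : Γ(M, U)} (hg : IsGen M U g)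
    {g' : Γ(M', U)} (hg' : IsGen M' U g') (m : Γ(M, U)) : ∃ m', LinearPartRel θ U m m' := by
  let A : CommRingCat.{u} := Γ(S, U)
  let j : Spec A ⟶ S := hU.fromSpec
  have hj : ⊤ ≤ j ⁻¹ᵁ U := by simp [j]
  have : IsOpenImmersion j := hU.isOpenImmersion_fromSpec
  have : IsOpenImmersion (Over.mk j).hom := this
  have hbij (N : S.Modules) := ofOpen_bijective (L := N) (s := s) (T := Over.mk j) U hj
    hU.opensRange_fromSpec.ge
  have hg0 := hg.isGenerator_ofOpen (s := s) (Over.mk j) hj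
  have hg0' := hg'.isGenerator_ofOpen (s := s) (Over.mk j) hj
  generalize ofOpen s (Over.mk j) U hj g = g0 at hg0
  generalize ofOpen s (Over.mk j) U hj g' = g0' at hg0'
  obtain ⟨Q', hQ⟩ := (hg0' _ (affLineProj j)).2 (W'.val (W.chart g0 ≫ θ))
  obtain ⟨Q, rfl⟩ := (ringOf_id_bijective _).2 Q'
  have hθQ {T : Over S} (t : T ⟶ Over.mk j) (b : Γ(T.left, ⊤)) :
      W.pt (b • pb t g0) ≫ θ = W'.pt (Polynomial.eval₂ (ringOf t) b Q • pb t g0') := by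
    obtain ⟨h, rfl, rfl⟩ := exists_affLine_hom t b
    rw [← comp_chart]
    apply W'.val_injective
    rw [Category.assoc, W'.val_comp, ← hQ, pb_smul, ← ringOf_comp_apply, Category.comp_id,
      W'.val_pt,
      pb_comp]
    congr 1
    exact ringOf_affLine h Q
  have hQ0 : Polynomial.coeff Q 0 = 0 := by
    have e1 := hθQ (𝟙 _) 0
    rw [zero_smul, W.pt_zero, zero_comp_of_isAddMonHom θ hθ, ← W'.pt_zero] at e1
    have e2 := (W'.rep.homEquiv.symm.injective e1).symm.trans
      (zero_smul Γ((Over.mk j).left, ⊤) (pb (𝟙 (Over.mk j)) g0')).symm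
    have e3 := (hg0' _ _).1 e2
    rw [Polynomial.eval₂_at_zero] at e3
    exact (map_eq_zero_iff _ (ringOf_id_bijective j).1).mp e3
  obtain ⟨a', ha⟩ := hg0.bijective.2 (ofOpen s (Over.mk j) U hj m)
  obtain ⟨a, rfl⟩ := (ringOf_id_bijective j).2 a'
  obtain ⟨m', hm'⟩ := (hbij M').2 (ringOf (𝟙 (Over.mk j)) (Polynomial.coeff Q 1 * a) • g0')
  refine ⟨m', fun T hT e he => ?_⟩
  have hr : Set.range T.hom ⊆ Set.range j := by
    rintro _ ⟨x, rfl⟩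
    exact hU.opensRange_fromSpec.ge (hT (show x ∈ ⊤ from trivial))
  let t : T ⟶ Over.mk j := Over.homMk (IsOpenImmersion.lift j T.hom hr)
    (IsOpenImmersion.lift_fac _ _ _)
  have he' : (e * ringOf t a) * (e * ringOf t a) = 0 := by
    rw [mul_mul_mul_comm, he, zero_mul]
  rw [← pb_ofOpen t U hj hT m, ← pb_ofOpen t U hj hT m', ← ha, hm', pb_smul, pb_smul,
    ← ringOf_comp_apply, ← ringOf_comp_apply, Category.comp_id, smul_smul, smul_smul, hθQ]
  congr 2
  rw [eval₂_of_mul_self_eq_zero (ringOf t) (A := A) Q he', hQ0, map_zero, zero_add, map_mul,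
    mul_left_comm]

/-- The images found locally by `exists_of_isGen` agree on overlaps by `unique`, so they glue. -/
lemma exists_rel (hθ : IsAddMonHom θ) (hM : IsInvertible M) (hM' : IsInvertible M')
    (m : Γ(M, U)) : ∃ m', LinearPartRel θ U m m' := by
  have h1 (x : U) : ∃ (V : S.Opens) (hV : V ≤ U) (_ : x.1 ∈ V) (m' : Γ(M', V)),
      LinearPartRel θ V (FqBundle.mres M hV m) m' := by
    obtain ⟨V1, hx1, g, hg⟩ := hM.exists_isGen x.1
    obtain ⟨V2, hx2, g', hg'⟩ := hM'.exists_isGen x.1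
    obtain ⟨_, ⟨V, hV, rfl⟩, hxV, hVU⟩ := S.isBasis_affineOpens.exists_subset_of_mem_open
      (show x.1 ∈ V1 ⊓ V2 ⊓ U from ⟨⟨hx1, hx2⟩, x.2⟩) (V1 ⊓ V2 ⊓ U).isOpen
    have hV1 : V ≤ V1 := fun y hy => (hVU hy).1.1
    have hV2 : V ≤ V2 := fun y hy => (hVU hy).1.2
    have hVU' : V ≤ U := fun y hy => (hVU hy).2
    exact ⟨V, hVU', hxV, exists_of_isGen hθ hV (hg.mres hV1) (hg'.mres hV2) _⟩
  choose V hV hx m' hm' using h1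
  obtain ⟨t, ht⟩ := mres_glue M' U V hV (fun x hx' => ⟨⟨x, hx'⟩, hx _⟩) m'
    fun i j Z hi hj => by
      have e1 := (hm' i).mres hi
      have e2 := (hm' j).mres hj
      rw [mres_mres] at e1 e2
      exact e1.unique hM' e2
  refine ⟨t, of_cover V hV (fun x hx' => ⟨⟨x, hx'⟩, hx _⟩) fun i => ?_⟩
  rw [ht]
  exact hm' i

end LinearPartRel

lemma exists_linearPart_hom (hM : IsInvertible M) (hM' : IsInvertible M') {W : LineBundle s M}
    {W' : LineBundle s M'} {θ : W.X ⟶ W'.X} (hθ : IsAddMonHom θ) :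
    ∃ φ : M ⟶ M', ∀ U m, LinearPartRel θ U m (φ.app U m) := by
  choose f hf using fun (U : S.Opens) (m : Γ(M, U)) => LinearPartRel.exists_rel hθ hM hM' m
  obtain ⟨φ, hφ⟩ := exists_modules_hom M M' f
    (fun U x y => (hf U _).unique hM' ((hf U x).add hθ (hf U y)))
    (fun U a x => (hf U _).unique hM' ((hf U x).smul a))
    (fun U V h x => (hf V _).unique hM' ((hf U x).mres h))
  refine ⟨φ, fun U m => ?_⟩
  rw [hφ]
  exact hf U m

/-- Invertible sheaves with isomorphic line bundles are isomorphic. -/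
theorem nonempty_iso_of_lineBundle_iso (hM : IsInvertible M) (hM' : IsInvertible M')
    {W : LineBundle s M} {W' : LineBundle s M'} (θ : W.X ≅ W'.X) (hθ : IsAddMonHom θ.hom) :
    Nonempty (M ≅ M') := by
  have hθ' : IsAddMonHom θ.inv := isAddMonHom_of_add _ fun T a b => by
    rw [← cancel_mono θ.hom, add_comp_of_isAddMonHom _ hθ]
    simp
  obtain ⟨φ, hφ⟩ := exists_linearPart_hom hM hM' hθ
  obtain ⟨ψ, hψ⟩ := exists_linearPart_hom hM' hM hθ'
  refine ⟨⟨φ, ψ, ?_, ?_⟩⟩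
  -- The relation for θ⁻¹ is the opposite of that for θ, and images are unique.
  · ext U m
    exact (hψ U _).unique hM (hφ U m).symm
  · ext U m
    exact (hφ U _).unique hM' (LinearPartRel.symm (θ := θ.symm) (hψ U m))

end LinearPart

/-! ### Generators of tensor powers, before and after sheafification. -/

section TensorPower

open scoped TensorProduct

/-- Presheaves of modules over the structure sheaf of `S`. -/
abbrev PreMod (S : Scheme.{u}) : Type (u + 1) :=
  PresheafOfModules.{u} (S.presheaf ⋙ forget₂ CommRingCat RingCat)

/-- Sections of a presheaf of modules. -/
abbrev psec (P : PreMod S) (U : S.Opens) : Type u := P.obj (.op U)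

/-- Restriction of sections of a presheaf of modules. -/
def pres (P : PreMod S) {U V : S.Opens} (h : V ≤ U) : psec P U →+ psec P V :=
  (P.presheaf.map (homOfLE h).op).hom

lemma pres_smul (P : PreMod S) {U V : S.Opens} (h : V ≤ U) (a : Γ(S, U)) (x : psec P U) :
    pres P h (a • x) = rres S h a • pres P h x :=
  P.map_smul (homOfLE h).op a x

lemma pres_pres (P : PreMod S) {U V W : S.Opens} (h : V ≤ U) (h' : W ≤ V) (x : psec P U) :
    pres P h' (pres P h x) = pres P (h'.trans h) x :=
  congr($(P.presheaf.map_comp (homOfLE h).op (homOfLE h').op) x).symm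

/-- The unit section of the zeroth tensor power. -/
def punit (U : S.Opens) : psec (𝟙_ (PreMod S)) U := (1 : Γ(S, U))

lemma pres_punit {U V : S.Opens} (h : V ≤ U) : pres (𝟙_ (PreMod S)) h (punit U) = punit V :=
  (rres S h).map_one

lemma smul_punit_bijective (U : S.Opens) :
    Function.Bijective fun a : Γ(S, U) => a • punit U := by
  have : (fun a : Γ(S, U) => a • punit U) = fun a => a := funext fun a => mul_one a
  rw [this]
  exact Function.bijective_id

/-- The tensor product of sections. -/
def ptmul {P Q : PreMod S} {U : S.Opens} (x : psec P U) (y : psec Q U) : psec (P ⊗ Q) U :=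
  (x ⊗ₜ[Γ(S, U)] y : (psec P U) ⊗[Γ(S, U)] (psec Q U))

lemma pres_ptmul {P Q : PreMod S} {U V : S.Opens} (h : V ≤ U) (x : psec P U) (y : psec Q U) :
    pres (P ⊗ Q) h (ptmul x y) = ptmul (pres P h x) (pres Q h y) := rfl

lemma ptmul_smul {P Q : PreMod S} {U : S.Opens} (a b : Γ(S, U)) (x : psec P U) (y : psec Q U) :
    ptmul (a • x) (b • y) = (a * b) • ptmul x y :=
  TensorProduct.smul_tmul_smul a b x y

lemma smul_tmul_bijective {R M N : Type*} [CommRing R] [AddCommGroup M] [AddCommGroup N]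
    [Module R M] [Module R N] {m : M} {n : N} (hm : Function.Bijective fun a : R => a • m)
    (hn : Function.Bijective fun a : R => a • n) :
    Function.Bijective fun a : R => a • (m ⊗ₜ[R] n) := by
  let e := (TensorProduct.lid R R).symm.trans (TensorProduct.congr
    (LinearEquiv.ofBijective (LinearMap.toSpanSingleton R M m) hm)
    (LinearEquiv.ofBijective (LinearMap.toSpanSingleton R N n) hn))
  convert e.bijective using 1
  funext a
  have he : e a = ((1 : R) • m) ⊗ₜ[R] (a • n) :=
    rfl
  rw [he, one_smul, TensorProduct.tmul_smul]

lemma smul_ptmul_bijective {P Q : PreMod S} {U : S.Opens} {x : psec P U} {y : psec Q U}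
    (hx : Function.Bijective fun a : Γ(S, U) => a • x)
    (hy : Function.Bijective fun a : Γ(S, U) => a • y) :
    Function.Bijective fun a : Γ(S, U) => a • ptmul x y :=
  smul_tmul_bijective hx hy

/-- The tensor power of a section. -/
def ppow {P : PreMod S} {U : S.Opens} (x : psec P U) : ∀ n, psec (presheafTensorPow P n) U
  | 0 => punit U
  | n + 1 => ptmul (ppow x n) x

lemma pres_ppow {P : PreMod S} {U V : S.Opens} (h : V ≤ U) (x : psec P U) (n : ℕ) :
    pres (presheafTensorPow P n) h (ppow x n) = ppow (pres P h x) n := by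
  induction n with
  | zero => exact pres_punit h
  | succ n ih => exact (pres_ptmul h (ppow x n) x).trans (congrArg (ptmul · _) ih)

lemma ppow_smul {P : PreMod S} {U : S.Opens} (a : Γ(S, U)) (x : psec P U) (n : ℕ) :
    ppow (a • x) n = a ^ n • ppow x n := by
  induction n with
  | zero => exact (by rw [pow_zero, one_smul]; rfl)
  | succ n ih =>
    rw [pow_succ]
    exact (congrArg (ptmul · _) ih).trans (ptmul_smul _ _ _ _)

lemma smul_ppow_bijective {P : PreMod S} {U : S.Opens} {x : psec P U}
    (hx : Function.Bijective fun a : Γ(S, U) => a • x) (n : ℕ) :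
    Function.Bijective fun a : Γ(S, U) => a • ppow x n := by
  induction n with
  | zero => exact smul_punit_bijective U
  | succ n ih => exact smul_ptmul_bijective ih hx

lemma smul_pres_ppow_bijective {P : PreMod S} {U V : S.Opens} (h : V ≤ U) {x : psec P U}
    (hx : Function.Bijective fun a : Γ(S, V) => a • pres P h x) (n : ℕ) :
    Function.Bijective fun a : Γ(S, V) => a • pres (presheafTensorPow P n) h (ppow x n) := by
  rw [pres_ppow]
  exact smul_ppow_bijective hx n

/-- The sheaf of modules associated with a presheaf of modules. -/
abbrev sheafified (P : PreMod S) : S.Modules :=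
  (PresheafOfModules.sheafification (𝟙 S.ringCatSheaf.obj)).obj P

/-- The canonical map to the associated sheaf. -/
def toSheafified (P : PreMod S) (U : S.Opens) : psec P U →+ Γ(sheafified P, U) :=
  ((CategoryTheory.toSheafify (Opens.grothendieckTopology S) P.presheaf).app (.op U)).hom

lemma toSheafified_smul (P : PreMod S) (U : S.Opens) (a : Γ(S, U)) (x : psec P U) :
    toSheafified P U (a • x) = a • toSheafified P U x :=
  ((PresheafOfModules.sheafificationHomEquiv (𝟙 S.ringCatSheaf.obj) (P := P)
    (𝟙 (sheafified P))).app (.op U)).hom.map_smul a x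

lemma mres_toSheafified (P : PreMod S) {U V : S.Opens} (h : V ≤ U) (x : psec P U) :
    mres (sheafified P) h (toSheafified P U x) = toSheafified P V (pres P h x) :=
  congr($((CategoryTheory.toSheafify (Opens.grothendieckTopology S) P.presheaf).naturality
    (homOfLE h).op) x).symm

lemma exists_pres_eq (P : PreMod S) {U : S.Opens} {x y : psec P U}
    (h : toSheafified P U x = toSheafified P U y) (p : S) (hp : p ∈ U) :
    ∃ (V : S.Opens) (hV : V ≤ U), p ∈ V ∧ pres P hV x = pres P hV y := by
  obtain ⟨V, f, hf, hpV⟩ := Presheaf.equalizerSieve_mem (Opens.grothendieckTopology S)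
    (CategoryTheory.toSheafify (Opens.grothendieckTopology S) P.presheaf) x y h p hp
  exact ⟨V, leOfHom f, hpV, hf⟩

lemma exists_toSheafified_eq (P : PreMod S) {U : S.Opens} (x : Γ(sheafified P, U))
    (p : S) (hp : p ∈ U) :
    ∃ (V : S.Opens) (hV : V ≤ U) (y : psec P V), p ∈ V ∧
      toSheafified P V y = mres (sheafified P) hV x := by
  obtain ⟨V, f, ⟨y, hy⟩, hpV⟩ := Presheaf.imageSieve_mem (Opens.grothendieckTopology S)
    (CategoryTheory.toSheafify (Opens.grothendieckTopology S) P.presheaf) x p hp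
  exact ⟨V, leOfHom f, y, hpV, hy⟩

/-- Injectivity is local. For surjectivity, a section comes locally from the presheaf and has a
coefficient there; injectivity makes the coefficients agree on overlaps, so they glue to a function.
-/
lemma isGen_toSheafified (P : PreMod S) {U : S.Opens} {g : psec P U}
    (hg : ∀ (V : S.Opens) (h : V ≤ U), Function.Bijective fun a : Γ(S, V) => a • pres P h g) :
    IsGen (sheafified P) U (toSheafified P U g) := by
  have inj (V : S.Opens) (h : V ≤ U) : Function.Injective
      fun a : Γ(S, V) => a • mres (sheafified P) h (toSheafified P U g) := by
    intro a b hab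
    simp only [mres_toSheafified, ← toSheafified_smul] at hab
    choose W hW hp e using fun p : V => exists_pres_eq P hab p p.2
    refine rres_ext V W hW (fun p hp' => ⟨⟨p, hp'⟩, hp _⟩) fun p => ?_
    have := e p
    rw [pres_smul, pres_smul, pres_pres] at this
    exact (hg _ _).1 this
  intro V h
  refine ⟨inj V h, fun x => ?_⟩
  choose W hW y hp e using fun p : V => exists_toSheafified_eq P x p p.2
  choose a ha using fun p : V => (hg (W p) ((hW p).trans h)).2 (y p)
  have ha' (p : V) : a p • mres (sheafified P) ((hW p).trans h) (toSheafified P U g) =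
      mres (sheafified P) (hW p) x := by
    rw [← e, ← ha, toSheafified_smul, mres_toSheafified]
  obtain ⟨c, hc⟩ := rres_glue V W hW (fun p hp' => ⟨⟨p, hp'⟩, hp _⟩) a fun p q Z hi hj => by
    refine inj Z (hi.trans ((hW p).trans h)) ?_
    have e1 := congrArg (mres (sheafified P) hi) (ha' p)
    have e2 := congrArg (mres (sheafified P) hj) (ha' q)
    rw [mres_smul, mres_mres, mres_mres] at e1 e2
    exact e1.trans e2.symm
  refine ⟨c, mres_ext (sheafified P) V W hW (fun p hp' => ⟨⟨p, hp'⟩, hp _⟩) fun p => ?_⟩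
  rw [mres_smul, hc, mres_mres, ha']

end TensorPower

/-! ### Power maps from L and the charts they provide. -/

section PowerMap

variable {k : Type u} [Field k] {s : S ⟶ Spec (.of k)} {L M : S.Modules} {ρ : S → ℕ}

/-- A map from the sections of `L` to those of `M` that behaves like the `ρ`-th power, where `ρ` is
constant. -/
structure PowerMap (L M : S.Modules) (ρ : S → ℕ) where
  toFun : ∀ U : S.Opens, Γ(L, U) → Γ(M, U)
  mres_toFun : ∀ (U V : S.Opens) (h : V ≤ U) (g : Γ(L, U)),
    mres M h (toFun U g) = toFun V (mres L h g)
  map_smul : ∀ (U : S.Opens) (r : ℕ), (∀ x ∈ U, ρ x = r) → ∀ (a : Γ(S, U)) (g : Γ(L, U)),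
    toFun U (a • g) = a ^ r • toFun U g
  isGen : ∀ (U : S.Opens) (r : ℕ), (∀ x ∈ U, ρ x = r) → ∀ g : Γ(L, U), IsGen L U g →
    IsGen M U (toFun U g)

/-- The power map to the tensor power. -/
def tensorPowerMap (L : S.Modules) (n : ℕ) : PowerMap L (tensorPow L n) fun _ => n where
  toFun U g := toSheafified _ U (ppow (P := (Scheme.Modules.toPresheafOfModules S).obj L) g n)
  mres_toFun U V h g := (mres_toSheafified _ h _).trans (congrArg _ (pres_ppow _ _ _))
  map_smul U r hr a g := by
    -- On the empty set the constant value r is arbitrary, and the identity holds because a sheaf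
    -- has only one section there.
    by_cases hU : U = ⊥
    · subst hU
      exact mres_ext _ ⊥ (fun i : Empty => i.elim) (fun i => i.elim) (fun x hx => hx.elim)
        fun i => i.elim
    · obtain ⟨x, hx⟩ := (TopologicalSpace.Opens.ne_bot_iff_nonempty U).mp hU
      obtain rfl := hr x hx
      exact (congrArg _ (ppow_smul _ _ _)).trans (toSheafified_smul _ _ _ _)
  isGen U r _ g hg := isGen_toSheafified _ fun V h =>
    smul_pres_ppow_bijective (P := (Scheme.Modules.toPresheafOfModules S).obj L) h (hg V h) n

lemma exists_affine_const (hL : IsInvertible L) (hρ : IsLocallyConstant ρ) (x : S) :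
    ∃ (U : S.Opens) (_ : IsAffineOpen U) (_ : x ∈ U) (g : Γ(L, U)) (_ : IsGen L U g),
      ∀ y ∈ U, ρ y = ρ x := by
  obtain ⟨U, hx, g, hg⟩ := hL.exists_isGen x
  obtain ⟨V, hV, hxV, hVρ⟩ := hρ.exists_open x
  obtain ⟨_, ⟨Z, hZ, rfl⟩, hxZ, hZU⟩ := S.isBasis_affineOpens.exists_subset_of_mem_open
    (show x ∈ U ⊓ ⟨V, hV⟩ from ⟨hx, hxV⟩) (U ⊓ ⟨V, hV⟩).isOpen
  exact ⟨Z, hZ, hxZ, _, hg.mres fun y hy => (hZU hy).1, fun y hy => hVρ y (hZU hy).2⟩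

namespace PowerMap

lemma isInvertible (π : PowerMap L M ρ) (hL : IsInvertible L) (hρ : IsLocallyConstant ρ) :
    IsInvertible M := by
  refine isInvertible_of_isGen fun x => ?_
  obtain ⟨U, -, hx, g, hg, hU⟩ := exists_affine_const hL hρ x
  exact ⟨U, hx, _, π.isGen U _ hU g hg⟩

/-- The affine charts with generators of `L` and `M` that correspond to each other under a power
map. -/
theorem nonempty_powerCharts (π : PowerMap L M ρ) (hL : IsInvertible L)
    (hρ : IsLocallyConstant ρ) (s : S ⟶ Spec (.of k)) : Nonempty (PowerCharts s L M ρ) := by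
  choose U hU hx g hg hr using exists_affine_const hL hρ
  have hj (x : S) : ⊤ ≤ (hU x).fromSpec ⁻¹ᵁ U x := by simp
  refine ⟨{
    ι := S
    A := fun x => Γ(S, U x)
    j := fun x => (hU x).fromSpec
    imm := fun x => (hU x).isOpenImmersion_fromSpec
    surj := fun x => ⟨x, (hU x).opensRange_fromSpec.ge (hx x)⟩
    r := ρ
    hr := fun x y => hr x _ (hj x trivial)
    g := fun x => ofOpen s (Over.mk (hU x).fromSpec) (U x) (hj x) (g x)
    hg := fun x => (hg x).isGenerator_ofOpen _ _
    h := fun x => ofOpen s (Over.mk (hU x).fromSpec) (U x) (hj x) (π.toFun _ (g x))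
    hh := fun x => (π.isGen _ _ (hr x) _ (hg x)).isGenerator_ofOpen _ _
    compat := fun x y T t t' u h => ?_ }⟩
  have hx' : ⊤ ≤ T.hom ⁻¹ᵁ U x := fun z _ => by
    have := hj x (show t.left z ∈ ⊤ from trivial)
    rw [← Over.w t]
    exact this
  have hy' : ⊤ ≤ T.hom ⁻¹ᵁ U y := fun z _ => by
    have := hj y (show t'.left z ∈ ⊤ from trivial)
    rw [← Over.w t']
    exact this
  have hxy : ⊤ ≤ T.hom ⁻¹ᵁ (U x ⊓ U y) := le_inf hx' hy'
  -- v is the transition function of L on the overlap; the given u is its pullback to T.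
  obtain ⟨v, hv : v • _ = _⟩ := (hg x (U x ⊓ U y) inf_le_left).2 (mres L inf_le_right (g y))
  rw [pb_ofOpen t' (U y) (hj y) hy', pb_ofOpen t (U x) (hj x) hx'] at h ⊢
  have e1 {N : S.Modules} (n : Γ(N, U x)) :
      ofOpen s T (U x) hx' n = ofOpen s T _ hxy (mres N inf_le_left n) := (ofOpen_mres _ _ _).symm
  have e2 {N : S.Modules} (n : Γ(N, U y)) :
      ofOpen s T (U y) hy' n = ofOpen s T _ hxy (mres N inf_le_right n) := (ofOpen_mres _ _ _).symm
  rw [e1, e2] at h ⊢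
  rw [← hv, ofOpen_smul] at h
  have hgen := (hg x).mres (V := U x ⊓ U y) inf_le_left |>.isGenerator_ofOpen (s := s) T hxy
  have hu := hgen.bijective.1 h
  rw [π.mres_toFun, π.mres_toFun, ← hv,
      π.map_smul _ (ρ x) fun z (hz : z ∈ U x ⊓ U y) => hr x z hz.1, ofOpen_smul,
    map_pow, map_pow]
  exact congrArg (fun w => w ^ ρ x • _) hu

end PowerMap

end PowerMap

/-! ### Tensor powers with a locally constant exponent. -/

section LocallyConstantPower

variable {L : S.Modules} {ρ : S → ℕ}

/-- Taking sections over U preserves limits, so sections of a product are families of sections. -/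
lemma existsUnique_product_section {ι : Type u} (N : ι → S.Modules) (U : S.Opens)
    (x : ∀ n, Γ(N n, U)) :
    ∃! y : Γ(∏ᶜ N, U), ∀ n, (Pi.π N n).app U y = x n := by
  let E : TopCat.Presheaf Ab S ⥤ Ab := (evaluation _ _).obj (.op U)
  let F : S.Modules ⥤ Type u := Scheme.Modules.toPresheaf S ⋙ E ⋙ forget Ab
  have : PreservesLimits E :=
    inferInstanceAs (PreservesLimits ((evaluation (TopologicalSpace.Opens S)ᵒᵖ Ab).obj (.op U)))
  have : PreservesLimits F := comp_preservesLimits _ _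
  obtain ⟨y, hy, hy'⟩ := (Types.isLimit_iff (F.mapCone (limit.cone (Discrete.functor N)))).mp
    ⟨isLimitOfPreserves F (limit.isLimit _)⟩ (fun j => x j.as) (by
      rintro ⟨i⟩ ⟨j⟩ f
      obtain rfl := Discrete.eq_of_hom f
      obtain rfl : f = 𝟙 _ := Subsingleton.elim _ _
      exact congr($((Discrete.functor N ⋙ F).map_id ⟨i⟩) (x i)))
  exact ⟨y, fun n => hy ⟨n⟩, fun z hz => hy' z fun j => hz j.as⟩

lemma subsingleton_of_disjoint (M : S.Modules) {U : S.Opens} (h : ∀ x, x ∉ U) :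
    Subsingleton Γ(M, U) :=
  ⟨fun _ _ => mres_ext M U (fun i : Empty => i.elim) (fun i => i.elim)
    (fun x hx => (h x hx).elim) fun i => i.elim⟩

/-- The extension by zero, for an open and closed subset `Z`, of the restriction of `M` to `Z`. -/
def cutOff (M : S.Modules) (Z : S.Opens) : S.Modules :=
  (Scheme.Modules.pushforward Z.ι).obj (M.restrict Z.ι)

/-- The restriction to `Z`. -/
def toCutOff (M : S.Modules) (Z : S.Opens) : M ⟶ cutOff M Z :=
  (Scheme.Modules.restrictAdjunction Z.ι).unit.app M

lemma toCutOff_bijective (M : S.Modules) {U Z : S.Opens} (h : U ≤ Z) :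
    Function.Bijective ((toCutOff M Z).app U) := by
  refine mres_bijective M (U := U) (V := Z.ι ''ᵁ Z.ι ⁻¹ᵁ U) (Z.ι.image_preimage_le U) ?_
  rw [Z.ι.image_preimage_eq_opensRange_inf]
  exact le_inf (by simpa using h) le_rfl

lemma subsingleton_cutOff (M : S.Modules) {U Z : S.Opens} (h : ∀ x ∈ U, x ∉ Z) :
    Subsingleton Γ(cutOff M Z, U) :=
  subsingleton_of_disjoint M (U := Z.ι ''ᵁ Z.ι ⁻¹ᵁ U) (by
    rintro _ ⟨y, hy, rfl⟩
    exact h _ hy y.2)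

/-- The open subset where a locally constant function takes the value `n`. -/
def levelSet (hρ : IsLocallyConstant ρ) (n : ℕ) : S.Opens := ⟨ρ ⁻¹' {n}, hρ {n}⟩

/-- The sheaf whose restriction to the open subset where `ρ = n` is the `n`-th tensor power
of `L`. -/
def locPow (L : S.Modules) (hρ : IsLocallyConstant ρ) : S.Modules :=
  ∏ᶜ fun n : ULift.{u} ℕ => cutOff (tensorPow L n.down) (levelSet hρ n.down)

/-- The projections of `locPow`. -/
def locPowProj (L : S.Modules) (hρ : IsLocallyConstant ρ) (n : ℕ) :
    locPow L hρ ⟶ cutOff (tensorPow L n) (levelSet hρ n) :=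
  Pi.π (fun n : ULift.{u} ℕ => cutOff (tensorPow L n.down) (levelSet hρ n.down)) ⟨n⟩

lemma existsUnique_locPow (L : S.Modules) (hρ : IsLocallyConstant ρ) (U : S.Opens)
    (x : ∀ n, Γ(cutOff (tensorPow L n) (levelSet hρ n), U)) :
    ∃! y : Γ(locPow L hρ, U), ∀ n, (locPowProj L hρ n).app U y = x n := by
  obtain ⟨y, hy, hy'⟩ := existsUnique_product_section
    (fun n : ULift.{u} ℕ => cutOff (tensorPow L n.down) (levelSet hρ n.down)) U fun n => x n.down
  exact ⟨y, fun n => hy ⟨n⟩, fun z hz => hy' z fun n => hz n.down⟩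

lemma locPow_ext {hρ : IsLocallyConstant ρ} {U : S.Opens} {y z : Γ(locPow L hρ, U)}
    (h : ∀ n, (locPowProj L hρ n).app U y = (locPowProj L hρ n).app U z) : y = z :=
  (existsUnique_locPow L hρ U _).unique h fun _ => rfl

/-- Where ρ = r, all factors of the product other than the r-th have only the zero section. -/
lemma locPowProj_bijective (hρ : IsLocallyConstant ρ) {U : S.Opens} {r : ℕ}
    (hr : ∀ x ∈ U, ρ x = r) : Function.Bijective ((locPowProj L hρ r).app U) := by
  have hs (n : ℕ) (hn : n ≠ r) : Subsingleton Γ(cutOff (tensorPow L n) (levelSet hρ n), U) :=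
    subsingleton_cutOff _ fun x hx hx' => hn (hx'.symm.trans (hr x hx))
  refine ⟨fun y z h => locPow_ext fun n => ?_, fun y => ?_⟩
  · by_cases hn : n = r
    · subst hn
      exact h
    · have := hs n hn
      exact Subsingleton.elim _ _
  · obtain ⟨z, hz, -⟩ := existsUnique_locPow L hρ U (Function.update (fun n => 0) r y)
    exact ⟨z, (hz r).trans (Function.update_self _ _ _)⟩

/-- The power map for a locally constant exponent. -/
def locPowMap (L : S.Modules) (hρ : IsLocallyConstant ρ) : PowerMap L (locPow L hρ) ρ :=
  have hspec (U : S.Opens) (g : Γ(L, U)) := (existsUnique_locPow L hρ U fun n =>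
    (toCutOff (tensorPow L n) (levelSet hρ n)).app U ((tensorPowerMap L n).toFun U g)).choose_spec.1
  have hsmul (U : S.Opens) (r : ℕ) (hr : ∀ x ∈ U, ρ x = r) (a : Γ(S, U)) (g : Γ(L, U)) :
    (existsUnique_locPow L hρ U fun n => (toCutOff (tensorPow L n) (levelSet hρ n)).app U
      ((tensorPowerMap L n).toFun U (a • g))).choose = a ^ r •
    (existsUnique_locPow L hρ U fun n => (toCutOff (tensorPow L n) (levelSet hρ n)).app U
      ((tensorPowerMap L n).toFun U g)).choose :=
    (locPowProj_bijective hρ hr).1 (by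
      rw [hspec, Scheme.Modules.Hom.app_smul, hspec,
        (tensorPowerMap L r).map_smul U r (fun _ _ => rfl), Scheme.Modules.Hom.app_smul])
  { toFun := fun U g => (existsUnique_locPow L hρ U fun n =>
      (toCutOff (tensorPow L n) (levelSet hρ n)).app U ((tensorPowerMap L n).toFun U g)).choose
    mres_toFun := fun U V h g => locPow_ext fun n => by
      rw [hom_mres, hspec, hspec, ← hom_mres, (tensorPowerMap L n).mres_toFun]
    map_smul := hsmul
    isGen := fun U r hr g hg V hV => by
      have hrV (x) (hx : x ∈ V) : ρ x = r := hr x (hV hx)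
      rw [← (locPowProj_bijective hρ hrV).of_comp_iff' ]
      have := (toCutOff_bijective (tensorPow L r) (Z := levelSet hρ r) hrV).comp
        ((tensorPowerMap L r).isGen U r (fun _ _ => rfl) g hg V hV)
      convert this using 1
      funext a
      simp only [Function.comp_apply, Scheme.Modules.Hom.app_smul]
      rw [hom_mres, hspec, hom_mres] }

end LocallyConstantPower

/-- Over a locally noetherian base, finite type implies finite presentation, and the rank of a
finite flat morphism of finite presentation is locally constant. -/
lemma isLocallyConstant_finrank [IsLocallyNoetherian S] {X : Scheme.{u}} (f : X ⟶ S)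
    (hfin : IsFinite f) (hflat : Flat f) : IsLocallyConstant f.finrank :=
  have : LocallyOfFinitePresentation f :=
    LocallyOfFinitePresentation.iff_locallyOfFiniteType.2 inferInstance
  f.isLocallyConstant_finrank

/-- The quotient of a line bundle by a finite flat subgroup scheme, with values in the line bundle
of a module that receives a power map from `L`. -/
lemma PowerMap.exists_isShortExact {k : Type u} [Field k] [Finite k] {s : S ⟶ Spec (.of k)}
    {L M : S.Modules} (hL : IsInvertible L) (V : LineBundle s L) {G : Over S} [AddGrpObj G]
    {i : G ⟶ V.X} (hi : V.IsFiniteFlatFqSubgroup i)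
    (hG : ∀ x : S, ∃ n : ℕ, G.hom.finrank x = Nat.card k ^ n)
    (hρ : IsLocallyConstant G.hom.finrank) (π : PowerMap L M G.hom.finrank) :
    IsInvertible M ∧ ∃ (W : LineBundle s M) (ξ : V.X ⟶ W.X), V.IsFqHom W ξ ∧ IsShortExact i ξ ∧
      IsFinite ξ.left ∧ Flat ξ.left ∧
      ∀ y, ξ.left.finrank y = G.hom.finrank (W.X.hom y) := by
  have hM := π.isInvertible hL hρ
  obtain ⟨D⟩ := π.nonempty_powerCharts hL hρ s
  obtain ⟨W⟩ := nonempty_lineBundle (s := s) hM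
  exact ⟨hM, W, PowerCharts.exists_quotient hi hG D W⟩

end FqBundle

end

theorem mainTheorem10 (k : Type u) [Field k] [Finite k] (S : Scheme.{u}) [IsLocallyNoetherian S]
    (s : S ⟶ Spec (.of k)) (L : S.Modules) (hL : FqBundle.IsInvertible L) :
    Nonempty (FqBundle.LineBundle s L) ∧
    ∀ (V : FqBundle.LineBundle s L) (G : Over S) [AddGrpObj G] (i : G ⟶ V.X),
      V.IsFiniteFlatFqSubgroup i →
      (∀ x : S, ∃ n : ℕ, G.hom.finrank x = Nat.card k ^ n) →
      (∃ (M : S.Modules) (_ : FqBundle.IsInvertible M) (W : FqBundle.LineBundle s M)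
        (ξ : V.X ⟶ W.X), V.IsFqHom W ξ ∧ FqBundle.IsShortExact i ξ) ∧
      (∀ (M M' : S.Modules), FqBundle.IsInvertible M → FqBundle.IsInvertible M' →
        ∀ (W : FqBundle.LineBundle s M) (W' : FqBundle.LineBundle s M')
          (ξ : V.X ⟶ W.X) (ξ' : V.X ⟶ W'.X),
          V.IsFqHom W ξ → FqBundle.IsShortExact i ξ →
          V.IsFqHom W' ξ' → FqBundle.IsShortExact i ξ' →
          ∃! θ : W.X ≅ W'.X, W.IsFqHom W' θ.hom ∧ ξ ≫ θ.hom = ξ') ∧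
      (ConnectedSpace S → ∃ r : ℕ, (∀ x : S, G.hom.finrank x = r) ∧
        ∀ (M : S.Modules), FqBundle.IsInvertible M →
          ∀ (W : FqBundle.LineBundle s M) (ξ : V.X ⟶ W.X),
            V.IsFqHom W ξ → FqBundle.IsShortExact i ξ →
            Nonempty (M ≅ FqBundle.tensorPow L r) ∧
            IsFinite ξ.left ∧ Flat ξ.left ∧ ∀ y : W.X.left, ξ.left.finrank y = r) := by
  refine ⟨FqBundle.nonempty_lineBundle hL, fun V G _ i hi hG => ⟨?_, ?_, fun hS => ?_⟩⟩
  · have hρ := FqBundle.isLocallyConstant_finrank G.hom hi.finite hi.flat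
    -- The rank may vary between components, so M is the tensor power of L with the rank as locally
    -- constant exponent.
    obtain ⟨hM, W, ξ, hξ, he, -⟩ :=
      (FqBundle.locPowMap L hρ).exists_isShortExact hL V hi hG hρ
    exact ⟨_, hM, W, ξ, hξ, he⟩
  · intro M M' _ _ W W' ξ ξ' hξ he hξ' he'
    exact FqBundle.existsUnique_iso hi.isHom hξ he hξ' he'
  · have hρ := FqBundle.isLocallyConstant_finrank G.hom hi.finite hi.flat
    obtain ⟨x₀⟩ := hS.toNonempty
    have hr (x : S) : G.hom.finrank x = G.hom.finrank x₀ :=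
      hρ.apply_eq_of_preconnectedSpace x x₀
    refine ⟨G.hom.finrank x₀, hr, fun M hM W ξ hξ he => ?_⟩
    have π : FqBundle.PowerMap L (FqBundle.tensorPow L (G.hom.finrank x₀)) G.hom.finrank :=
      (funext hr : G.hom.finrank = fun _ => G.hom.finrank x₀) ▸
        FqBundle.tensorPowerMap L (G.hom.finrank x₀)
    obtain ⟨hM', W', ξ', hξ', he', hfin, hflat, hrank⟩ := π.exists_isShortExact hL V hi hG hρ
    -- The given pair is isomorphic to the one constructed with values in L^{⊗r}, from which
    -- everything is transported.
    obtain ⟨θ, ⟨hθ, hθξ⟩, -⟩ := FqBundle.existsUnique_iso hi.isHom hξ he hξ' he'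
    obtain ⟨h₁, h₂, h₃⟩ := FqBundle.finite_flat_of_iso θ hθξ hfin hflat
    exact ⟨FqBundle.nonempty_iso_of_lineBundle_iso hM hM' θ hθ.isHom, h₁, h₂,
      fun y => by rw [h₃, hrank, hr]⟩
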